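/- **Conventions.** Let $S$ be a nonempty geodesic metric space. A *geodesic* in $S$ is the image of an isometric embedding of a nonempty closed interval of $\mathbf R$ (a segment, ray or line). A $(\lambda,\mu)$-quasigeodesic ($\lambda\ge1$, $\mu\ge0$) is a map $q$ from an interval $[a,b]$ with $\frac1\lambda|s-t|-\mu\le d(q(s),q(t))\le\lambda|s-t|+\mu$. For $M:\mathbf R^2\to\mathbf R$, a geodesic $\alpha$ in a metric space is *$M$-Morse* if every $(\lambda,\mu)$-quasigeodesic with endpoints on $\alpha$ lies in the $M(\lambda,\mu)$-neighbourhood of $\alpha$. Write $\pi_\alpha(x)$ for the set of closest points of $\alpha$ to $x$; $\alpha$ is *$D$-strongly contracting* if $\operatorname{diam}\pi_\alpha(B)<D$ for every closed ball $B$ disjoint from $\alpha$. **The space $X$.** Let $\alpha:[0,20D]\to S$ be a $D$-strongly contracting geodesic with $D\ge1$, and let $I=\alpha[a,a+10D]$, with $0<a$ and $a+10D<20D$. The *curtain* dual to $\alpha$ at $I$ is $\mathfrak h=\{x:\pi_\alpha(x)\subset I\}$, with halfspaces $\mathfrak h^-$ and $\mathfrak h^+$, the sets of $x$ such that $\pi_\alpha(x)$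 meets $\alpha[0,a)$, respectively $\alpha(a+10D,20D]$. Let $P$ be the set of all bipartitions $\{\mathfrak h^-\cup\mathfrak h,\mathfrak h^+\}$ and $\{\mathfrak h^-,\mathfrak h\cup\mathfrak h^+\}$ of $S$ induced by curtains. Disjoint curtains $\mathfrak h,\mathfrak k$ are *$R$-ball-separated* if there is a ball $B\subset\mathfrak h^+\cap\mathfrak k^-$ of radius at most $R$ that meets every geodesic from $\mathfrak h^-$ to $\mathfrak k^+$. An *$R$-chain* is a sequence of curtains $(\mathfrak h_i)$, indexed by a (finite or infinite) interval of integers, such that for $i<j$ we have $\mathfrak h_i\subset\mathfrak h_j^-$ and $\mathfrak h_j\subset\mathfrak h_i^+$, and $\mathfrak h_i,\mathfrak h_j$ are $R$-ball-separated. For an integer $R\ge1$ let $\mathcal C_R$ be the collection of all sets $\{h_i\}\subset P$ whose elements form a chain (their halfspaces can be labelled so that $h_i^-\subset h_j^-$ for $i<j$) and are induced by the members of an $R$-chain $(\mathfrak h_i)$. An *ultrafilter* on $P$ is a choice of halfspace for each $h\in P$ such that whenever a halfspace $A$ of $h$ is contained in a halfspace $B$ of $k$ and $A$ is chosen for $h$,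 then $B$ is chosen for $k$. Each $s\in S$ determines the ultrafilter $\phi_s$ choosing the halfspaces that contain $s$. Let $d_R(x,y)\in\{0,1,\dots,\infty\}$ be the supremum of $|c|$ over all $c\in\mathcal C_R$ such that $x$ and $y$ choose different halfspaces of every $h\in c$. Fix any numbers $\lambda_R>0$ ($R\ge1$) with $\sum_R\lambda_R(L_R+m_R+1)<\infty$, where $L_R=3R+5$ and $m_R=3$. Put $\mathrm D(x,y)=\sum_{R\ge1}\lambda_Rd_R(x,y)$, and let $X$ be the set of ultrafilters $x$ with $\mathrm D(\phi_s,x)<\infty$ for all $s\in S$, with the metric $\mathrm D$. Isometric actions on $S$ induce isometric actions on $X$. **Groups.** An isometric action of $G$ on $S$ is *proper* if $\{g\in G:d(s,gs)\le r\}$ is finite for all $s\in S$ and $r\in\mathbf R$, and *cobounded* if the translates of some ball cover $S$. A finitely generated subgroup $H$ of a finitely generated group $G$ is *stable* if, for word metrics given by finite generating sets, the inclusion $H\to G$ is a quasiisometric embedding and there is $M:\mathbf R^2\to\mathbf R$ such that every (discrete) geodesic in $G$ between points of $H$ is $M$-Morse. **Theorem.** Let $S$ be a nonempty geodesic metric space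 such that for each $M:\mathbf R^2\to\mathbf R$ there exists $D$ such that every $M$-Morse geodesic in $S$ is $D$-strongly contracting. Let $X$ be the space constructed above. Then $X$ contains $\phi_s$ for every $s\in S$, and $X$ is a roughly geodesic, four-point hyperbolic metric space. Moreover, let $G$ be any group acting properly coboundedly by isometries on $S$. Then $G$ is finitely generated, and for all word metrics given by finite generating sets of $G$ and of a finitely generated subgroup $H<G$ and for every $x\in X$, the subgroup $H$ is stable in $G$ if and only if the orbit map $H\to X$, $h\mapsto hx$, is a quasiisometric embedding. Thus $X$ is a universal recognising space for stable subgroups of $G$. -/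

import Mathlib

open Set
open scoped NNReal ENNReal

namespace UniversalSpace

/-! ## Geodesics, quasigeodesics, Morse and strongly contracting sets -/

/-- The restriction of `γ` to `I` is an isometric embedding. -/
def IsGeodesicOn {Y : Type*} [MetricSpace Y] (γ : ℝ → Y) (I : Set ℝ) : Prop :=
  ∀ s ∈ I, ∀ t ∈ I, dist (γ s) (γ t) = |s - t|

/-- Every two points are joined by a geodesic segment. -/
def IsGeodesicSpace (Y : Type*) [MetricSpace Y] : Prop :=
  ∀ x y : Y, ∃ γ : ℝ → Y, IsGeodesicOn γ (Icc 0 (dist x y)) ∧ γ 0 = x ∧ γ (dist x y) = y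

/-- `A` is the image of a geodesic: an isometrically embedded nonempty closed interval of `ℝ`,
which may be a segment, a ray or a whole line. -/
def IsGeodesicSet {Y : Type*} [MetricSpace Y] (A : Set Y) : Prop :=
  ∃ (γ : ℝ → Y) (I : Set ℝ), I.OrdConnected ∧ IsClosed I ∧ I.Nonempty ∧ IsGeodesicOn γ I ∧
    A = γ '' I

/-- `q` restricted to `[a, b]` is a `(l, m)`-quasigeodesic for the distance function `d`
(no continuity is required). -/
def IsQuasigeodesicOn {Y : Type*} (d : Y → Y → ℝ) (l m : ℝ) (q : ℝ → Y) (a b : ℝ) : Prop :=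
  ∀ s ∈ Icc a b, ∀ t ∈ Icc a b,
    |s - t| / l - m ≤ d (q s) (q t) ∧ d (q s) (q t) ≤ l * |s - t| + m

/-- The set `A` is `M`-Morse for the distance function `d`: every `(l, m)`-quasigeodesic with
endpoints in `A` stays in the `M l m`-neighbourhood of `A`. -/
def IsMorse {Y : Type*} (d : Y → Y → ℝ) (M : ℝ → ℝ → ℝ) (A : Set Y) : Prop :=
  ∀ l m : ℝ, 1 ≤ l → 0 ≤ m → ∀ (q : ℝ → Y) (a b : ℝ), a ≤ b → IsQuasigeodesicOn d l m q a b →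
    q a ∈ A → q b ∈ A → ∀ t ∈ Icc a b, ∃ p ∈ A, d (q t) p ≤ M l m

/-- The set of closest points in `A` to `x`. -/
def closestPoints {Y : Type*} [MetricSpace Y] (A : Set Y) (x : Y) : Set Y :=
  {p | p ∈ A ∧ ∀ q ∈ A, dist x p ≤ dist x q}

/-- `A` is `D`-strongly contracting: the closest-point projection to `A` of every ball that is
disjoint from `A` has diameter less than `D`. -/
def StronglyContracting {Y : Type*} [MetricSpace Y] (A : Set Y) (D : ℝ) : Prop :=
  ∀ (x : Y) (r : ℝ), 0 ≤ r → Disjoint (Metric.closedBall x r) A →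
    Metric.ediam (⋃ y ∈ Metric.closedBall x r, closestPoints A y) < ENNReal.ofReal D

/-- Quasiisometric embeddings between sets with distance functions. -/
def IsQIEmbedding {Y Z : Type*} (dY : Y → Y → ℝ) (dZ : Z → Z → ℝ) (f : Y → Z) : Prop :=
  ∃ K C : ℝ, 1 ≤ K ∧ 0 ≤ C ∧ ∀ x y : Y,
    dY x y / K - C ≤ dZ (f x) (f y) ∧ dZ (f x) (f y) ≤ K * dY x y + C

/-! ## Hyperbolicity -/

/-- Four-point hyperbolicity. -/
def IsFourPointHyperbolic (Y : Type*) [MetricSpace Y] : Prop :=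
  ∃ δ : ℝ, ∀ x₁ x₂ x₃ x₄ : Y,
    dist x₁ x₂ + dist x₃ x₄ ≤
      δ + max (dist x₁ x₃ + dist x₂ x₄) (dist x₁ x₄ + dist x₂ x₃)

/-- Any two points are joined by a `(1, k)`-quasiisometrically embedded interval of integers,
with `k` uniform. -/
def IsRoughlyGeodesic (Y : Type*) [MetricSpace Y] : Prop :=
  ∃ k : ℝ, ∀ x y : Y, ∃ (n : ℕ) (z : ℕ → Y), z 0 = x ∧ z n = y ∧
    ∀ i ≤ n, ∀ j ≤ n, |dist (z i) (z j) - dist (i : ℝ) (j : ℝ)| ≤ k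

/-! ## Sets with walls, ultrafilters and duals

A wall of `S` is an unordered pair of subsets of `S`, its two halfspaces; `P` is the set of walls
under consideration. -/

/-- An ultrafilter on `P`: a consistent choice of halfspace for every wall in `P`. -/
@[ext]
structure WallUltrafilter {S : Type*} (P : Set (Sym2 (Set S))) where
  /-- the chosen halfspace -/
  side : P → Set S
  side_mem : ∀ h : P, side h ∈ h.1
  consistent : ∀ (h k : P) (A B : Set S), A ∈ h.1 → B ∈ k.1 → A ⊆ B → side h = A → side k = B

/-- The walls in `c` all separate `x` from `y`. -/
def Separates {S : Type*} {P : Set (Sym2 (Set S))} (c : Set P) (x y : WallUltrafilter P) : Prop :=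
  ∀ h ∈ c, x.side h ≠ y.side h

/-- The extended distance defined by a collection `C` of sets of walls: the supremum of the
cardinalities of the elements of `C` that separate `x` from `y`. -/
noncomputable def dualDist {S : Type*} {P : Set (Sym2 (Set S))} (C : Set (Set P))
    (x y : WallUltrafilter P) : ℕ∞ :=
  ⨆ c ∈ {c | c ∈ C ∧ Separates c x y}, c.encard

/-- The weighted sum `∑_{R ≥ 1} lam R * d_R` of the distances given by a sequence of collections
of sets of walls. -/
noncomputable def gradedDist {S : Type*} {P : Set (Sym2 (Set S))} (C : ℕ+ → Set (Set P))
    (lam : ℕ+ → ℝ≥0) (x y : WallUltrafilter P) : ℝ≥0∞ :=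
  ∑' R : ℕ+, (lam R : ℝ≥0∞) * (dualDist (C R) x y : ℝ≥0∞)

/-! ## Curtains -/

/-- The data of a curtain: a `D`-strongly contracting geodesic `α` of length `20 * D`, `D ≥ 1`,
together with a subgeodesic `α [a, a + 10 * D]` that contains no endpoint of `α`. -/
structure Curtain (S : Type*) [MetricSpace S] where
  D : ℝ
  one_le : 1 ≤ D
  α : ℝ → S
  geodesic : IsGeodesicOn α (Icc 0 (20 * D))
  contracting : StronglyContracting (α '' Icc 0 (20 * D)) D
  a : ℝ
  a_pos : 0 < a
  a_lt : a + 10 * D < 20 * D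

namespace Curtain

/-- The geodesic to which the curtain is dual. -/
def axis {S : Type*} [MetricSpace S] (𝔥 : Curtain S) : Set S := 𝔥.α '' Icc 0 (20 * 𝔥.D)

/-- The curtain itself, as a subset of `S`. -/
def carrier {S : Type*} [MetricSpace S] (𝔥 : Curtain S) : Set S :=
  {x | closestPoints 𝔥.axis x ⊆ 𝔥.α '' Icc 𝔥.a (𝔥.a + 10 * 𝔥.D)}

/-- The first halfspace of the curtain. -/
def minus {S : Type*} [MetricSpace S] (𝔥 : Curtain S) : Set S :=
  {x | (closestPoints 𝔥.axis x ∩ 𝔥.α '' Ico 0 𝔥.a).Nonempty}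

/-- The second halfspace of the curtain. -/
def plus {S : Type*} [MetricSpace S] (𝔥 : Curtain S) : Set S :=
  {x | (closestPoints 𝔥.axis x ∩ 𝔥.α '' Ioc (𝔥.a + 10 * 𝔥.D) (20 * 𝔥.D)).Nonempty}

/-- The two bipartitions of `S` induced by a curtain. -/
def Induces {S : Type*} [MetricSpace S] (𝔥 : Curtain S) (h : Sym2 (Set S)) : Prop :=
  h = s(𝔥.minus ∪ 𝔥.carrier, 𝔥.plus) ∨ h = s(𝔥.minus, 𝔥.carrier ∪ 𝔥.plus)

/-- `R`-ball-separation: some ball of radius at most `R` lies between the two curtains and meets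
every geodesic from the far side of the first to the far side of the second. -/
def BallSeparated {S : Type*} [MetricSpace S] (R : ℝ) (𝔥 𝔨 : Curtain S) : Prop :=
  Disjoint 𝔥.carrier 𝔨.carrier ∧
  ∃ (x : S) (r : ℝ), 0 ≤ r ∧ r ≤ R ∧ Metric.closedBall x r ⊆ 𝔥.plus ∩ 𝔨.minus ∧
    ∀ (γ : ℝ → S) (l : ℝ), 0 ≤ l → IsGeodesicOn γ (Icc 0 l) → γ 0 ∈ 𝔥.minus → γ l ∈ 𝔨.plus →
      (γ '' Icc 0 l ∩ Metric.closedBall x r).Nonempty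

end Curtain

/-- A (finite or infinite) chain of curtains, the members of which are pairwise
`R`-ball-separated. The index set may be any set of integers: it is order-isomorphic to an
interval of integers, so this only changes the labels. The middle one of any three members
separates the other two. -/
structure IsRChain {S : Type*} [MetricSpace S] (R : ℝ) {J : Set ℤ} (𝔥 : J → Curtain S) :
    Prop where
  subset_minus : ∀ i j : J, i < j → (𝔥 i).carrier ⊆ (𝔥 j).minus
  subset_plus : ∀ i j : J, i < j → (𝔥 j).carrier ⊆ (𝔥 i).plus
  separated : ∀ i j : J, i < j → (𝔥 i).BallSeparated R (𝔥 j)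

/-- The set `P` of all bipartitions of `S` induced by curtains. -/
def walls (S : Type*) [MetricSpace S] : Set (Sym2 (Set S)) :=
  {h | ∃ 𝔥 : Curtain S, 𝔥.Induces h}

/-- A chain of walls: a family of walls, whose halfspaces can be labelled so that
the negative ones are nested. -/
def IsWallChain {S : Type*} [MetricSpace S] {J : Set ℤ} (h : J → walls S) : Prop :=
  ∃ m : J → Set S, (∀ i, m i ∈ (h i).1) ∧ ∀ i j, i < j → m i ⊆ m j

/-- The collection `𝓒_R` of all chains of walls that are induced by `R`-chains of curtains. -/
def chains (S : Type*) [MetricSpace S] (R : ℕ+) : Set (Set (walls S)) :=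
  {c | ∃ (J : Set ℤ) (𝔥 : J → Curtain S) (h : J → walls S),
    IsRChain (R : ℝ) 𝔥 ∧ IsWallChain h ∧ (∀ i, (𝔥 i).Induces (h i).1) ∧ c = range h}

/-- The ultrafilters on the set of walls induced by curtains. -/
abbrev Ultra (S : Type*) [MetricSpace S] : Type _ := WallUltrafilter (walls S)

/-! ### Curtains tripartition the space -/

theorem closestPoints_self {Y : Type*} [MetricSpace Y] {A : Set Y} {x p : Y} (hx : x ∈ A)
    (hp : p ∈ closestPoints A x) : p = x := by
  have h := hp.2 x hx
  rw [dist_self] at h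
  exact (dist_le_zero.1 h).symm

theorem StronglyContracting.dist_lt {Y : Type*} [MetricSpace Y] {A : Set Y} {D : ℝ}
    (hA : StronglyContracting A D) (hD : 0 < D) {x p q : Y} (hp : p ∈ closestPoints A x)
    (hq : q ∈ closestPoints A x) : dist p q < D := by
  by_cases hx : x ∈ A
  · rw [closestPoints_self hx hp, closestPoints_self hx hq, dist_self]
    exact hD
  · have h := hA x 0 le_rfl (by simpa [Metric.closedBall_zero] using hx)
    simp only [Metric.closedBall_zero, mem_singleton_iff, iUnion_iUnion_eq_left] at h
    have h' := (Metric.edist_le_ediam_of_mem hp hq).trans_lt h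
    rw [edist_dist] at h'
    exact (ENNReal.ofReal_lt_ofReal_iff hD).1 h'

namespace Curtain

theorem disjoint_minus_carrier {S : Type*} [MetricSpace S] (𝔥 : Curtain S) :
    Disjoint 𝔥.minus 𝔥.carrier := by
  rw [Set.disjoint_left]
  rintro x ⟨p, hp, t, ht, rfl⟩ hx
  obtain ⟨u, hu, hut⟩ := hx hp
  have h1 := 𝔥.one_le
  have h2 := 𝔥.a_pos
  have h3 := 𝔥.a_lt
  have h := 𝔥.geodesic u ⟨by linarith [hu.1], by linarith [hu.2]⟩ t
    ⟨ht.1, by linarith [ht.2]⟩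
  rw [hut, dist_self] at h
  have h4 : u - t = 0 := abs_eq_zero.1 h.symm
  linarith [hu.1, ht.2]

theorem disjoint_carrier_plus {S : Type*} [MetricSpace S] (𝔥 : Curtain S) :
    Disjoint 𝔥.carrier 𝔥.plus := by
  rw [Set.disjoint_right]
  rintro x ⟨p, hp, t, ht, rfl⟩ hx
  obtain ⟨u, hu, hut⟩ := hx hp
  have h1 := 𝔥.one_le
  have h2 := 𝔥.a_pos
  have h3 := 𝔥.a_lt
  have h := 𝔥.geodesic u ⟨by linarith [hu.1], by linarith [hu.2]⟩ t
    ⟨by linarith [ht.1], ht.2⟩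
  rw [hut, dist_self] at h
  have h4 : u - t = 0 := abs_eq_zero.1 h.symm
  linarith [hu.2, ht.1]

theorem disjoint_minus_plus {S : Type*} [MetricSpace S] (𝔥 : Curtain S) :
    Disjoint 𝔥.minus 𝔥.plus := by
  rw [Set.disjoint_left]
  rintro x ⟨p, hp, t, ht, rfl⟩ ⟨q, hq, u, hu, rfl⟩
  have h1 := 𝔥.one_le
  have h2 := 𝔥.a_pos
  have h3 := 𝔥.a_lt
  have h := 𝔥.contracting.dist_lt (by linarith) hp hq
  rw [𝔥.geodesic t ⟨ht.1, by linarith [ht.2]⟩ u ⟨by linarith [hu.1], hu.2⟩] at h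
  have h4 := neg_le_abs (t - u)
  linarith [hu.1, ht.2]

theorem minus_union_carrier_union_plus {S : Type*} [MetricSpace S] (𝔥 : Curtain S) :
    𝔥.minus ∪ 𝔥.carrier ∪ 𝔥.plus = univ := by
  refine eq_univ_of_forall fun x => ?_
  by_cases hx : x ∈ 𝔥.carrier
  · exact Or.inl (Or.inr hx)
  · simp only [carrier, mem_ofPred_eq, not_subset] at hx
    obtain ⟨p, hp, hpI⟩ := hx
    obtain ⟨t, ht, rfl⟩ := hp.1
    by_cases hta : t < 𝔥.a
    · exact Or.inl (Or.inl ⟨𝔥.α t, hp, t, ⟨ht.1, hta⟩, rfl⟩)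
    · by_cases htb : t ≤ 𝔥.a + 10 * 𝔥.D
      · exact (hpI ⟨t, ⟨not_lt.1 hta, htb⟩, rfl⟩).elim
      · exact Or.inr ⟨𝔥.α t, hp, t, ⟨not_le.1 htb, ht.2⟩, rfl⟩

end Curtain

/-- The elements of `walls S` are bipartitions of `S`. -/
theorem exists_eq_compl_of_mem_walls {S : Type*} [MetricSpace S] {h : Sym2 (Set S)}
    (hh : h ∈ walls S) : ∃ A : Set S, h = s(A, Aᶜ) := by
  obtain ⟨𝔥, h𝔥⟩ := hh
  have h1 := Set.disjoint_left.1 𝔥.disjoint_minus_carrier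
  have h2 := Set.disjoint_left.1 𝔥.disjoint_carrier_plus
  have h3 := Set.disjoint_left.1 𝔥.disjoint_minus_plus
  have h4 : ∀ x, (x ∈ 𝔥.minus ∨ x ∈ 𝔥.carrier) ∨ x ∈ 𝔥.plus := fun x => by
    have : x ∈ 𝔥.minus ∪ 𝔥.carrier ∪ 𝔥.plus := by
      rw [𝔥.minus_union_carrier_union_plus]; trivial
    exact this
  rcases h𝔥 with rfl | rfl
  · refine ⟨𝔥.minus ∪ 𝔥.carrier, ?_⟩
    congr 2
    ext x
    simp only [mem_compl_iff, mem_union]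
    have := h4 x
    have := @h2 x
    have := @h3 x
    tauto
  · refine ⟨𝔥.minus, ?_⟩
    congr 2
    ext x
    simp only [mem_compl_iff, mem_union]
    have := h4 x
    have := @h1 x
    have := @h3 x
    tauto

/-- Every point lies in exactly one halfspace of each wall. -/
theorem existsUnique_side {S : Type*} [MetricSpace S] (s : S) (h : walls S) :
    ∃! A : Set S, A ∈ h.1 ∧ s ∈ A := by
  obtain ⟨A, hA⟩ := exists_eq_compl_of_mem_walls h.2
  rw [hA]
  by_cases hs : s ∈ A
  · refine ⟨A, ⟨by simp, hs⟩, ?_⟩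
    rintro B ⟨hB, hsB⟩
    rcases Sym2.mem_iff.1 hB with rfl | rfl
    · rfl
    · exact (hsB hs).elim
  · refine ⟨Aᶜ, ⟨by simp, hs⟩, ?_⟩
    rintro B ⟨hB, hsB⟩
    rcases Sym2.mem_iff.1 hB with rfl | rfl
    · exact (hs hsB).elim
    · rfl

/-- The ultrafilter determined by a point `s` of `S`: every wall is oriented towards `s`. -/
noncomputable def principal {S : Type*} [MetricSpace S] (s : S) : Ultra S where
  side h := (existsUnique_side s h).choose
  side_mem h := (existsUnique_side s h).choose_spec.1.1
  consistent h k A B _ hB hAB hs := by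
    have h1 := (existsUnique_side s h).choose_spec.1.2
    rw [hs] at h1
    exact ((existsUnique_side s k).choose_spec.2 B ⟨hB, hAB h1⟩).symm

theorem principal_side_eq {S : Type*} [MetricSpace S] {s : S} {h : walls S} {A : Set S}
    (hA : A ∈ h.1) (hs : s ∈ A) : (principal s).side h = A :=
  ((existsUnique_side s h).choose_spec.2 A ⟨hA, hs⟩).symm

/-! ### The graded dual -/

/-- Admissible weights for the graded dual: a sequence of positive numbers `lam R`, `R ≥ 1`, with
`∑ lam R * (L_R + m_R + 1) < ∞`, for the separation constants `L_R = 3 * R + 5` and the gluing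
constants `m_R = 3` of the collections `chains S R`. -/
structure Weights where
  lam : ℕ+ → ℝ≥0
  pos : ∀ R, 0 < lam R
  summable : Summable fun R : ℕ+ => lam R * ((3 * (R : ℝ≥0) + 5) + 3 + 1)

/-- The extended metric on the space of ultrafilters. -/
noncomputable def wallDist {S : Type*} [MetricSpace S] (w : Weights) (x y : Ultra S) : ℝ≥0∞ :=
  gradedDist (chains S) w.lam x y

/-- The universal space: the graded dual of `S`. -/
def Space (S : Type*) [MetricSpace S] (w : Weights) : Type _ :=
  {x : Ultra S // ∀ s : S, wallDist w (principal s) x < ∞}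

theorem chains_subset {S : Type*} [MetricSpace S] {R : ℕ+} {c b : Set (walls S)}
    (hc : c ∈ chains S R) (hb : b ⊆ c) : b ∈ chains S R := by
  obtain ⟨J, 𝔥, h, hR, ⟨m, hm, hmm⟩, hi, rfl⟩ := hc
  have hsub : {i : ℤ | ∃ hi : i ∈ J, h ⟨i, hi⟩ ∈ b} ⊆ J := fun i hi => hi.1
  refine ⟨{i : ℤ | ∃ hi : i ∈ J, h ⟨i, hi⟩ ∈ b}, fun i => 𝔥 (inclusion hsub i),
    fun i => h (inclusion hsub i),
    ⟨fun i j hij => hR.subset_minus _ _ hij, fun i j hij => hR.subset_plus _ _ hij,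
      fun i j hij => hR.separated _ _ hij⟩,
    ⟨fun i => m (inclusion hsub i), fun i => hm _, fun i j hij => hmm _ _ hij⟩,
    fun i => hi _, ?_⟩
  ext x
  constructor
  · intro hx
    obtain ⟨i, rfl⟩ := hb hx
    exact ⟨⟨i.1, i.2, hx⟩, rfl⟩
  · rintro ⟨⟨i, hi, hib⟩, rfl⟩
    exact hib

theorem singleton_mem_chains {S : Type*} [MetricSpace S] (R : ℕ+) (h : walls S) :
    {h} ∈ chains S R := by
  obtain ⟨𝔥, h𝔥⟩ := h.2
  have hlt : ∀ i j : ({0} : Set ℤ), ¬ i < j := fun i j => by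
    rw [Subsingleton.elim i j]; exact lt_irrefl _
  refine ⟨{0}, fun _ => 𝔥, fun _ => h, ⟨fun i j hij => (hlt i j hij).elim,
    fun i j hij => (hlt i j hij).elim, fun i j hij => (hlt i j hij).elim⟩,
    ⟨fun _ => h.1.out.1, fun _ => Sym2.out_fst_mem _, fun i j hij => (hlt i j hij).elim⟩,
    fun _ => h𝔥, ?_⟩
  have : Nonempty ({0} : Set ℤ) := ⟨⟨0, rfl⟩⟩
  exact range_const.symm

theorem dualDist_comm {S : Type*} {P : Set (Sym2 (Set S))} (C : Set (Set P))
    (x y : WallUltrafilter P) : dualDist C x y = dualDist C y x := by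
  have h : ∀ c : Set P, Separates c x y ↔ Separates c y x := fun c =>
    ⟨fun h k hk => (h k hk).symm, fun h k hk => (h k hk).symm⟩
  simp only [dualDist, h]

theorem dualDist_self {S : Type*} {P : Set (Sym2 (Set S))} (C : Set (Set P))
    (x : WallUltrafilter P) : dualDist C x x = 0 := by
  refine le_antisymm (iSup₂_le fun c hc => ?_) bot_le
  have : c = ∅ := eq_empty_of_forall_notMem fun h hh => hc.2 h hh rfl
  simp [this]

theorem dualDist_triangle {S : Type*} {P : Set (Sym2 (Set S))} {C : Set (Set P)}
    (hC : ∀ c ∈ C, ∀ b ⊆ c, b ∈ C) (x y z : WallUltrafilter P) :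
    dualDist C x z ≤ dualDist C x y + dualDist C y z := by
  refine iSup₂_le fun c hc => ?_
  have h1 : {h ∈ c | x.side h ≠ y.side h}.encard ≤ dualDist C x y :=
    le_iSup₂_of_le (f := fun (c : Set P) (_ : c ∈ {c | c ∈ C ∧ Separates c x y}) => c.encard) _
      ⟨hC c hc.1 _ (sep_subset _ _), fun h hh => hh.2⟩ le_rfl
  have h2 : {h ∈ c | ¬ x.side h ≠ y.side h}.encard ≤ dualDist C y z :=
    le_iSup₂_of_le (f := fun (c : Set P) (_ : c ∈ {c | c ∈ C ∧ Separates c y z}) => c.encard) _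
      ⟨hC c hc.1 _ (sep_subset _ _), fun h hh => by
        have h3 := hc.2 h hh.1
        rwa [not_not.1 hh.2] at h3⟩ le_rfl
  have h4 : c ⊆ {h ∈ c | x.side h ≠ y.side h} ∪ {h ∈ c | ¬ x.side h ≠ y.side h} := by
    intro h hh
    by_cases h5 : x.side h ≠ y.side h
    · exact Or.inl ⟨hh, h5⟩
    · exact Or.inr ⟨hh, h5⟩
  exact (encard_le_encard h4).trans ((encard_union_le _ _).trans (add_le_add h1 h2))

theorem wallDist_comm {S : Type*} [MetricSpace S] (w : Weights) (x y : Ultra S) :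
    wallDist w x y = wallDist w y x := by
  simp only [wallDist, gradedDist, dualDist_comm _ x y]

theorem wallDist_self {S : Type*} [MetricSpace S] (w : Weights) (x : Ultra S) :
    wallDist w x x = 0 := by
  simp [wallDist, gradedDist, dualDist_self]

theorem wallDist_triangle {S : Type*} [MetricSpace S] (w : Weights) (x y z : Ultra S) :
    wallDist w x z ≤ wallDist w x y + wallDist w y z := by
  simp only [wallDist, gradedDist]
  rw [← ENNReal.tsum_add]
  refine ENNReal.tsum_le_tsum fun R => ?_
  rw [← mul_add, ← ENat.toENNReal_add]
  gcongr
  exact dualDist_triangle (fun c hc b hb => chains_subset hc hb) x y z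

theorem eq_of_wallDist_eq_zero {S : Type*} [MetricSpace S] (w : Weights) {x y : Ultra S}
    (h : wallDist w x y = 0) : x = y := by
  ext1
  funext k
  by_contra hk
  have h1 := ENNReal.tsum_eq_zero.1 h 1
  have h2 : dualDist (chains S 1) x y = 0 := by
    rcases mul_eq_zero.1 h1 with h3 | h3
    · exact ((w.pos 1).ne' (by exact_mod_cast h3)).elim
    · exact_mod_cast h3
  have h3 : ({k} : Set (walls S)).encard ≤ dualDist (chains S 1) x y :=
    le_iSup₂_of_le (f := fun (c : Set (walls S))
      (_ : c ∈ {c | c ∈ chains S 1 ∧ Separates c x y}) => c.encard) _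
      ⟨singleton_mem_chains 1 k, fun h hh => by rw [mem_singleton_iff.1 hh]; exact hk⟩ le_rfl
  rw [h2, encard_singleton] at h3
  simp at h3

theorem Space.wallDist_ne_top {S : Type*} [MetricSpace S] [Nonempty S] {w : Weights}
    (x y : Space S w) : wallDist w x.1 y.1 ≠ ∞ := by
  obtain ⟨s⟩ := ‹Nonempty S›
  refine ((wallDist_triangle w x.1 (principal s) y.1).trans_lt ?_).ne
  rw [wallDist_comm w x.1]
  exact ENNReal.add_lt_top.2 ⟨x.2 s, y.2 s⟩

noncomputable instance {S : Type*} [MetricSpace S] [Nonempty S] (w : Weights) :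
    MetricSpace (Space S w) where
  dist x y := (wallDist w x.1 y.1).toReal
  dist_self x := by simp [wallDist_self]
  dist_comm x y := by rw [wallDist_comm]
  dist_triangle x y z := by
    rw [← ENNReal.toReal_add (Space.wallDist_ne_top x y) (Space.wallDist_ne_top y z)]
    exact ENNReal.toReal_mono
      (ENNReal.add_ne_top.2 ⟨Space.wallDist_ne_top x y, Space.wallDist_ne_top y z⟩)
      (wallDist_triangle w x.1 y.1 z.1)
  eq_of_dist_eq_zero {x y} h := by
    refine Subtype.ext (eq_of_wallDist_eq_zero w ?_)
    rcases (ENNReal.toReal_eq_zero_iff _).1 h with h | h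
    · exact h
    · exact (Space.wallDist_ne_top x y h).elim

/-! ### The action of isometries on the graded dual -/

theorem closestPoints_image {Y : Type*} [MetricSpace Y] (e : Y ≃ᵢ Y) (A : Set Y) (x : Y) :
    closestPoints (e '' A) (e x) = e '' closestPoints A x := by
  ext p
  constructor
  · rintro ⟨⟨q, hq, rfl⟩, h⟩
    refine ⟨q, ⟨hq, fun r hr => ?_⟩, rfl⟩
    simpa [e.isometry.dist_eq] using h (e r) (mem_image_of_mem _ hr)
  · rintro ⟨q, ⟨hq, h⟩, rfl⟩
    refine ⟨mem_image_of_mem _ hq, ?_⟩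
    rintro _ ⟨r, hr, rfl⟩
    simpa [e.isometry.dist_eq] using h r hr

theorem StronglyContracting.image {Y : Type*} [MetricSpace Y] {A : Set Y} {D : ℝ}
    (hA : StronglyContracting A D) (e : Y ≃ᵢ Y) : StronglyContracting (e '' A) D := by
  intro x r hr hd
  obtain ⟨x, rfl⟩ := e.surjective x
  rw [← e.image_closedBall, disjoint_image_iff e.injective] at hd
  rw [← e.image_closedBall, biUnion_image]
  simp only [closestPoints_image]
  rw [← image_iUnion₂, e.isometry.ediam_image]
  exact hA x r hr hd

/-- The image of a curtain under an isometry. -/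
def Curtain.map {S : Type*} [MetricSpace S] (e : S ≃ᵢ S) (𝔥 : Curtain S) : Curtain S where
  D := 𝔥.D
  one_le := 𝔥.one_le
  α := e ∘ 𝔥.α
  geodesic s hs t ht := by
    rw [Function.comp_apply, Function.comp_apply, e.isometry.dist_eq]
    exact 𝔥.geodesic s hs t ht
  contracting := by
    rw [image_comp]
    exact 𝔥.contracting.image e
  a := 𝔥.a
  a_pos := 𝔥.a_pos
  a_lt := 𝔥.a_lt

namespace Curtain

theorem map_axis {S : Type*} [MetricSpace S] (e : S ≃ᵢ S) (𝔥 : Curtain S) :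
    (𝔥.map e).axis = e '' 𝔥.axis := by
  simp only [axis, map, image_comp]

theorem map_carrier {S : Type*} [MetricSpace S] (e : S ≃ᵢ S) (𝔥 : Curtain S) :
    (𝔥.map e).carrier = e '' 𝔥.carrier := by
  ext x
  obtain ⟨x, rfl⟩ := e.surjective x
  rw [e.injective.mem_set_image]
  simp only [carrier, mem_ofPred_eq, map_axis, closestPoints_image]
  simp only [map, image_comp, image_subset_image_iff e.injective]

theorem map_minus {S : Type*} [MetricSpace S] (e : S ≃ᵢ S) (𝔥 : Curtain S) :
    (𝔥.map e).minus = e '' 𝔥.minus := by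
  ext x
  obtain ⟨x, rfl⟩ := e.surjective x
  rw [e.injective.mem_set_image]
  simp only [minus, mem_ofPred_eq, map_axis, closestPoints_image]
  simp only [map, image_comp, ← image_inter e.injective, image_nonempty]

theorem map_plus {S : Type*} [MetricSpace S] (e : S ≃ᵢ S) (𝔥 : Curtain S) :
    (𝔥.map e).plus = e '' 𝔥.plus := by
  ext x
  obtain ⟨x, rfl⟩ := e.surjective x
  rw [e.injective.mem_set_image]
  simp only [plus, mem_ofPred_eq, map_axis, closestPoints_image]
  simp only [map, image_comp, ← image_inter e.injective, image_nonempty]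

theorem Induces.map {S : Type*} [MetricSpace S] {𝔥 : Curtain S} {h : Sym2 (Set S)}
    (hh : 𝔥.Induces h) (e : S ≃ᵢ S) : (𝔥.map e).Induces (h.map (image e)) := by
  rcases hh with rfl | rfl
  · left
    simp only [Sym2.map_mk, map_minus, map_carrier, map_plus, image_union]
  · right
    simp only [Sym2.map_mk, map_minus, map_carrier, map_plus, image_union]

theorem BallSeparated.map {S : Type*} [MetricSpace S] {R : ℝ} {𝔥 𝔨 : Curtain S}
    (hh : 𝔥.BallSeparated R 𝔨) (e : S ≃ᵢ S) : (𝔥.map e).BallSeparated R (𝔨.map e) := by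
  obtain ⟨hd, x, r, h0, hr, hB, hγ⟩ := hh
  refine ⟨?_, e x, r, h0, hr, ?_, ?_⟩
  · rw [map_carrier, map_carrier, disjoint_image_iff e.injective]
    exact hd
  · rw [map_plus, map_minus, ← image_inter e.injective, ← e.image_closedBall]
    exact image_mono hB
  · intro γ l hl hg hm hp
    rw [map_minus] at hm
    rw [map_plus] at hp
    obtain ⟨u, hu, hu'⟩ := hm
    obtain ⟨v, hv, hv'⟩ := hp
    obtain ⟨z, ⟨t, ht, hz⟩, hzB⟩ := hγ (e.symm ∘ γ) l hl
      (fun s hs t ht => by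
        rw [Function.comp_apply, Function.comp_apply, e.symm.isometry.dist_eq]
        exact hg s hs t ht)
      (by rw [Function.comp_apply, ← hu', e.symm_apply_apply]; exact hu)
      (by rw [Function.comp_apply, ← hv', e.symm_apply_apply]; exact hv)
    refine ⟨γ t, ⟨t, ht, rfl⟩, ?_⟩
    rw [← e.image_closedBall]
    refine ⟨z, hzB, ?_⟩
    rw [← hz, Function.comp_apply, e.apply_symm_apply]

end Curtain

theorem IsRChain.map {S : Type*} [MetricSpace S] {R : ℝ} {J : Set ℤ} {𝔥 : J → Curtain S}
    (h : IsRChain R 𝔥) (e : S ≃ᵢ S) : IsRChain R fun i => (𝔥 i).map e where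
  subset_minus i j hij := by
    rw [Curtain.map_carrier, Curtain.map_minus]
    exact image_mono (h.subset_minus i j hij)
  subset_plus i j hij := by
    rw [Curtain.map_carrier, Curtain.map_plus]
    exact image_mono (h.subset_plus i j hij)
  separated i j hij := (h.separated i j hij).map e

/-- The image of a wall under an isometry. -/
def mapWall {S : Type*} [MetricSpace S] (e : S ≃ᵢ S) (h : walls S) : walls S :=
  ⟨h.1.map (image e), by
    obtain ⟨𝔥, h𝔥⟩ := h.2
    exact ⟨𝔥.map e, h𝔥.map e⟩⟩

theorem mapWall_mapWall {S : Type*} [MetricSpace S] (e f : S ≃ᵢ S) (h : walls S) :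
    mapWall e (mapWall f h) = mapWall (f.trans e) h := by
  refine Subtype.ext ?_
  simp only [mapWall, Sym2.map_map]
  congr 1
  funext A
  rw [Function.comp_apply, ← image_comp]
  rfl

theorem mapWall_refl {S : Type*} [MetricSpace S] (h : walls S) :
    mapWall (IsometryEquiv.refl S) h = h := by
  refine Subtype.ext ?_
  have h1 : image (IsometryEquiv.refl S : S → S) = id := by
    funext A
    exact image_id A
  change h.1.map (image (IsometryEquiv.refl S : S → S)) = h.1
  rw [h1, Sym2.map_id, id]

theorem symm_trans_aux {S : Type*} [MetricSpace S] (e : S ≃ᵢ S) :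
    e.trans e.symm = IsometryEquiv.refl S := by
  ext s
  exact e.symm_apply_apply s

theorem trans_symm_aux {S : Type*} [MetricSpace S] (e : S ≃ᵢ S) :
    e.symm.trans e = IsometryEquiv.refl S := by
  ext s
  exact e.apply_symm_apply s

theorem mapWall_symm_mapWall {S : Type*} [MetricSpace S] (e : S ≃ᵢ S) (h : walls S) :
    mapWall e.symm (mapWall e h) = h := by
  rw [mapWall_mapWall, symm_trans_aux, mapWall_refl]

theorem mapWall_mapWall_symm {S : Type*} [MetricSpace S] (e : S ≃ᵢ S) (h : walls S) :
    mapWall e (mapWall e.symm h) = h := by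
  rw [mapWall_mapWall, trans_symm_aux, mapWall_refl]

theorem image_mem_chains {S : Type*} [MetricSpace S] (e : S ≃ᵢ S) {R : ℕ+} {c : Set (walls S)}
    (hc : c ∈ chains S R) : mapWall e '' c ∈ chains S R := by
  obtain ⟨J, 𝔥, h, hR, ⟨m, hm, hmm⟩, hi, rfl⟩ := hc
  refine ⟨J, fun i => (𝔥 i).map e, fun i => mapWall e (h i), hR.map e,
    ⟨fun i => e '' m i, fun i => Sym2.mem_map.2 ⟨m i, hm i, rfl⟩,
      fun i j hij => image_mono (hmm i j hij)⟩, fun i => (hi i).map e, ?_⟩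
  rw [← range_comp]
  rfl

/-- The image of an ultrafilter under an isometry. -/
def mapUltra {S : Type*} [MetricSpace S] (e : S ≃ᵢ S) (x : Ultra S) : Ultra S where
  side h := e '' x.side (mapWall e.symm h)
  side_mem h := by
    obtain ⟨A, hA, hA'⟩ := Sym2.mem_map.1 (x.side_mem (mapWall e.symm h))
    rw [← hA', ← image_comp, e.self_comp_symm, image_id]
    exact hA
  consistent h k A B hA hB hAB hs := by
    have h1 : x.side (mapWall e.symm h) = e.symm '' A := by
      rw [← hs, ← image_comp, e.symm_comp_self, image_id]
    rw [x.consistent (mapWall e.symm h) (mapWall e.symm k) (e.symm '' A) (e.symm '' B)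
      (Sym2.mem_map.2 ⟨A, hA, rfl⟩) (Sym2.mem_map.2 ⟨B, hB, rfl⟩) (image_mono hAB) h1,
      ← image_comp, e.self_comp_symm, image_id]

theorem mapUltra_principal {S : Type*} [MetricSpace S] (e : S ≃ᵢ S) (s : S) :
    mapUltra e (principal s) = principal (e s) := by
  ext1
  funext h
  refine (principal_side_eq ((mapUltra e (principal s)).side_mem h) ?_).symm
  exact mem_image_of_mem e (existsUnique_side s (mapWall e.symm h)).choose_spec.1.2

theorem mapUltra_mapUltra {S : Type*} [MetricSpace S] (e f : S ≃ᵢ S) (x : Ultra S) :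
    mapUltra e (mapUltra f x) = mapUltra (f.trans e) x := by
  ext1
  funext h
  simp only [mapUltra, mapWall_mapWall, ← image_comp]
  rfl

theorem mapUltra_refl {S : Type*} [MetricSpace S] (x : Ultra S) :
    mapUltra (IsometryEquiv.refl S) x = x := by
  ext1
  funext h
  have h1 : mapWall (IsometryEquiv.refl S).symm h = h := mapWall_refl h
  simp only [mapUltra, h1]
  exact image_id _

theorem dualDist_mapUltra_le {S : Type*} [MetricSpace S] (e : S ≃ᵢ S) (R : ℕ+) (x y : Ultra S) :
    dualDist (chains S R) (mapUltra e x) (mapUltra e y) ≤ dualDist (chains S R) x y := by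
  refine iSup₂_le fun c hc => ?_
  have hinj : Function.Injective (mapWall e.symm) :=
    Function.LeftInverse.injective (g := mapWall e) (mapWall_mapWall_symm e)
  rw [← hinj.encard_image c]
  refine le_iSup₂_of_le (f := fun (c : Set (walls S))
      (_ : c ∈ {c | c ∈ chains S R ∧ Separates c x y}) => c.encard) _
      ⟨image_mem_chains e.symm hc.1, ?_⟩ le_rfl
  rintro _ ⟨h, hh, rfl⟩ heq
  exact hc.2 h hh (congrArg (image e) heq)

theorem wallDist_mapUltra {S : Type*} [MetricSpace S] (w : Weights) (e : S ≃ᵢ S)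
    (x y : Ultra S) : wallDist w (mapUltra e x) (mapUltra e y) = wallDist w x y := by
  have key : ∀ (f : S ≃ᵢ S) (u v : Ultra S),
      wallDist w (mapUltra f u) (mapUltra f v) ≤ wallDist w u v := fun f u v =>
    ENNReal.tsum_le_tsum fun R => mul_le_mul_right
      (ENat.toENNReal_mono (dualDist_mapUltra_le f R u v)) _
  refine le_antisymm (key e x y) ?_
  have h := key e.symm (mapUltra e x) (mapUltra e y)
  rwa [mapUltra_mapUltra, mapUltra_mapUltra, symm_trans_aux, mapUltra_refl,
    mapUltra_refl] at h

/-- The action on the universal space that is induced by an isometric action on `S`. -/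
instance {S G : Type*} [MetricSpace S] [Group G] [MulAction G S] [IsIsometricSMul G S]
    (w : Weights) : MulAction G (Space S w) where
  smul g x := ⟨mapUltra (IsometryEquiv.constSMul g) x.1, fun s => by
    have h : principal s
        = mapUltra (IsometryEquiv.constSMul g) (principal (g⁻¹ • s)) := by
      rw [mapUltra_principal, IsometryEquiv.constSMul_apply, smul_inv_smul]
    rw [h, wallDist_mapUltra]
    exact x.2 _⟩
  one_smul x := by
    refine Subtype.ext ?_
    have h : (IsometryEquiv.constSMul (1 : G) : S ≃ᵢ S) = IsometryEquiv.refl S := by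
      ext s
      exact one_smul G s
    change mapUltra (IsometryEquiv.constSMul (1 : G)) x.1 = x.1
    rw [h, mapUltra_refl]
  mul_smul g k x := by
    refine Subtype.ext ?_
    have h : (IsometryEquiv.constSMul (g * k) : S ≃ᵢ S)
        = (IsometryEquiv.constSMul k).trans (IsometryEquiv.constSMul g) := by
      ext s
      exact mul_smul g k s
    change mapUltra (IsometryEquiv.constSMul (g * k)) x.1
      = mapUltra (IsometryEquiv.constSMul g) (mapUltra (IsometryEquiv.constSMul k) x.1)
    rw [h, mapUltra_mapUltra]

instance {S G : Type*} [MetricSpace S] [Nonempty S] [Group G] [MulAction G S]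
    [IsIsometricSMul G S] (w : Weights) : IsIsometricSMul G (Space S w) where
  isometry_smul g := Isometry.of_dist_eq fun x y =>
    congrArg ENNReal.toReal (wallDist_mapUltra w (IsometryEquiv.constSMul g) x.1 y.1)

/-! ## Groups: word metrics, stability, proper cobounded actions -/

/-- The word length of `g` with respect to `T`. -/
noncomputable def wordLength {G : Type*} [Group G] (T : Set G) (g : G) : ℕ :=
  sInf {n | ∃ l : List G, l.length = n ∧ (∀ x ∈ l, x ∈ T ∨ x⁻¹ ∈ T) ∧ l.prod = g}

/-- The (left-invariant) word metric with respect to `T`. -/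
noncomputable def wordDist {G : Type*} [Group G] (T : Set G) (g h : G) : ℝ :=
  wordLength T (g⁻¹ * h)

/-- `A` is the image of a geodesic of the word metric given by `T` that joins points of `H`. -/
def IsWordGeodesicBetween {G : Type*} [Group G] (T : Set G) (H : Subgroup G) (A : Set G) : Prop :=
  ∃ (n : ℕ) (p : ℕ → G), p 0 ∈ H ∧ p n ∈ H ∧
    (∀ i ≤ n, ∀ j ≤ n, wordDist T (p i) (p j) = |(i : ℝ) - (j : ℝ)|) ∧ A = p '' Iic n

/-- Stability of the subgroup `H` (with the word metric given by `U`) in the group `G` (with the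
word metric given by `T`). -/
def IsStable {G : Type*} [Group G] (T : Set G) (H : Subgroup G) (U : Set H) : Prop :=
  IsQIEmbedding (wordDist U) (wordDist T) (fun h : H => (h : G)) ∧
  ∃ M : ℝ → ℝ → ℝ, ∀ A : Set G, IsWordGeodesicBetween T H A → IsMorse (wordDist T) M A

/-- The action is (metrically) proper. -/
def IsProperAction (G S : Type*) [Group G] [MetricSpace S] [MulAction G S] : Prop :=
  ∀ (s : S) (r : ℝ), {g : G | dist s (g • s) ≤ r}.Finite

/-- The translates of some ball cover the space. -/
def IsCoboundedAction (G S : Type*) [Group G] [MetricSpace S] [MulAction G S] : Prop :=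
  ∃ (s : S) (r : ℝ), ∀ y : S, ∃ g : G, dist y (g • s) ≤ r

end UniversalSpace

open UniversalSpace

namespace UniversalSpace

/-! ## Geometry of strongly contracting sets -/

/-! The metric of X is a weighted sum of the counting distances d_R. Each estimate is proved for one
R with an error linear in R, and the weights make the errors summable
(`Weights.summable_mul_linear`).

Two properties of R-chains carry the proof. First, curtains are thick: projection to a strongly
contracting geodesic is 1-Lipschitz up to an additive error (`dist_closest_le`), so crossing a
curtain costs length at least 8, and ball-separation makes these costs add up along a chain
(`le_dist_of_precedes`). Second, chains cannot cross for long: if the sides of two chains meet in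
all four ways and one chain has at least four members, geodesics running along either end of the
other chain must pass through one ball of radius R, so the other chain has at most 3R+5 members
(`length_le_of_crossing`). Hence two chains from x to y, with no member of the second lying before a
member of the first, can be concatenated after deleting O(R) members (`exists_glued_chain`).

For hyperbolicity, a chain from x to y and a chain from z to u are sorted by the positions of the
other two points and reglued into chains from x to u and from z to y; only members separating x, u
from y, z are lost (`chainDist_add_chainDist_le`). Long chains of this type and long chains
separating x, z from y, u would cross, so one type is short for every R simultaneously. Rough
geodesics come from changing the choices of x into those of y along initial segments of a linear
order on the walls that extends inclusion of the sides chosen by x (`exists_interpolate`).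

If H is stable, geodesics of S between points of an H-orbit have uniformly Morse subsegments, which
are D-strongly contracting for one D. Curtains placed along them at intervals of 50D form R-chains
for any R at least 10D, so this single d_R already grows linearly (`le_chainDist_of_contracting`).

Conversely, suppose that H embeds quasiisometrically in X. Since d_R increases with R and is bounded
by the distance of S plus 2, the tail of the series cannot account for linear growth, so one d_R
grows linearly along paths of H-orbit points (`exists_le_chainDist`). Stability of quasigeodesics in
the hyperbolic space X turns such a path into a ladder of pairs of ball-separated curtains
(`exists_ladder`). A quasigeodesic of S between the ends of a ladder cannot make long excursions
away from the separating balls (`Ladder.exists_dist_centre_le`), which gives the Morse property.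
Properness and coboundedness transfer everything between S and G. -/

theorem IsGeodesicSpace.exists_between {Y : Type*} [MetricSpace Y] (hY : IsGeodesicSpace Y)
    (x y : Y) {t : ℝ} (h0 : 0 ≤ t) (h1 : t ≤ dist x y) :
    ∃ z, dist x z = t ∧ dist z y = dist x y - t := by
  obtain ⟨γ, hγ, hx, hy⟩ := hY x y
  refine ⟨γ t, ?_, ?_⟩
  · have := hγ 0 ⟨le_rfl, dist_nonneg⟩ t ⟨h0, h1⟩
    rw [hx] at this
    rw [this, zero_sub, abs_neg, abs_of_nonneg h0]
  · have := hγ t ⟨h0, h1⟩ (dist x y) ⟨dist_nonneg, le_rfl⟩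
    rw [hy] at this
    rw [this, abs_sub_comm, abs_of_nonneg (by linarith)]

/-- The closed ball about x of radius d(x,y) misses A, since d(x,y) is smaller than the distance
from x to A. -/
theorem StronglyContracting.dist_lt_of_dist_lt {Y : Type*} [MetricSpace Y] {A : Set Y} {D : ℝ}
    (hA : StronglyContracting A D) (hD : 0 < D) {x y p q : Y} (hp : p ∈ closestPoints A x)
    (hq : q ∈ closestPoints A y) (h : dist x y < dist x p) : dist p q < D := by
  have h1 := hA x (dist x y) dist_nonneg (by
    rw [Set.disjoint_left]
    intro z hz hzA
    have := hp.2 z hzA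
    rw [Metric.mem_closedBall, dist_comm] at hz
    linarith)
  have h2 := (Metric.edist_le_ediam_of_mem (s := ⋃ z ∈ Metric.closedBall x (dist x y),
    closestPoints A z) (mem_iUnion₂.2 ⟨x, by simp, hp⟩)
    (mem_iUnion₂.2 ⟨y, by simp [dist_comm], hq⟩)).trans_lt h1
  rw [edist_dist] at h2
  exact (ENNReal.ofReal_lt_ofReal_iff hD).1 h2

theorem StronglyContracting.mono {Y : Type*} [MetricSpace Y] {A : Set Y} {D E : ℝ}
    (hA : StronglyContracting A D) (h : D ≤ E) : StronglyContracting A E :=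
  fun x r hr hd => (hA x r hr hd).trans_le (ENNReal.ofReal_le_ofReal h)

theorem mem_closestPoints_self {Y : Type*} [MetricSpace Y] {A : Set Y} {x : Y} (hx : x ∈ A) :
    x ∈ closestPoints A x :=
  ⟨hx, fun q _ => by rw [dist_self]; exact dist_nonneg⟩

section Contraction

variable {Y : Type*} [MetricSpace Y] {A : Set Y} {D : ℝ} (hY : IsGeodesicSpace Y)
  (hA : StronglyContracting A D) (hD : 0 < D) (hne : ∀ x, (closestPoints A x).Nonempty)

include hY hA hD hne

/-- Walk from y towards p in steps of length D. While the walker is farther than D from A, a step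
moves the projection by less than D, so the projection moves no more than the walker; the last
stretch costs D. -/
theorem dist_closest_le_of_mem {y p q : Y} (hp : p ∈ A) (hq : q ∈ closestPoints A y) :
    dist q p ≤ dist y p + D := by
  obtain ⟨n, hn⟩ := exists_nat_ge (dist y p / D)
  rw [div_le_iff₀ hD] at hn
  induction n generalizing y q with
  | zero =>
    have : y = p := by
      rw [← dist_le_zero]
      simpa using hn
    subst this
    rw [closestPoints_self hp hq]
    simp [hD.le]
  | succ n ih =>
    by_cases hr : dist y q ≤ D
    · have := dist_triangle q y p
      rw [dist_comm q y] at this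
      linarith
    · have h1 := hq.2 p hp
      obtain ⟨y', h2, h3⟩ := hY.exists_between y p hD.le (by linarith)
      obtain ⟨q', hq'⟩ := hne y'
      have h4 := hA.dist_lt_of_dist_lt hD hq hq' (by linarith)
      have h5 := ih hq' (by push_cast at hn; linarith)
      have := dist_triangle q q' p
      linarith

/-- The same walk, from y₁ to y₂. If it comes within D of A, the preceding lemma, applied to the
closest point there, finishes it; this accounts for the second D. -/
theorem dist_closest_le {y₁ y₂ q₁ q₂ : Y} (h₁ : q₁ ∈ closestPoints A y₁)
    (h₂ : q₂ ∈ closestPoints A y₂) : dist q₁ q₂ ≤ dist y₁ y₂ + 2 * D := by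
  obtain ⟨n, hn⟩ := exists_nat_ge (dist y₁ y₂ / D)
  rw [div_le_iff₀ hD] at hn
  induction n generalizing y₁ q₁ with
  | zero =>
    have : y₁ = y₂ := by
      rw [← dist_le_zero]
      simpa using hn
    subst this
    have := hA.dist_lt hD h₁ h₂
    rw [dist_self]
    linarith
  | succ n ih =>
    by_cases hr : dist y₁ q₁ ≤ D
    · have h3 := dist_closest_le_of_mem hY hA hD hne h₁.1 h₂
      have h4 := dist_triangle y₂ y₁ q₁
      rw [dist_comm y₂ y₁] at h4
      rw [dist_comm q₂ q₁] at h3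
      linarith
    · by_cases h12 : dist y₁ y₂ ≤ D
      · have := hA.dist_lt_of_dist_lt hD h₁ h₂ (by linarith)
        have := dist_nonneg (x := y₁) (y := y₂)
        linarith
      · obtain ⟨y', h2, h3⟩ := hY.exists_between y₁ y₂ hD.le (by linarith)
        obtain ⟨q', hq'⟩ := hne y'
        have h4 := hA.dist_lt_of_dist_lt hD h₁ hq' (by linarith)
        have h5 := ih hq' (by push_cast at hn; linarith)
        have := dist_triangle q₁ q' q₂
        linarith

omit hne in
-- Used to cut off the initial part of a geodesic from x, along which the projection hardly moves:
-- one may advance to within D of the radius d(x,A) at no cost.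
theorem exists_dist_eq_max {x z q : Y} (hq : q ∈ closestPoints A x) (hxz : dist x q ≤ dist x z) :
    ∃ y, dist x y = max 0 (dist x q - D) ∧ dist y z = dist x z - max 0 (dist x q - D) ∧
      ∀ q' ∈ closestPoints A y, dist q q' < D := by
  obtain ⟨y, h1, h2⟩ := hY.exists_between x z (t := max 0 (dist x q - D)) (le_max_left _ _)
    (max_le dist_nonneg (by linarith))
  refine ⟨y, h1, h2, fun q' hq' => ?_⟩
  by_cases h : dist x q ≤ D
  · rw [max_eq_left (by linarith), dist_eq_zero] at h1
    subst h1
    exact hA.dist_lt hD hq hq'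
  · rw [max_eq_right (by linarith)] at h1
    exact hA.dist_lt_of_dist_lt hD hq hq' (by linarith)

/-- Geodesics from x to a point of A pass near the projection of x. After the free initial part of
length d(x,q) - D, the rest of the geodesic must carry the projection from q to p. -/
theorem dist_add_dist_closest_le_of_mem {x p q : Y} (hp : p ∈ A) (hq : q ∈ closestPoints A x) :
    dist x q + dist q p ≤ dist x p + 3 * D := by
  obtain ⟨y, _, h2, h3⟩ := exists_dist_eq_max hY hA hD hq (hq.2 p hp)
  obtain ⟨q', hq'⟩ := hne y
  have h4 := h3 q' hq'
  have h5 := dist_closest_le_of_mem hY hA hD hne hp hq'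
  have h6 := dist_triangle q q' p
  have h7 := le_max_right 0 (dist x q - D)
  linarith

/-- Cutting the free parts off both ends of a geodesic from x to z leaves a middle part that must
carry the projection from q₁ to q₂. The error consists of D for each cut, D for each projection and
2D from `dist_closest_le`. -/
theorem dist_add_dist_add_dist_le {x z q₁ q₂ : Y} (h₁ : q₁ ∈ closestPoints A x)
    (h₂ : q₂ ∈ closestPoints A z) (h : 2 * D ≤ dist q₁ q₂) :
    dist x q₁ + dist q₁ q₂ + dist z q₂ ≤ dist x z + 6 * D := by
  have hsum : dist x q₁ + dist z q₂ ≤ dist x z := by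
    by_contra! hlt
    have hx : 0 < dist x q₁ := by
      rcases (dist_nonneg (x := x) (y := q₁)).lt_or_eq with h0 | h0
      · exact h0
      · have : x ∈ A := by rw [dist_eq_zero.1 h0.symm]; exact h₁.1
        have := h₂.2 x this
        rw [dist_comm z x] at this
        linarith
    have hz : 0 < dist z q₂ := by
      rcases (dist_nonneg (x := z) (y := q₂)).lt_or_eq with h0 | h0
      · exact h0
      · have : z ∈ A := by rw [dist_eq_zero.1 h0.symm]; exact h₂.1
        have := h₁.2 z this
        linarith
    -- If the free parts overlapped, a point of the geodesic in the overlap would project within D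
    -- of both q₁ and q₂, although these are at least 2D apart.
    obtain ⟨t, ht1, ht2⟩ : ∃ t, max 0 (dist x z - dist z q₂) ≤ t ∧
        t < dist x q₁ ∧ t ≤ dist x z ∧ dist x z - dist z q₂ < t := by
      by_cases hc : dist x z < dist x q₁
      · exact ⟨dist x z, max_le dist_nonneg (by linarith), hc, le_rfl, by linarith⟩
      · have : max 0 (dist x z - dist z q₂) < dist x q₁ := max_lt hx (by linarith)
        obtain ⟨t, h3, h4⟩ := exists_between this
        exact ⟨t, h3.le, h4, by linarith, (le_max_right _ _).trans_lt h3⟩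
    obtain ⟨w, hw1, hw2⟩ := hY.exists_between x z ((le_max_left _ _).trans ht1) ht2.2.1
    obtain ⟨q, hq⟩ := hne w
    have h3 := hA.dist_lt_of_dist_lt hD h₁ hq (by linarith)
    have h4 := hA.dist_lt_of_dist_lt hD h₂ hq (by rw [dist_comm z w]; linarith)
    have := dist_triangle_right q₁ q₂ q
    linarith
  obtain ⟨y, hy1, hy2, hy3⟩ := exists_dist_eq_max hY hA hD h₁
    (z := z) (by have := dist_nonneg (x := z) (y := q₂); linarith)
  have hzy : dist z q₂ ≤ dist z y := by
    rw [dist_comm z y, hy2]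
    have : max 0 (dist x q₁ - D) ≤ dist x q₁ := max_le dist_nonneg (by linarith)
    linarith
  obtain ⟨y', hy1', hy2', hy3'⟩ := exists_dist_eq_max hY hA hD h₂ hzy
  obtain ⟨q, hq⟩ := hne y
  obtain ⟨q', hq'⟩ := hne y'
  have h5 := dist_closest_le hY hA hD hne hq' hq
  have h6 := hy3 q hq
  have h7 := hy3' q' hq'
  have h8 := le_max_right 0 (dist x q₁ - D)
  have h9 := le_max_right 0 (dist z q₂ - D)
  have h10 := dist_triangle4 q₁ q q' q₂
  rw [dist_comm q' q₂, dist_comm q q'] at h10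
  rw [dist_comm z y] at hy2'
  linarith

/-- Applying the previous estimate to both halves of the geodesic counts d(z,q) twice with error
12D, while the remaining terms already add up to at least d(x,y). -/
theorem dist_closest_le_of_between {x y z q₁ q₂ q : Y} (h₁ : q₁ ∈ closestPoints A x)
    (h₂ : q₂ ∈ closestPoints A y) (hq : q ∈ closestPoints A z)
    (hz : dist x z + dist z y = dist x y) (hq₁ : 2 * D ≤ dist q₁ q) (hq₂ : 2 * D ≤ dist q q₂) :
    dist z q ≤ 6 * D := by
  have h3 := dist_add_dist_add_dist_le hY hA hD hne h₁ hq hq₁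
  have h4 := dist_add_dist_add_dist_le hY hA hD hne hq h₂ hq₂
  have h5 := dist_triangle4 x q₁ q₂ y
  have h6 := dist_triangle q₁ q q₂
  rw [dist_comm q₂ y] at h5
  linarith

end Contraction

theorem closestPoints_nonempty {Y : Type*} [MetricSpace Y] {A : Set Y} (hA : IsCompact A)
    (hne : A.Nonempty) (x : Y) : (closestPoints A x).Nonempty := by
  obtain ⟨p, hp, h⟩ := hA.exists_isMinOn hne (f := fun y => dist x y) (by fun_prop)
  exact ⟨p, hp, fun q hq => h hq⟩

theorem IsGeodesicOn.continuousOn {Y : Type*} [MetricSpace Y] {γ : ℝ → Y} {I : Set ℝ}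
    (hγ : IsGeodesicOn γ I) : ContinuousOn γ I := by
  refine LipschitzOnWith.continuousOn (K := 1) (LipschitzOnWith.of_dist_le_mul fun s hs t ht => ?_)
  rw [hγ s hs t ht, Real.dist_eq]
  simp

theorem IsGeodesicOn.mono {Y : Type*} [MetricSpace Y] {γ : ℝ → Y} {I J : Set ℝ}
    (hγ : IsGeodesicOn γ I) (h : J ⊆ I) : IsGeodesicOn γ J :=
  fun s hs t ht => hγ s (h hs) t (h ht)

theorem IsGeodesicOn.closestPoints_nonempty {Y : Type*} [MetricSpace Y] {γ : ℝ → Y} {a b : ℝ}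
    (hγ : IsGeodesicOn γ (Icc a b)) (hab : a ≤ b) (x : Y) :
    (closestPoints (γ '' Icc a b) x).Nonempty :=
  UniversalSpace.closestPoints_nonempty (isCompact_Icc.image_of_continuousOn hγ.continuousOn)
    ((nonempty_Icc.2 hab).image γ) x

/-- A geodesic from `x` to `y`, together with the additivity of distances along it. -/
theorem IsGeodesicOn.dist_add_dist {Y : Type*} [MetricSpace Y] {γ : ℝ → Y} {a b r s t : ℝ}
    (hγ : IsGeodesicOn γ (Icc a b)) (hr : a ≤ r) (hrs : r ≤ s) (hst : s ≤ t) (ht : t ≤ b) :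
    dist (γ r) (γ s) + dist (γ s) (γ t) = dist (γ r) (γ t) := by
  rw [hγ r ⟨hr, by linarith⟩ s ⟨by linarith, by linarith⟩,
    hγ s ⟨by linarith, by linarith⟩ t ⟨by linarith, by linarith⟩,
    hγ r ⟨hr, by linarith⟩ t ⟨by linarith, by linarith⟩,
    abs_of_nonpos (by linarith), abs_of_nonpos (by linarith), abs_of_nonpos (by linarith)]
  ring

/-! ## Coarse intermediate values -/

theorem exists_abs_sub_le_of_nat {f : ℕ → ℝ} {J c : ℝ} {n : ℕ} (h0 : f 0 ≤ c + J)
    (hn : c - J ≤ f n) (hJ : ∀ i < n, |f (i + 1) - f i| ≤ J) (hJ0 : 0 ≤ J) :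
    ∃ i ≤ n, |f i - c| ≤ J := by
  induction n with
  | zero => exact ⟨0, le_rfl, abs_le.2 ⟨by linarith, by linarith⟩⟩
  | succ n ih =>
    by_cases h : c - J ≤ f n
    · obtain ⟨i, hi, h⟩ := ih h fun i hi => hJ i (by omega)
      exact ⟨i, by omega, h⟩
    · refine ⟨n + 1, le_rfl, abs_le.2 ⟨by linarith, ?_⟩⟩
      linarith [le_abs_self (f (n + 1) - f n), hJ n (by omega)]

/-- Sampling at unit steps, truncated at b, reduces this to the discrete version; f need not be
continuous. -/
theorem exists_abs_sub_le_of_Icc {f : ℝ → ℝ} {J a b c : ℝ} (hab : a ≤ b) (ha : f a ≤ c + J)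
    (hb : c - J ≤ f b) (hJ : ∀ s ∈ Icc a b, ∀ t ∈ Icc a b, |s - t| ≤ 1 → |f s - f t| ≤ J) :
    ∃ t ∈ Icc a b, |f t - c| ≤ J := by
  obtain ⟨n, hn⟩ := exists_nat_ge (b - a)
  have hJ0 : 0 ≤ J := (abs_nonneg _).trans (hJ a ⟨le_rfl, hab⟩ a ⟨le_rfl, hab⟩ (by simp))
  have hmem : ∀ i : ℕ, min (a + i) b ∈ Icc a b := fun i =>
    ⟨le_min (by have : (0 : ℝ) ≤ i := i.cast_nonneg
                linarith) hab, min_le_right _ _⟩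
  obtain ⟨i, -, h⟩ := exists_abs_sub_le_of_nat (f := fun i : ℕ => f (min (a + i) b)) (n := n)
    (c := c) (by simpa [hab] using ha) (by rw [min_eq_right (by linarith)]; exact hb)
    (fun i _ => hJ _ (hmem _) _ (hmem _) (by
      push_cast
      refine (abs_min_sub_min_le_max _ _ _ _).trans ?_
      simp)) hJ0
  exact ⟨_, hmem i, h⟩

/-! ## The order on curtains given by ball-separation -/

namespace Curtain

theorem closestPoints_nonempty {S : Type*} [MetricSpace S] (𝔥 : Curtain S) (x : S) :
    (closestPoints 𝔥.axis x).Nonempty :=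
  𝔥.geodesic.closestPoints_nonempty (by linarith [𝔥.one_le]) x

theorem α_zero_mem_minus {S : Type*} [MetricSpace S] (𝔥 : Curtain S) : 𝔥.α 0 ∈ 𝔥.minus := by
  have h1 := 𝔥.one_le
  exact ⟨𝔥.α 0, mem_closestPoints_self ⟨0, ⟨le_rfl, by linarith⟩, rfl⟩, 0, ⟨le_rfl, 𝔥.a_pos⟩, rfl⟩

theorem mem_cases {S : Type*} [MetricSpace S] (𝔥 : Curtain S) (x : S) :
    x ∈ 𝔥.minus ∨ x ∈ 𝔥.carrier ∨ x ∈ 𝔥.plus := by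
  have : x ∈ 𝔥.minus ∪ 𝔥.carrier ∪ 𝔥.plus := by
    rw [𝔥.minus_union_carrier_union_plus]; trivial
  rcases this with (h | h) | h <;> tauto

theorem notMem_plus_of_mem_minus {S : Type*} [MetricSpace S] {𝔥 : Curtain S} {x : S}
    (h : x ∈ 𝔥.minus) : x ∉ 𝔥.plus := Set.disjoint_left.1 𝔥.disjoint_minus_plus h

/-- The two projections are at least 10D apart and projecting gains at most 2D, so the distance is
at least 8D. -/
theorem eight_le_dist {S : Type*} [MetricSpace S] (hS : IsGeodesicSpace S) {𝔥 : Curtain S}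
    {x y : S} (hx : x ∈ 𝔥.minus) (hy : y ∈ 𝔥.plus) : 8 ≤ dist x y := by
  obtain ⟨p, hp, t, ht, rfl⟩ := hx
  obtain ⟨q, hq, u, hu, rfl⟩ := hy
  have h1 := 𝔥.one_le
  have h2 := 𝔥.a_pos
  have h3 := 𝔥.a_lt
  have h4 := dist_closest_le hS 𝔥.contracting (by linarith) 𝔥.closestPoints_nonempty hp hq
  rw [𝔥.geodesic t ⟨ht.1, by linarith [ht.2]⟩ u ⟨by linarith [hu.1], hu.2⟩] at h4
  have h5 := neg_le_abs (t - u)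
  linarith [hu.1, ht.2]

/-- The curtain dual to the same segment of the reversed geodesic. -/
def reverse {S : Type*} [MetricSpace S] (𝔥 : Curtain S) : Curtain S where
  D := 𝔥.D
  one_le := 𝔥.one_le
  α t := 𝔥.α (20 * 𝔥.D - t)
  geodesic s hs t ht := by
    rw [𝔥.geodesic _ ⟨by linarith [hs.2], by linarith [hs.1]⟩ _
      ⟨by linarith [ht.2], by linarith [ht.1]⟩, abs_sub_comm]
    congr 1
    ring
  contracting := by
    have : (fun t => 𝔥.α (20 * 𝔥.D - t)) '' Icc 0 (20 * 𝔥.D) = 𝔥.α '' Icc 0 (20 * 𝔥.D) := by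
      change (𝔥.α ∘ fun t => 20 * 𝔥.D - t) '' _ = _
      rw [image_comp, image_const_sub_Icc]
      simp
    rw [this]
    exact 𝔥.contracting
  a := 10 * 𝔥.D - 𝔥.a
  a_pos := by linarith [𝔥.a_lt]
  a_lt := by linarith [𝔥.a_pos]

theorem reverse_axis {S : Type*} [MetricSpace S] (𝔥 : Curtain S) : 𝔥.reverse.axis = 𝔥.axis := by
  change (𝔥.α ∘ fun t => 20 * 𝔥.D - t) '' _ = _
  rw [image_comp, reverse, image_const_sub_Icc]
  simp [axis]

theorem reverse_carrier {S : Type*} [MetricSpace S] (𝔥 : Curtain S) :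
    𝔥.reverse.carrier = 𝔥.carrier := by
  simp only [carrier, reverse_axis]
  change {x | _ ⊆ (𝔥.α ∘ fun t => 20 * 𝔥.D - t) '' Icc (10 * 𝔥.D - 𝔥.a)
    (10 * 𝔥.D - 𝔥.a + 10 * 𝔥.D)} = _
  rw [image_comp, image_const_sub_Icc]
  ring_nf

theorem reverse_minus {S : Type*} [MetricSpace S] (𝔥 : Curtain S) :
    𝔥.reverse.minus = 𝔥.plus := by
  simp only [minus, plus, reverse_axis]
  change {x | (_ ∩ (𝔥.α ∘ fun t => 20 * 𝔥.D - t) '' Ico 0 (10 * 𝔥.D - 𝔥.a)).Nonempty} = _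
  rw [image_comp, image_const_sub_Ico]
  ring_nf

theorem reverse_plus {S : Type*} [MetricSpace S] (𝔥 : Curtain S) :
    𝔥.reverse.plus = 𝔥.minus := by
  simp only [minus, plus, reverse_axis]
  change {x | (_ ∩ (𝔥.α ∘ fun t => 20 * 𝔥.D - t) '' Ioc (10 * 𝔥.D - 𝔥.a + 10 * 𝔥.D)
    (20 * 𝔥.D)).Nonempty} = _
  rw [image_comp, image_const_sub_Ioc]
  ring_nf

/-- The relation between consecutive members of an `R`-chain. -/
structure Precedes {S : Type*} [MetricSpace S] (R : ℝ) (𝔥 𝔨 : Curtain S) : Prop where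
  carrier_subset_minus : 𝔥.carrier ⊆ 𝔨.minus
  carrier_subset_plus : 𝔨.carrier ⊆ 𝔥.plus
  ballSeparated : 𝔥.BallSeparated R 𝔨

namespace Precedes

variable {S : Type*} [MetricSpace S] {R : ℝ} {𝔥 𝔨 𝔩 𝔪 : Curtain S}

theorem exists_mem (h : Precedes R 𝔥 𝔨) : ∃ b, b ∈ 𝔥.plus ∧ b ∈ 𝔨.minus := by
  obtain ⟨-, b, r, h0, -, hB, -⟩ := h.ballSeparated
  have : b ∈ Metric.closedBall b r := by simpa using h0
  exact ⟨b, hB this⟩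

/-- Ball-separation applies to geodesics of length 0: a common point would lie in the separating
ball, which is contained in 𝔥⁺. -/
theorem notMem_plus (h : Precedes R 𝔥 𝔨) {x : S} (hx : x ∈ 𝔥.minus) : x ∉ 𝔨.plus := fun hx' => by
  obtain ⟨-, b, r, -, -, hB, hg⟩ := h.ballSeparated
  obtain ⟨-, ⟨t, -, rfl⟩, hb⟩ := hg (fun _ => x) 0 le_rfl
    (fun s hs t ht => by
      rw [dist_self, le_antisymm hs.2 hs.1, le_antisymm ht.2 ht.1, sub_self, abs_zero]) hx hx'
  exact notMem_plus_of_mem_minus hx (hB hb).1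

theorem minus_subset (h : Precedes R 𝔥 𝔨) : 𝔥.minus ⊆ 𝔨.minus := fun x hx => by
  rcases 𝔨.mem_cases x with h1 | h1 | h1
  · exact h1
  · exact (notMem_plus_of_mem_minus hx (h.carrier_subset_plus h1)).elim
  · exact (h.notMem_plus hx h1).elim

theorem plus_subset (h : Precedes R 𝔥 𝔨) : 𝔨.plus ⊆ 𝔥.plus := fun x hx => by
  rcases 𝔥.mem_cases x with h1 | h1 | h1
  · exact (h.notMem_plus h1 hx).elim
  · exact (notMem_plus_of_mem_minus (h.carrier_subset_minus h1) hx).elim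
  · exact h1

theorem mem_minus_of_notMem_plus (h : Precedes R 𝔥 𝔨) {x : S} (hx : x ∉ 𝔥.plus) :
    x ∈ 𝔨.minus := by
  rcases 𝔥.mem_cases x with h1 | h1 | h1
  · exact h.minus_subset h1
  · exact h.carrier_subset_minus h1
  · exact (hx h1).elim

theorem mem_plus_of_notMem_minus (h : Precedes R 𝔥 𝔨) {x : S} (hx : x ∉ 𝔨.minus) :
    x ∈ 𝔥.plus := by
  by_contra h1
  exact hx (h.mem_minus_of_notMem_plus h1)

/-- The ball that separates 𝔥 from 𝔨 also separates 𝔥 from any curtain beyond 𝔨. Hence the relation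
is transitive with the same R. -/
theorem of_subset (h : Precedes R 𝔥 𝔨) (h1 : 𝔨.minus ⊆ 𝔪.minus) (h2 : 𝔪.plus ⊆ 𝔨.plus) :
    Precedes R 𝔥 𝔪 := by
  have hm : 𝔥.carrier ⊆ 𝔪.minus := h.carrier_subset_minus.trans h1
  have hp : 𝔪.carrier ⊆ 𝔥.plus := fun x hx =>
    h.mem_plus_of_notMem_minus fun h3 => Set.disjoint_left.1 𝔪.disjoint_minus_carrier (h1 h3) hx
  obtain ⟨-, b, r, h0, hr, hB, hg⟩ := h.ballSeparated
  refine ⟨hm, hp, Set.disjoint_left.2 fun x hx hx' =>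
    Set.disjoint_left.1 𝔥.disjoint_carrier_plus hx (hp hx'), b, r, h0, hr,
    fun x hx => ⟨(hB hx).1, h1 (hB hx).2⟩, fun γ l hl hγ hx hy => hg γ l hl hγ hx (h2 hy)⟩

theorem trans (h : Precedes R 𝔥 𝔨) (h' : Precedes R 𝔨 𝔩) : Precedes R 𝔥 𝔩 :=
  h.of_subset h'.minus_subset h'.plus_subset

theorem mono {R' : ℝ} (h : Precedes R 𝔥 𝔨) (hR : R ≤ R') : Precedes R' 𝔥 𝔨 := by
  obtain ⟨hd, b, r, h0, hr, h1⟩ := h.ballSeparated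
  exact ⟨h.carrier_subset_minus, h.carrier_subset_plus, hd, b, r, h0, hr.trans hR, h1⟩

protected theorem reverse (h : Precedes R 𝔥 𝔨) : Precedes R 𝔨.reverse 𝔥.reverse := by
  obtain ⟨hd, b, r, h0, hr, hB, hg⟩ := h.ballSeparated
  refine ⟨?_, ?_, ?_, b, r, h0, hr, ?_, ?_⟩
  · rw [reverse_carrier, reverse_minus]
    exact h.carrier_subset_plus
  · rw [reverse_carrier, reverse_plus]
    exact h.carrier_subset_minus
  · rw [reverse_carrier, reverse_carrier]
    exact hd.symm
  · rw [reverse_plus, reverse_minus, inter_comm]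
    exact hB
  · intro γ l hl hγ h1 h2
    rw [reverse_minus] at h1
    rw [reverse_plus] at h2
    obtain ⟨-, ⟨t, ht, rfl⟩, hb⟩ := hg (fun t => γ (l - t)) l hl
      (fun s hs t ht => by
        rw [hγ _ ⟨by linarith [hs.2], by linarith [hs.1]⟩ _
          ⟨by linarith [ht.2], by linarith [ht.1]⟩, abs_sub_comm]
        congr 1
        ring) (by simpa using h2) (by simpa using h1)
    exact ⟨_, ⟨l - t, ⟨by linarith [ht.2], by linarith [ht.1]⟩, rfl⟩, hb⟩

/-- The ball that separates two curtains is met between any two points on a geodesic. -/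
theorem exists_ball (h : Precedes R 𝔥 𝔨) : ∃ b : S, b ∈ 𝔥.plus ∧ b ∈ 𝔨.minus ∧
    ∀ (γ : ℝ → S) (s t : ℝ), s ≤ t → IsGeodesicOn γ (Icc s t) →
      (γ s ∈ 𝔥.minus ∧ γ t ∈ 𝔨.plus ∨ γ s ∈ 𝔨.plus ∧ γ t ∈ 𝔥.minus) →
      ∃ u ∈ Icc s t, dist (γ u) b ≤ R ∧ γ u ∈ 𝔥.plus ∧ γ u ∈ 𝔨.minus := by
  obtain ⟨hd, b, r, h0, hr, hB, hg⟩ := h.ballSeparated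
  have hb : b ∈ Metric.closedBall b r := by simpa using h0
  refine ⟨b, (hB hb).1, (hB hb).2, fun γ s t hst hγ hx => ?_⟩
  rcases hx with ⟨h1, h2⟩ | ⟨h1, h2⟩
  · obtain ⟨-, ⟨u, hu, rfl⟩, hb⟩ := hg (fun u => γ (s + u)) (t - s) (by linarith)
      (fun u hu v hv => by
        rw [hγ _ ⟨by linarith [hu.1], by linarith [hu.2]⟩ _
          ⟨by linarith [hv.1], by linarith [hv.2]⟩, add_sub_add_left_eq_sub])
      (by simpa using h1) (by simpa using h2)
    exact ⟨s + u, ⟨by linarith [hu.1], by linarith [hu.2]⟩, (Metric.mem_closedBall.1 hb).trans hr,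
      hB hb⟩
  · obtain ⟨-, ⟨u, hu, rfl⟩, hb⟩ := hg (fun u => γ (t - u)) (t - s) (by linarith)
      (fun u hu v hv => by
        rw [hγ _ ⟨by linarith [hu.2], by linarith [hu.1]⟩ _
          ⟨by linarith [hv.2], by linarith [hv.1]⟩, abs_sub_comm]
        congr 1
        ring)
      (by simpa using h2) (by simpa using h1)
    exact ⟨t - u, ⟨by linarith [hu.2], by linarith [hu.1]⟩, (Metric.mem_closedBall.1 hb).trans hr,
      hB hb⟩

end Precedes

/-! ### Thickness of chains, and the bound on crossing chains of curtains -/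

section Chains

variable {S : Type*} [MetricSpace S] (hS : IsGeodesicSpace S) {R : ℝ}

include hS

/-- A geodesic from x to y meets the ball between the last two curtains in a point beyond the former
and before the latter. Thus the thickness of the last curtain adds to the length required by the
earlier ones. -/
theorem le_dist_of_precedes {𝔨 : ℕ → Curtain S} {i j : ℕ} (hij : i ≤ j)
    (h : ∀ m, i ≤ m → m < j → Precedes R (𝔨 m) (𝔨 (m + 1))) {x y : S}
    (hx : x ∈ (𝔨 i).minus) (hy : y ∈ (𝔨 j).plus) : 8 * ((j : ℝ) - i + 1) ≤ dist x y := by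
  induction j, hij using Nat.le_induction generalizing y with
  | base =>
    have := eight_le_dist hS hx hy
    linarith
  | succ j hij ih =>
    have hp := h j hij (by omega)
    obtain ⟨γ, hγ, h0, h1⟩ := hS x y
    have hxj : x ∈ (𝔨 j).minus := by
      clear ih hp hy h1
      induction j, hij using Nat.le_induction with
      | base => exact hx
      | succ j hij ih =>
        exact (h j hij (by omega)).minus_subset (ih fun m h1 h2 => h m h1 (by omega))
    obtain ⟨b, -, -, hb⟩ := hp.exists_ball
    obtain ⟨u, hu, -, h2, h3⟩ := hb γ 0 (dist x y) dist_nonneg hγ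
      (Or.inl ⟨by rwa [h0], by rwa [h1]⟩)
    have h4 := ih (fun m h1 h2 => h m h1 (by omega)) h2
    have h5 := eight_le_dist hS h3 hy
    have h6 := hγ.dist_add_dist le_rfl hu.1 hu.2 le_rfl
    rw [h0, h1] at h6
    push_cast
    linarith

/-- A geodesic with both ends before 𝔨₀ that goes beyond 𝔨ⱼ passes the ball between 𝔨₀ and 𝔨₁ on its
way out and back. These two points are at distance at most 2R, but the way out crosses 𝔨₁, …, 𝔨ⱼ and
so has length at least 8j. -/
theorem notMem_plus_of_between {𝔨 : ℕ → Curtain S} {n : ℕ}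
    (h : ∀ i j, i < j → j < n → Precedes R (𝔨 i) (𝔨 j)) {γ : ℝ → S} {s t u : ℝ}
    (hsu : s ≤ u) (hut : u ≤ t) (hγ : IsGeodesicOn γ (Icc s t)) (hs : γ s ∈ (𝔨 0).minus)
    (ht : γ t ∈ (𝔨 0).minus) {j : ℕ} (hj : 1 ≤ j) (hjn : j < n) (hjR : R < 4 * j) :
    γ u ∉ (𝔨 j).plus := fun hu => by
  obtain ⟨b, -, -, hb⟩ := (h 0 1 one_pos (by omega)).exists_ball
  have hu1 : γ u ∈ (𝔨 1).plus := by
    rcases hj.eq_or_lt with rfl | hj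
    · exact hu
    · exact (h 1 j hj hjn).plus_subset hu
  obtain ⟨v, hv, hv1, -, hv2⟩ := hb γ s u hsu (hγ.mono (Icc_subset_Icc le_rfl hut))
    (Or.inl ⟨hs, hu1⟩)
  obtain ⟨w, hw, hw1, -, -⟩ := hb γ u t hut (hγ.mono (Icc_subset_Icc hsu le_rfl))
    (Or.inr ⟨hu1, ht⟩)
  have h1 := hγ.dist_add_dist hv.1 hv.2 hw.1 hw.2
  have h2 := dist_triangle_right (γ v) (γ w) b
  have h3 := le_dist_of_precedes hS hj (fun m h1 h2 => h m (m + 1) (by omega) (by omega)) hv2 hu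
  have := dist_nonneg (x := γ u) (y := γ w)
  push_cast at h3
  linarith

/-- A chain of curtains that cross two ball-separated curtains is short. -/
theorem card_le_of_crossing {R : ℕ} (hR : 1 ≤ R) {𝔥 𝔩 : Curtain S} (hhl : Precedes (R : ℝ) 𝔥 𝔩)
    {𝔨 : ℕ → Curtain S} {n : ℕ} (h : ∀ i j, i < j → j < n → Precedes (R : ℝ) (𝔨 i) (𝔨 j))
    {p₁ p₂ q₁ q₂ : S} (hp₁ : p₁ ∈ 𝔥.minus) (hp₁' : p₁ ∈ (𝔨 0).minus) (hp₂ : p₂ ∈ 𝔩.plus)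
    (hp₂' : p₂ ∈ (𝔨 0).minus) (hq₁ : q₁ ∈ 𝔥.minus) (hq₁' : q₁ ∈ (𝔨 (n - 1)).plus)
    (hq₂ : q₂ ∈ 𝔩.plus) (hq₂' : q₂ ∈ (𝔨 (n - 1)).plus) : n ≤ 3 * R + 3 := by
  by_contra! hn
  have hR' : (1 : ℝ) ≤ R := by exact_mod_cast hR
  obtain ⟨b, -, -, hb⟩ := hhl.exists_ball
  obtain ⟨γ, hγ, h0, h1⟩ := hS p₁ p₂
  obtain ⟨β, hβ, h2, h3⟩ := hS q₁ q₂
  obtain ⟨u, hu, hub, -⟩ := hb γ 0 _ dist_nonneg hγ (Or.inl ⟨by rwa [h0], by rwa [h1]⟩)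
  obtain ⟨v, hv, hvb, -⟩ := hb β 0 _ dist_nonneg hβ (Or.inl ⟨by rwa [h2], by rwa [h3]⟩)
  -- Both geodesics run from 𝔥⁻ to 𝔩⁺ and hence come within R of b. The first keeps to the start of
  -- the chain 𝔨, and the second, seen in the reversed chain, keeps to its end.
  have hu' : γ u ∉ (𝔨 R).plus :=
    notMem_plus_of_between hS h hu.1 hu.2 hγ (by rwa [h0]) (by rwa [h1]) hR (by omega)
      (by linarith)
  have hv' : β v ∉ (𝔨 (n - 1 - R)).reverse.plus :=
    notMem_plus_of_between hS (𝔨 := fun i => (𝔨 (n - 1 - i)).reverse) (n := n)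
      (fun i j hij hj => (h (n - 1 - j) (n - 1 - i) (by omega) (by omega)).reverse)
      hv.1 hv.2 hβ (by rw [h2, reverse_minus]; exact hq₁') (by rw [h3, reverse_minus]; exact hq₂')
      hR (by omega) (by linarith)
  rw [reverse_plus] at hv'
  have hu2 := (h R (R + 1) (by omega) (by omega)).mem_minus_of_notMem_plus hu'
  have hv2 := (h (n - 2 - R) (n - 1 - R) (by omega) (by omega)).mem_plus_of_notMem_minus hv'
  -- The two points near b are separated by the n - 2 - 2R curtains in the middle, although their
  -- distance is at most 2R.
  have h4 := le_dist_of_precedes hS (i := R + 1) (j := n - 2 - R) (by omega)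
    (fun m h1 h2 => h m (m + 1) (by omega) (by omega)) hu2 hv2
  have h5 := dist_triangle_right (γ u) (β v) b
  have h6 : ((n - 2 - R : ℕ) : ℝ) = n - 2 - R := by
    rw [Nat.cast_sub (by omega), Nat.cast_sub (by omega)]
    norm_num
  rw [h6] at h4
  have : (3 * R + 4 : ℝ) ≤ n := by exact_mod_cast hn
  push_cast at h4
  linarith

end Chains

end Curtain

/-! ## Chains of oriented walls -/

/-- A curtain together with one of the two walls it induces. -/
structure Half (S : Type*) [MetricSpace S] where
  curtain : Curtain S
  neg : Set S
  neg_eq : neg = curtain.minus ∨ neg = curtain.minus ∪ curtain.carrier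

namespace Half

variable {S : Type*} [MetricSpace S]

theorem minus_subset (p : Half S) : p.curtain.minus ⊆ p.neg := by
  rcases p.neg_eq with h | h
  · rw [h]
  · rw [h]; exact subset_union_left

theorem notMem_plus (p : Half S) {x : S} (hx : x ∈ p.neg) : x ∉ p.curtain.plus := by
  rcases p.neg_eq with h | h
  · rw [h] at hx
    exact Curtain.notMem_plus_of_mem_minus hx
  · rw [h] at hx
    rcases hx with hx | hx
    · exact Curtain.notMem_plus_of_mem_minus hx
    · exact Set.disjoint_left.1 p.curtain.disjoint_carrier_plus hx

theorem notMem_minus (p : Half S) {x : S} (hx : x ∉ p.neg) : x ∉ p.curtain.minus :=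
  fun h => hx (p.minus_subset h)

theorem induces (p : Half S) : p.curtain.Induces s(p.neg, p.negᶜ) := by
  have h1 := Set.disjoint_left.1 p.curtain.disjoint_minus_carrier
  have h2 := Set.disjoint_left.1 p.curtain.disjoint_carrier_plus
  have h3 := Set.disjoint_left.1 p.curtain.disjoint_minus_plus
  have h4 := p.curtain.mem_cases
  rcases p.neg_eq with h | h
  · right
    rw [h]
    congr 2
    ext x
    have := h4 x
    have := @h1 x
    have := @h3 x
    simp only [mem_compl_iff, mem_union]
    tauto
  · left
    rw [h]
    congr 2
    ext x
    have := h4 x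
    have := @h2 x
    have := @h3 x
    simp only [mem_compl_iff, mem_union]
    tauto

/-- The wall underlying an oriented wall. -/
def wall (p : Half S) : walls S := ⟨s(p.neg, p.negᶜ), p.curtain, p.induces⟩

theorem exists_of_induces {𝔥 : Curtain S} {h : walls S} (hh : 𝔥.Induces h.1) :
    ∃ p : Half S, p.curtain = 𝔥 ∧ p.wall = h := by
  rcases hh with hh | hh
  · refine ⟨⟨𝔥, 𝔥.minus ∪ 𝔥.carrier, Or.inr rfl⟩, rfl, Subtype.ext ?_⟩
    obtain ⟨A, hA⟩ := exists_eq_compl_of_mem_walls h.2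
    rw [hh] at hA ⊢
    simp only [wall]
    rcases Sym2.eq_iff.1 hA with ⟨h1, h2⟩ | ⟨h1, h2⟩
    · rw [h2, h1]
    · rw [h2, h1, compl_compl]
  · refine ⟨⟨𝔥, 𝔥.minus, Or.inl rfl⟩, rfl, Subtype.ext ?_⟩
    obtain ⟨A, hA⟩ := exists_eq_compl_of_mem_walls h.2
    rw [hh] at hA ⊢
    simp only [wall]
    rcases Sym2.eq_iff.1 hA with ⟨h1, h2⟩ | ⟨h1, h2⟩
    · rw [h2, h1]
    · rw [h2, h1, compl_compl]

/-- The opposite orientation. -/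
def reverse (p : Half S) : Half S where
  curtain := p.curtain.reverse
  neg := p.negᶜ
  neg_eq := by
    rw [Curtain.reverse_minus, Curtain.reverse_carrier]
    have h1 := Set.disjoint_left.1 p.curtain.disjoint_minus_carrier
    have h2 := Set.disjoint_left.1 p.curtain.disjoint_carrier_plus
    have h3 := Set.disjoint_left.1 p.curtain.disjoint_minus_plus
    have h4 := p.curtain.mem_cases
    rcases p.neg_eq with h | h
    · right
      rw [h]
      ext x
      have := h4 x
      have := @h1 x
      have := @h3 x
      simp only [mem_compl_iff, mem_union]
      tauto
    · left
      rw [h]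
      ext x
      have := h4 x
      have := @h2 x
      have := @h3 x
      simp only [mem_compl_iff, mem_union]
      tauto

theorem reverse_wall (p : Half S) : p.reverse.wall = p.wall := by
  refine Subtype.ext ?_
  simp only [wall, reverse, compl_compl]
  exact Sym2.eq_swap

/-- The order on oriented walls induced by that on curtains. -/
def Precedes (R : ℝ) (p q : Half S) : Prop := p.curtain.Precedes R q.curtain

namespace Precedes

variable {R : ℝ} {p q : Half S}

/-- It does not matter which side of its wall contains the curtain of p, once one more member of the
chain is passed. Wherever halfspaces are replaced by the sides of curtains, this costs one member at
that end. -/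
theorem neg_subset_minus (h : Precedes R p q) : p.neg ⊆ q.curtain.minus :=
  fun _ hx => Curtain.Precedes.mem_minus_of_notMem_plus h (p.notMem_plus hx)

theorem mem_plus (h : Precedes R p q) {x : S} (hx : x ∉ q.neg) : x ∈ p.curtain.plus :=
  Curtain.Precedes.mem_plus_of_notMem_minus h (q.notMem_minus hx)

theorem neg_subset (h : Precedes R p q) : p.neg ⊆ q.neg :=
  h.neg_subset_minus.trans q.minus_subset

theorem not_subset (h : Precedes R p q) : ¬ q.neg ⊆ p.neg := fun hs => by
  obtain ⟨b, hb, hb'⟩ := Curtain.Precedes.exists_mem h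
  exact p.notMem_plus (hs (q.minus_subset hb')) hb

/-- Distinctness of the walls makes the length of a chain equal to the cardinality of its set of
walls. The swapped coincidence is impossible because the negative sides are nested and nonempty. -/
theorem wall_ne (h : Precedes R p q) : p.wall ≠ q.wall := fun he => by
  have h1 : s(p.neg, p.negᶜ) = s(q.neg, q.negᶜ) := congrArg Subtype.val he
  rcases Sym2.eq_iff.1 h1 with ⟨h2, -⟩ | ⟨h2, -⟩
  · exact h.not_subset h2.ge
  · have h3 := p.curtain.α_zero_mem_minus
    have h4 := h.neg_subset (p.minus_subset h3)
    have h5 := p.minus_subset h3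
    rw [h2] at h5
    exact h5 h4

theorem mono {R' : ℝ} (h : Precedes R p q) (hR : R ≤ R') : Precedes R' p q :=
  Curtain.Precedes.mono h hR

theorem reverse (h : Precedes R p q) : Precedes R q.reverse p.reverse :=
  Curtain.Precedes.reverse h

/-- Gluing two chains along an inclusion of halfspaces. -/
theorem glue {p' q' : Half S} (h : Precedes R p p') {u : Half S} (h1 : Precedes R p' u)
    (h2 : u.neg ⊆ q'.neg) (h3 : Precedes R q' q) : Precedes R p q := by
  refine Curtain.Precedes.of_subset h ?_ ?_
  · exact ((p'.minus_subset.trans h1.neg_subset).trans h2).trans h3.neg_subset_minus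
  · intro x hx
    refine h1.mem_plus fun hu => ?_
    exact Curtain.notMem_plus_of_mem_minus (h3.neg_subset_minus (h2 hu)) hx

end Precedes

end Half

/-! ### Orientations chosen by ultrafilters, and chains as finite lists -/

section Choice

variable {S : Type*} [MetricSpace S]

/-- The ultrafilter `x` lies on the negative side of `p`. -/
def Ultra.Neg (x : Ultra S) (p : Half S) : Prop := x.side p.wall = p.neg

namespace Ultra

theorem mem_wall (p : Half S) : p.neg ∈ p.wall.1 := by simp [Half.wall]

theorem compl_mem_wall (p : Half S) : p.negᶜ ∈ p.wall.1 := by simp [Half.wall]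

theorem side_of_neg {x : Ultra S} {p : Half S} (h : x.Neg p) : x.side p.wall = p.neg := h

theorem side_of_not_neg {x : Ultra S} {p : Half S} (h : ¬ x.Neg p) : x.side p.wall = p.negᶜ := by
  rcases Sym2.mem_iff.1 (x.side_mem p.wall) with h1 | h1
  · exact (h h1).elim
  · exact h1

theorem neg_ne_compl (p : Half S) : p.neg ≠ p.negᶜ := fun h => by
  have h1 := p.minus_subset p.curtain.α_zero_mem_minus
  have h2 := h1
  rw [h] at h2
  exact h2 h1

theorem not_neg_iff {x : Ultra S} {p : Half S} : ¬ x.Neg p ↔ x.side p.wall = p.negᶜ :=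
  ⟨side_of_not_neg, fun h h' => neg_ne_compl p (h'.symm.trans h)⟩

theorem side_ne_iff {x y : Ultra S} {p : Half S} :
    x.side p.wall ≠ y.side p.wall ↔ (x.Neg p ∧ ¬ y.Neg p ∨ ¬ x.Neg p ∧ y.Neg p) := by
  have h := neg_ne_compl p
  by_cases hx : x.Neg p <;> by_cases hy : y.Neg p
  · simp only [hx, hy]
    rw [side_of_neg hx, side_of_neg hy]
    simp
  · simp only [hx, hy]
    rw [side_of_neg hx, side_of_not_neg hy]
    simpa using h
  · simp only [hx, hy]
    rw [side_of_neg hy, side_of_not_neg hx]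
    simpa using h.symm
  · simp only [hx, hy]
    rw [side_of_not_neg hx, side_of_not_neg hy]
    simp

theorem Neg.of_subset {x : Ultra S} {p q : Half S} (h : x.Neg p) (hpq : p.neg ⊆ q.neg) :
    x.Neg q := x.consistent _ _ _ _ (mem_wall p) (mem_wall q) hpq h

/-- Chosen halfspaces meet: otherwise one would lie in the complement of the other and consistency
would choose this complement. This lemma and its two variants supply the quadrants in
`length_le_of_crossing`. -/
theorem exists_mem_mem {x : Ultra S} {p q : Half S} (hp : x.Neg p) (hq : x.Neg q) :
    ∃ s, s ∈ p.neg ∧ s ∈ q.neg := by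
  by_contra! h
  exact neg_ne_compl q (hq.symm.trans
    (x.consistent _ _ _ _ (mem_wall p) (compl_mem_wall q) (fun s hs => h s hs) hp))

theorem exists_mem_notMem {x : Ultra S} {p q : Half S} (hp : x.Neg p) (hq : ¬ x.Neg q) :
    ∃ s, s ∈ p.neg ∧ s ∉ q.neg := by
  by_contra! h
  exact hq (hp.of_subset h)

theorem exists_notMem_notMem {x : Ultra S} {p q : Half S} (hp : ¬ x.Neg p) (hq : ¬ x.Neg q) :
    ∃ s, s ∉ p.neg ∧ s ∉ q.neg := by
  by_contra! h
  exact hq (x.consistent _ _ _ _ (compl_mem_wall p) (mem_wall q) (fun s hs => h s hs)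
    (side_of_not_neg hp))

theorem neg_reverse_iff {x : Ultra S} {p : Half S} : x.Neg p.reverse ↔ ¬ x.Neg p := by
  rw [not_neg_iff, Neg, Half.reverse_wall]
  rfl

theorem principal_neg_iff {s : S} {p : Half S} : Ultra.Neg (principal s) p ↔ s ∈ p.neg := by
  constructor
  · intro h
    by_contra hs
    exact neg_ne_compl p (h.symm.trans (principal_side_eq (compl_mem_wall p) hs))
  · exact fun h => principal_side_eq (mem_wall p) h

end Ultra

/-- `l` is an `R`-chain of oriented walls that leads from `x` to `y`. -/
structure ChainFromTo (R : ℝ) (x y : Ultra S) (l : List (Half S)) : Prop where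
  pairwise : l.Pairwise (Half.Precedes R)
  neg : ∀ p ∈ l, x.Neg p
  not_neg : ∀ p ∈ l, ¬ y.Neg p

theorem ChainFromTo.sublist {R : ℝ} {x y : Ultra S} {l l' : List (Half S)}
    (h : ChainFromTo R x y l) (hl : l'.Sublist l) : ChainFromTo R x y l' :=
  ⟨h.pairwise.sublist hl, fun p hp => h.neg p (hl.subset hp),
    fun p hp => h.not_neg p (hl.subset hp)⟩

theorem ChainFromTo.mono {R R' : ℝ} {x y : Ultra S} {l : List (Half S)}
    (h : ChainFromTo R x y l) (hR : R ≤ R') : ChainFromTo R' x y l :=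
  ⟨h.pairwise.imp fun h => h.mono hR, h.neg, h.not_neg⟩

/-- The reversed chain. -/
def reverseChain (l : List (Half S)) : List (Half S) := (l.map Half.reverse).reverse

theorem length_reverseChain (l : List (Half S)) : (reverseChain l).length = l.length := by
  simp [reverseChain]

theorem mem_reverseChain {l : List (Half S)} {p : Half S} :
    p ∈ reverseChain l ↔ ∃ q ∈ l, q.reverse = p := by
  simp [reverseChain]

theorem ChainFromTo.reverse {R : ℝ} {x y : Ultra S} {l : List (Half S)}
    (h : ChainFromTo R x y l) : ChainFromTo R y x (reverseChain l) := by
  refine ⟨?_, ?_, ?_⟩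
  · rw [reverseChain, List.pairwise_reverse, List.pairwise_map]
    exact h.pairwise.imp fun h => h.reverse
  · intro p hp
    obtain ⟨q, hq, rfl⟩ := mem_reverseChain.1 hp
    exact Ultra.neg_reverse_iff.2 (h.not_neg q hq)
  · intro p hp
    obtain ⟨q, hq, rfl⟩ := mem_reverseChain.1 hp
    rw [Ultra.neg_reverse_iff, not_not]
    exact h.neg q hq

theorem ChainFromTo.length_le_dualDist {R : ℕ+} {x y : Ultra S} {l : List (Half S)}
    (h : ChainFromTo (R : ℝ) x y l) : (l.length : ℕ∞) ≤ dualDist (chains S R) x y := by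
  have hpw := List.pairwise_iff_getElem.1 h.pairwise
  set J : Set ℤ := {i | 0 ≤ i ∧ i < l.length} with hJ
  have hlt : ∀ i : J, i.1.toNat < l.length := fun i => by
    have := i.2
    simp only [hJ, mem_ofPred_eq] at this
    omega
  let f : J → Half S := fun i => l[i.1.toNat]'(hlt i)
  have hf : ∀ i j : J, i < j → (f i).Precedes (R : ℝ) (f j) := fun i j hij =>
    hpw _ _ (hlt i) (hlt j) (by
      have h1 := i.2
      have h2 := j.2
      have h3 : i.1 < j.1 := hij
      simp only [hJ, mem_ofPred_eq] at h1 h2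
      omega)
  have hinj : Function.Injective fun i => (f i).wall := by
    intro i j hij
    rcases lt_trichotomy i j with h1 | h1 | h1
    · exact ((hf i j h1).wall_ne hij).elim
    · exact h1
    · exact ((hf j i h1).wall_ne hij.symm).elim
  have hcard : (range fun i => (f i).wall).encard = l.length := by
    have h1 : (range fun i => (f i).wall) = range fun i : Fin l.length => l[i].wall := by
      ext k
      constructor
      · rintro ⟨i, rfl⟩
        exact ⟨⟨_, hlt i⟩, rfl⟩
      · rintro ⟨i, rfl⟩
        exact ⟨⟨i.1, by simp [hJ]⟩, by simp [f]⟩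
    have h2 : Function.Injective fun i : Fin l.length => l[i].wall := by
      intro i j hij
      have := @hinj ⟨i.1, by simp [hJ]⟩ ⟨j.1, by simp [hJ]⟩ (by simpa [f] using hij)
      simpa [Fin.ext_iff] using this
    rw [h1, ← image_univ, h2.encard_image]
    simp
  rw [← hcard]
  refine le_iSup₂_of_le (f := fun (c : Set (walls S))
      (_ : c ∈ {c | c ∈ chains S R ∧ Separates c x y}) => c.encard) _
      ⟨⟨J, fun i => (f i).curtain, fun i => (f i).wall,
        ⟨fun i j hij => (hf i j hij).carrier_subset_minus,
          fun i j hij => (hf i j hij).carrier_subset_plus,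
          fun i j hij => (hf i j hij).ballSeparated⟩,
        ⟨fun i => (f i).neg, fun i => Ultra.mem_wall _, fun i j hij => (hf i j hij).neg_subset⟩,
        fun i => (f i).induces, rfl⟩, ?_⟩ le_rfl
  rintro _ ⟨i, rfl⟩
  exact Ultra.side_ne_iff.2 (Or.inl ⟨h.neg _ (List.getElem_mem _), h.not_neg _ (List.getElem_mem _)⟩)

/-- A set of walls in the collection that separates x from y contains n walls, which inherit the
order of the R-chain. They all point in the same direction, possibly after reversal of the whole
list. -/
theorem exists_chainFromTo {R : ℕ+} {x y : Ultra S} {n : ℕ}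
    (h : (n : ℕ∞) ≤ dualDist (chains S R) x y) :
    ∃ l, ChainFromTo (R : ℝ) x y l ∧ l.length = n := by
  rcases Nat.eq_zero_or_pos n with rfl | hn
  · exact ⟨[], ⟨List.Pairwise.nil, by simp, by simp⟩, rfl⟩
  obtain ⟨c, hc, hsep, hcn⟩ : ∃ c ∈ chains S R, Separates c x y ∧ (n : ℕ∞) ≤ c.encard := by
    by_contra! hlt
    have : dualDist (chains S R) x y ≤ (n - 1 : ℕ) := iSup₂_le fun c hc => by
      have h1 := hlt c hc.1 hc.2
      have h2 : ((n - 1 : ℕ) : ℕ∞) + 1 = n := by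
        norm_cast
        omega
      rw [← h2] at h1
      exact Order.lt_add_one_iff_of_not_isMax (by simp) |>.1 h1
    have h3 := h.trans this
    rw [Nat.cast_le] at h3
    omega
  obtain ⟨J, 𝔥, k, hR, -, hind, rfl⟩ := hc
  choose f hf hfk using fun i => Half.exists_of_induces (hind i)
  obtain ⟨t, ht, htn⟩ := exists_subset_encard_eq hcn
  have htf : t.Finite := finite_of_encard_eq_coe htn
  have : Nonempty J := by
    by_contra hJ
    rw [not_nonempty_iff] at hJ
    rw [range_eq_empty, encard_empty, nonpos_iff_eq_zero, Nat.cast_eq_zero] at hcn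
    omega
  choose! g hg using fun w (hw : w ∈ t) => ht hw
  classical
  let F : Finset J := htf.toFinset.image g
  have hF : F.card = n := by
    rw [Finset.card_image_of_injOn, ← Nat.cast_inj (R := ℕ∞), ← htn, htf.encard_eq_coe_toFinset_card]
    intro a ha b hb hab
    rw [htf.coe_toFinset] at ha hb
    rw [← hg a ha, ← hg b hb, hab]
  have hprec : ∀ i j, i < j → (f i).Precedes (R : ℝ) (f j) := fun i j hij => by
    rw [Half.Precedes, hf, hf]
    exact ⟨hR.subset_minus i j hij, hR.subset_plus i j hij, hR.separated i j hij⟩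
  let l := (F.sort (· ≤ ·)).map f
  have hl : l.Pairwise (Half.Precedes (R : ℝ)) := by
    rw [List.pairwise_map]
    exact (Finset.sortedLT_sort F).pairwise.imp fun h => hprec _ _ h
  have hln : l.length = n := by simp [l, hF]
  have hcases : ∀ p ∈ l, x.Neg p ∧ ¬ y.Neg p ∨ ¬ x.Neg p ∧ y.Neg p := by
    intro p hp
    obtain ⟨i, -, rfl⟩ := List.mem_map.1 hp
    rw [← Ultra.side_ne_iff, hfk]
    exact hsep _ ⟨i, rfl⟩
  by_cases hall : ∀ p ∈ l, x.Neg p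
  · exact ⟨l, ⟨hl, hall, fun p hp => by have := hcases p hp; have := hall p hp; tauto⟩, hln⟩
  -- One member with x on its positive side forces this for all members: if another had x on its
  -- negative side, nestedness would put x or y on the wrong side of one of the two.
  · push Not at hall
    obtain ⟨p, hp, hxp⟩ := hall
    have hyp : y.Neg p := by have := hcases p hp; tauto
    have key : ChainFromTo (R : ℝ) y x l := by
      have h1 : ∀ q ∈ l, ¬ x.Neg q := by
        intro q hq hxq
        obtain ⟨i, -, rfl⟩ := List.mem_map.1 hp
        obtain ⟨j, -, rfl⟩ := List.mem_map.1 hq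
        have := hcases _ hq
        rcases lt_trichotomy i j with h2 | h2 | h2
        · have := hyp.of_subset (hprec i j h2).neg_subset
          tauto
        · subst h2; exact hxp hxq
        · exact hxp (hxq.of_subset (hprec j i h2).neg_subset)
      exact ⟨hl, fun q hq => by have := hcases q hq; have := h1 q hq; tauto, h1⟩
    exact ⟨_, key.reverse, by rw [length_reverseChain, hln]⟩

/-! ### Crossing and gluing -/

/-- The middle two of four members of `l₁` play the roles of 𝔥 and 𝔩 in
`Curtain.card_le_of_crossing`. The outer two members, and the first and last members of `l₂`,
convert points of halfspaces into points beyond curtains; whence 3R+3+2. -/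
theorem length_le_of_crossing (hS : IsGeodesicSpace S) {R : ℕ} (hR : 1 ≤ R)
    {l₁ l₂ : List (Half S)} (h₁ : l₁.Pairwise (Half.Precedes (R : ℝ)))
    (h₂ : l₂.Pairwise (Half.Precedes (R : ℝ))) (h4 : 4 ≤ l₁.length)
    (hnn : ∀ p ∈ l₁, ∀ q ∈ l₂, ∃ s, s ∈ p.neg ∧ s ∈ q.neg)
    (hnp : ∀ p ∈ l₁, ∀ q ∈ l₂, ∃ s, s ∈ p.neg ∧ s ∉ q.neg)
    (hpn : ∀ p ∈ l₁, ∀ q ∈ l₂, ∃ s, s ∉ p.neg ∧ s ∈ q.neg)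
    (hpp : ∀ p ∈ l₁, ∀ q ∈ l₂, ∃ s, s ∉ p.neg ∧ s ∉ q.neg) : l₂.length ≤ 3 * R + 5 := by
  by_contra! hn
  rw [List.pairwise_iff_getElem] at h₁ h₂
  have h01 := h₁ 0 1 (by omega) (by omega) one_pos
  have h12 := h₁ 1 2 (by omega) (by omega) (by omega)
  have h23 := h₁ 2 3 (by omega) (by omega) (by omega)
  set n := l₂.length with hndef
  -- The shift drops the first member of `l₂`; the value outside the range is irrelevant.
  let 𝔨 : ℕ → Curtain S := fun i => if h : i + 1 < n then (l₂[i + 1]'h).curtain else l₁[0].curtain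
  have h𝔨 : ∀ i (h : i + 1 < n), 𝔨 i = (l₂[i + 1]'h).curtain := fun i h => by simp [𝔨, h]
  have hfirst := h₂ 0 1 (by omega) (by omega) one_pos
  have hlast := h₂ (n - 2) (n - 1) (by omega) (by omega) (by omega)
  obtain ⟨p₁, hp₁, hp₁'⟩ := hnn l₁[0] (List.getElem_mem _) l₂[0] (List.getElem_mem _)
  obtain ⟨q₁, hq₁, hq₁'⟩ := hnp l₁[0] (List.getElem_mem _) l₂[n - 1] (List.getElem_mem _)
  obtain ⟨p₂, hp₂, hp₂'⟩ := hpn l₁[3] (List.getElem_mem _) l₂[0] (List.getElem_mem _)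
  obtain ⟨q₂, hq₂, hq₂'⟩ := hpp l₁[3] (List.getElem_mem _) l₂[n - 1] (List.getElem_mem _)
  have hk0 : 𝔨 0 = l₂[1].curtain := h𝔨 0 (by omega)
  have hkn : 𝔨 (n - 2 - 1) = l₂[n - 2].curtain := by
    rw [h𝔨 _ (by omega)]
    simp only [show n - 2 - 1 + 1 = n - 2 by omega]
  have := Curtain.card_le_of_crossing hS hR (𝔥 := l₁[1].curtain) (𝔩 := l₁[2].curtain) h12
    (𝔨 := 𝔨) (n := n - 2)
    (fun i j hij hj => by
      rw [h𝔨 i (by omega), h𝔨 j (by omega)]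
      exact h₂ _ _ _ _ (by omega))
    (h01.neg_subset_minus hp₁) (by rw [hk0]; exact hfirst.neg_subset_minus hp₁')
    (h23.mem_plus hp₂) (by rw [hk0]; exact hfirst.neg_subset_minus hp₂')
    (h01.neg_subset_minus hq₁) (by rw [hkn]; exact hlast.mem_plus hq₁')
    (h23.mem_plus hq₂) (by rw [hkn]; exact hlast.mem_plus hq₂')
  omega

/-- Some late member of `l₁` must lie before an early member of `l₂`, since otherwise the end of
`l₁` would cross the start of `l₂`. Both chains are cut there and concatenated. -/
theorem exists_glued_chain (hS : IsGeodesicSpace S) {R : ℕ} (hR : 1 ≤ R) {x y : Ultra S}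
    {l₁ l₂ : List (Half S)} (h₁ : ChainFromTo (R : ℝ) x y l₁) (h₂ : ChainFromTo (R : ℝ) x y l₂)
    (h : ∀ p ∈ l₁, ∀ q ∈ l₂, ∃ s, s ∉ p.neg ∧ s ∈ q.neg) :
    ∃ l, ChainFromTo (R : ℝ) x y l ∧ (∀ p ∈ l, p ∈ l₁ ∨ p ∈ l₂) ∧
      l₁.length + l₂.length ≤ l.length + (3 * R + 12) := by
  by_cases hn : l₁.length < 3 * R + 8
  · exact ⟨l₂, h₂, fun p hp => Or.inr hp, by omega⟩
  by_cases hm : l₂.length < 4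
  · exact ⟨l₁, h₁, fun p hp => Or.inl hp, by omega⟩
  have hp₁ := List.pairwise_iff_getElem.1 h₁.pairwise
  have hp₂ := List.pairwise_iff_getElem.1 h₂.pairwise
  -- The last 3R+6 members of `l₁`, one more than the crossing bound allows, are tested against the
  -- first four of `l₂`. The mixed quadrant that `h` does not supply is witnessed by a single point
  -- s violating the inclusion, because both chains are nested.
  obtain ⟨i, hi⟩ : ∃ i, l₁.length = i + 2 + (3 * R + 6) :=
    ⟨l₁.length - (3 * R + 8), by omega⟩
  have key : (l₁[i + 2]'(by omega)).neg ⊆ (l₂[3]'(by omega)).neg := by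
    by_contra hsub
    obtain ⟨s, hs, hs'⟩ := not_subset.1 hsub
    have := length_le_of_crossing hS hR (l₁ := l₂.take 4) (l₂ := l₁.drop (i + 2))
      (h₂.pairwise.sublist (List.take_sublist _ _)) (h₁.pairwise.sublist (List.drop_sublist _ _))
      (by simp; omega)
      (fun p hp q hq => Ultra.exists_mem_mem (h₂.neg p (List.mem_of_mem_take hp))
        (h₁.neg q (List.mem_of_mem_drop hq)))
      (fun p hp q hq => by
        obtain ⟨s, h3, h4⟩ := h q (List.mem_of_mem_drop hq) p (List.mem_of_mem_take hp)
        exact ⟨s, h4, h3⟩)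
      (fun p hp q hq => by
        obtain ⟨a, ha, rfl⟩ := List.mem_take_iff_getElem.1 hp
        obtain ⟨b, hb, rfl⟩ := List.mem_drop_iff_getElem.1 hq
        refine ⟨s, fun h5 => hs' ?_, ?_⟩
        · rcases (show a ≤ 3 by omega).eq_or_lt with rfl | h6
          · exact h5
          · exact (hp₂ a 3 (by omega) (by omega) h6).neg_subset h5
        · rcases Nat.eq_zero_or_pos b with rfl | h6
          · exact hs
          · exact (hp₁ (i + 2) (i + 2 + b) (by omega) (by omega) (by omega)).neg_subset hs)
      (fun p hp q hq => Ultra.exists_notMem_notMem (h₂.not_neg p (List.mem_of_mem_take hp))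
        (h₁.not_neg q (List.mem_of_mem_drop hq)))
    rw [List.length_drop] at this
    omega
  refine ⟨l₁.take (i + 1) ++ l₂.drop 4, ⟨?_, ?_, ?_⟩, ?_, ?_⟩
  · rw [List.pairwise_append]
    refine ⟨h₁.pairwise.sublist (List.take_sublist _ _),
      h₂.pairwise.sublist (List.drop_sublist _ _), fun p hp q hq => ?_⟩
    obtain ⟨a, ha, rfl⟩ := List.mem_take_iff_getElem.1 hp
    obtain ⟨b, hb, rfl⟩ := List.mem_drop_iff_getElem.1 hq
    exact (hp₁ a (i + 1) (by omega) (by omega) (by omega)).glue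
      (hp₁ (i + 1) (i + 2) (by omega) (by omega) (by omega)) key
      (hp₂ 3 (4 + b) (by omega) (by omega) (by omega))
  · intro p hp
    rcases List.mem_append.1 hp with hp | hp
    · exact h₁.neg p (List.mem_of_mem_take hp)
    · exact h₂.neg p (List.mem_of_mem_drop hp)
  · intro p hp
    rcases List.mem_append.1 hp with hp | hp
    · exact h₁.not_neg p (List.mem_of_mem_take hp)
    · exact h₂.not_neg p (List.mem_of_mem_drop hp)
  · intro p hp
    rcases List.mem_append.1 hp with hp | hp
    · exact Or.inl (List.mem_of_mem_take hp)
    · exact Or.inr (List.mem_of_mem_drop hp)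
  · rw [List.length_append, List.length_take, List.length_drop]
    omega

end Choice

/-! ## The distance of the universal space as a weighted sum -/

section Weights

/-- Every error term below is linear in R, so this makes the summed error finite and independent of
the points. -/
theorem Weights.summable_mul_linear (w : Weights) (a b : ℝ) :
    Summable fun R : ℕ+ => (w.lam R : ℝ) * (a * (R : ℝ) + b) := by
  have h : Summable fun R : ℕ+ => (w.lam R : ℝ) * (3 * (R : ℝ) + 9) := by
    have := NNReal.summable_coe.2 w.summable
    refine this.congr fun R => ?_
    push_cast
    ring
  have h1 : ∀ c : ℝ, Summable fun R : ℕ+ => (w.lam R : ℝ) * (c * R) := fun c => by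
    refine Summable.of_norm_bounded (h.mul_left |c|) fun R => ?_
    have h2 : (0 : ℝ) ≤ w.lam R := (w.lam R).2
    have h3 : (0 : ℝ) ≤ (R : ℝ) := Nat.cast_nonneg _
    rw [norm_mul, norm_mul, Real.norm_of_nonneg h2, Real.norm_of_nonneg h3, Real.norm_eq_abs]
    have : |c| * ((w.lam R : ℝ) * (3 * (R : ℝ) + 9)) - w.lam R * (|c| * R)
      = |c| * w.lam R * (2 * R + 9) := by ring
    have : 0 ≤ |c| * w.lam R * (2 * (R : ℝ) + 9) := by positivity
    linarith
  have h2 : Summable fun R : ℕ+ => (w.lam R : ℝ) * b := by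
    refine Summable.of_norm_bounded (h.mul_left |b|) fun R => ?_
    have h2 : (0 : ℝ) ≤ w.lam R := (w.lam R).2
    have h3 : (0 : ℝ) ≤ (R : ℝ) := Nat.cast_nonneg _
    rw [norm_mul, Real.norm_of_nonneg h2, Real.norm_eq_abs]
    have : |b| * ((w.lam R : ℝ) * (3 * (R : ℝ) + 9)) - w.lam R * |b|
      = |b| * w.lam R * (3 * R + 8) := by ring
    have : 0 ≤ |b| * w.lam R * (3 * (R : ℝ) + 8) := by positivity
    linarith
  exact ((h1 a).add h2).congr fun R => by ring

end Weights

section ChainDist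

variable {S : Type*} [MetricSpace S] {w : Weights}

theorem dualDist_ne_top {x y : Ultra S} (h : wallDist w x y ≠ ∞) (R : ℕ+) :
    dualDist (chains S R) x y ≠ ⊤ := fun htop => by
  refine ENNReal.ne_top_of_tsum_ne_top h R ?_
  rw [htop, ENat.toENNReal_top]
  exact ENNReal.mul_top (by simpa using (w.pos R).ne')

variable [Nonempty S]

/-- The distance given by `R`-chains. -/
noncomputable def chainDist (R : ℕ+) (x y : Space S w) : ℕ := (dualDist (chains S R) x.1 y.1).toNat

theorem coe_chainDist (R : ℕ+) (x y : Space S w) :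
    (chainDist R x y : ℕ∞) = dualDist (chains S R) x.1 y.1 :=
  ENat.natCast_toNat (dualDist_ne_top (Space.wallDist_ne_top x y) R)

omit [Nonempty S] in
theorem chainDist_comm (R : ℕ+) (x y : Space S w) : chainDist R x y = chainDist R y x := by
  rw [chainDist, dualDist_comm, chainDist]

theorem chainDist_triangle (R : ℕ+) (x y z : Space S w) :
    chainDist R x z ≤ chainDist R x y + chainDist R y z := by
  have := dualDist_triangle (C := chains S R) (fun c hc b hb => chains_subset hc hb) x.1 y.1 z.1
  rw [← coe_chainDist, ← coe_chainDist, ← coe_chainDist] at this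
  exact_mod_cast this

theorem ChainFromTo.length_le {R : ℕ+} {x y : Space S w} {l : List (Half S)}
    (h : ChainFromTo (R : ℝ) x.1 y.1 l) : l.length ≤ chainDist R x y := by
  have := h.length_le_dualDist
  rw [← coe_chainDist] at this
  exact_mod_cast this

theorem exists_chain (R : ℕ+) (x y : Space S w) :
    ∃ l, ChainFromTo (R : ℝ) x.1 y.1 l ∧ l.length = chainDist R x y :=
  exists_chainFromTo (coe_chainDist R x y).le

theorem chainDist_mono {R R' : ℕ+} (h : R ≤ R') (x y : Space S w) :
    chainDist R x y ≤ chainDist R' x y := by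
  obtain ⟨l, hl, hln⟩ := exists_chain R x y
  rw [← hln]
  exact (hl.mono (by exact_mod_cast h)).length_le

theorem hasSum_chainDist (x y : Space S w) :
    HasSum (fun R : ℕ+ => (w.lam R : ℝ) * chainDist R x y) (dist x y) := by
  have h := Space.wallDist_ne_top x y
  have h1 := ENNReal.hasSum_toReal h
  have h2 : dist x y = ∑' R : ℕ+, ((w.lam R : ℝ≥0∞) *
      ((dualDist (chains S R) x.1 y.1 : ℕ∞) : ℝ≥0∞)).toReal :=
    ENNReal.tsum_toReal_eq fun R => ENNReal.ne_top_of_tsum_ne_top h R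
  rw [h2]
  convert h1 using 2 with R
  rw [← coe_chainDist, ENNReal.toReal_mul]
  simp

theorem mul_chainDist_le_dist (R : ℕ+) (x y : Space S w) :
    (w.lam R : ℝ) * chainDist R x y ≤ dist x y :=
  le_hasSum (hasSum_chainDist x y) R fun _ _ => by positivity

/-! ## Hyperbolicity -/

/-- Sort a maximal chain `c` from x to y by the positions of u and z: `c₁` leads from x to u, `c₂`
from z to y, and only `c₃` is of no use, as it separates x, u from y, z. Sort a maximal chain `e`
from z to u likewise. Regluing `c₁` with `e₂` and `e₁` with `c₂` costs 3R+12 each. -/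
theorem chainDist_add_chainDist_le (hS : IsGeodesicSpace S) {R : ℕ+} {x y z u : Space S w} {b : ℕ}
    (hb : ∀ l, ChainFromTo (R : ℝ) x.1 y.1 l → ChainFromTo (R : ℝ) u.1 z.1 l → l.length ≤ b) :
    chainDist R x y + chainDist R z u ≤
      chainDist R x u + chainDist R y z + 2 * (3 * R + 12) + 2 * b := by
  classical
  obtain ⟨c, hc, hcn⟩ := exists_chain R x y
  obtain ⟨e, he, hen⟩ := exists_chain R z u
  have hR : 1 ≤ (R : ℕ) := R.pos
  let c₁ := c.filter fun p => ¬ u.1.Neg p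
  let c₂ := (c.filter fun p => u.1.Neg p).filter fun p => z.1.Neg p
  let c₃ := (c.filter fun p => u.1.Neg p).filter fun p => ¬ z.1.Neg p
  let e₁ := e.filter fun p => ¬ y.1.Neg p
  let e₂ := (e.filter fun p => y.1.Neg p).filter fun p => x.1.Neg p
  let e₃ := (e.filter fun p => y.1.Neg p).filter fun p => ¬ x.1.Neg p
  have hcl : c.length = c₁.length + (c₂.length + c₃.length) := by
    have h1 := List.length_eq_length_filter_add (l := c) fun p => decide (u.1.Neg p)
    have h2 := List.length_eq_length_filter_add (l := c.filter fun p => u.1.Neg p)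
      fun p => decide (z.1.Neg p)
    simp only [c₁, c₂, c₃, decide_not]
    omega
  have hel : e.length = e₁.length + (e₂.length + e₃.length) := by
    have h1 := List.length_eq_length_filter_add (l := e) fun p => decide (y.1.Neg p)
    have h2 := List.length_eq_length_filter_add (l := e.filter fun p => y.1.Neg p)
      fun p => decide (x.1.Neg p)
    simp only [e₁, e₂, e₃, decide_not]
    omega
  have mc₁ : ∀ p ∈ c₁, p ∈ c ∧ ¬ u.1.Neg p := fun p hp => by simpa [c₁] using hp
  have mc₂ : ∀ p ∈ c₂, p ∈ c ∧ u.1.Neg p ∧ z.1.Neg p := fun p hp => by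
    simp [c₂] at hp; tauto
  have mc₃ : ∀ p ∈ c₃, p ∈ c ∧ u.1.Neg p ∧ ¬ z.1.Neg p := fun p hp => by
    simp [c₃] at hp; tauto
  have me₁ : ∀ p ∈ e₁, p ∈ e ∧ ¬ y.1.Neg p := fun p hp => by simpa [e₁] using hp
  have me₂ : ∀ p ∈ e₂, p ∈ e ∧ y.1.Neg p ∧ x.1.Neg p := fun p hp => by
    simp [e₂] at hp; tauto
  have me₃ : ∀ p ∈ e₃, p ∈ e ∧ y.1.Neg p ∧ ¬ x.1.Neg p := fun p hp => by
    simp [e₃] at hp; tauto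
  have pc₁ : c₁.Sublist c := List.filter_sublist
  have pc₂ : c₂.Sublist c := List.filter_sublist.trans List.filter_sublist
  have pc₃ : c₃.Sublist c := List.filter_sublist.trans List.filter_sublist
  have pe₁ : e₁.Sublist e := List.filter_sublist
  have pe₂ : e₂.Sublist e := List.filter_sublist.trans List.filter_sublist
  have pe₃ : e₃.Sublist e := List.filter_sublist.trans List.filter_sublist
  have hc₃ : c₃.length ≤ b := hb c₃ (hc.sublist pc₃)
    ⟨hc.pairwise.sublist pc₃, fun p hp => (mc₃ p hp).2.1, fun p hp => (mc₃ p hp).2.2⟩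
  have he₃ : e₃.length ≤ b := by
    rw [← length_reverseChain]
    refine hb _ (ChainFromTo.reverse ⟨he.pairwise.sublist pe₃, fun p hp => (me₃ p hp).2.1,
      fun p hp => (me₃ p hp).2.2⟩) (he.sublist pe₃).reverse
  -- The condition for gluing is witnessed by y, which lies beyond all members of `c` but before
  -- those of `e₂`. For the other pair it is witnessed by u.
  obtain ⟨l, hl, -, hll⟩ := exists_glued_chain hS hR (x := x.1) (y := u.1) (l₁ := c₁) (l₂ := e₂)
    ⟨hc.pairwise.sublist pc₁, fun p hp => hc.neg p (mc₁ p hp).1, fun p hp => (mc₁ p hp).2⟩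
    ⟨he.pairwise.sublist pe₂, fun p hp => (me₂ p hp).2.2, fun p hp => he.not_neg p (me₂ p hp).1⟩
    (fun p hp q hq => by
      obtain ⟨s, h1, h2⟩ := Ultra.exists_mem_notMem (me₂ q hq).2.1 (hc.not_neg p (mc₁ p hp).1)
      exact ⟨s, h2, h1⟩)
  obtain ⟨l', hl', -, hll'⟩ := exists_glued_chain hS hR (x := z.1) (y := y.1) (l₁ := e₁) (l₂ := c₂)
    ⟨he.pairwise.sublist pe₁, fun p hp => he.neg p (me₁ p hp).1, fun p hp => (me₁ p hp).2⟩
    ⟨hc.pairwise.sublist pc₂, fun p hp => (mc₂ p hp).2.2, fun p hp => hc.not_neg p (mc₂ p hp).1⟩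
    (fun p hp q hq => by
      obtain ⟨s, h1, h2⟩ := Ultra.exists_mem_notMem (mc₂ q hq).2.1 (he.not_neg p (me₁ p hp).1)
      exact ⟨s, h2, h1⟩)
  have h1 := ChainFromTo.length_le hl
  have h2 := ChainFromTo.length_le hl'
  rw [chainDist_comm R z y] at h2
  omega

omit [Nonempty S] in
-- The four ultrafilters x, y, z, u occupy the four quadrants of any wall of `l₁` and any wall of
-- `l₂`, so the chains cross.
theorem length_le_of_transverse (hS : IsGeodesicSpace S) {R : ℕ+} {x y z u : Ultra S}
    {l₁ l₂ : List (Half S)} (h₁ : ChainFromTo (R : ℝ) x y l₁) (h₁' : ChainFromTo (R : ℝ) u z l₁)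
    (h₂ : ChainFromTo (R : ℝ) x y l₂) (h₂' : ChainFromTo (R : ℝ) z u l₂) (h4 : 4 ≤ l₁.length) :
    l₂.length ≤ 3 * R + 5 :=
  length_le_of_crossing hS R.pos h₁.pairwise h₂.pairwise h4
    (fun p hp q hq => Ultra.exists_mem_mem (h₁.neg p hp) (h₂.neg q hq))
    (fun p hp q hq => Ultra.exists_mem_notMem (h₁'.neg p hp) (h₂'.not_neg q hq))
    (fun p hp q hq => by
      obtain ⟨s, h1, h2⟩ := Ultra.exists_mem_notMem (h₂'.neg q hq) (h₁'.not_neg p hp)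
      exact ⟨s, h2, h1⟩)
    (fun p hp q hq => Ultra.exists_notMem_notMem (h₁.not_neg p hp) (h₂.not_neg q hq))

/-- Summation over R; the constant is 2(3R+12) + 2(3R+5) = 12R+34. -/
theorem dist_add_dist_le (hS : IsGeodesicSpace S) {x y z u : Space S w}
    (hb : ∀ (R : ℕ+) l, ChainFromTo (R : ℝ) x.1 y.1 l → ChainFromTo (R : ℝ) u.1 z.1 l →
      l.length ≤ 3 * R + 5) :
    dist x y + dist z u ≤ dist x u + dist y z + ∑' R : ℕ+, (w.lam R : ℝ) * (12 * R + 34) := by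
  refine hasSum_le (fun R => ?_) ((hasSum_chainDist x y).add (hasSum_chainDist z u))
    (((hasSum_chainDist x u).add (hasSum_chainDist y z)).add
      (w.summable_mul_linear 12 34).hasSum)
  have h := chainDist_add_chainDist_le hS (hb R)
  have h1 : (chainDist R x y : ℝ) + chainDist R z u ≤
      chainDist R x u + chainDist R y z + (12 * R + 34) := by
    have : chainDist R x y + chainDist R z u ≤
      chainDist R x u + chainDist R y z + (12 * R + 34) := by omega
    exact_mod_cast this
  have h2 : (0 : ℝ) ≤ w.lam R := (w.lam R).2
  have := mul_le_mul_of_nonneg_left h1 h2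
  linarith

theorem isFourPointHyperbolic_space (hS : IsGeodesicSpace S) (w : Weights) :
    IsFourPointHyperbolic (Space S w) := by
  refine ⟨∑' R : ℕ+, (w.lam R : ℝ) * (12 * R + 34), fun x y z u => ?_⟩
  by_cases h₁ : ∀ (R : ℕ+) l, ChainFromTo (R : ℝ) x.1 y.1 l → ChainFromTo (R : ℝ) u.1 z.1 l →
      l.length ≤ 3 * R + 5
  · have := dist_add_dist_le hS h₁
    have := le_max_right (dist x z + dist y u) (dist x u + dist y z)
    linarith
  by_cases h₂ : ∀ (R : ℕ+) l, ChainFromTo (R : ℝ) x.1 y.1 l → ChainFromTo (R : ℝ) z.1 u.1 l →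
      l.length ≤ 3 * R + 5
  · have := dist_add_dist_le hS h₂
    have := le_max_left (dist x z + dist y u) (dist x u + dist y z)
    rw [dist_comm u z] at *
    linarith
  -- The same pairing of the points must serve for all R. If each pairing failed for some R, the two
  -- long chains would both be chains for the larger of the two values, where
  -- `length_le_of_transverse` excludes them.
  push Not at h₁ h₂
  obtain ⟨R, l, hl, hl', hn⟩ := h₁
  obtain ⟨R', l', hm, hm', hn'⟩ := h₂
  exfalso
  rcases le_total R R' with h | h
  · have hR : (R : ℝ) ≤ R' := by exact_mod_cast h
    have := length_le_of_transverse hS (hl.mono hR) (hl'.mono hR) hm hm' (by omega)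
    omega
  · have hR : (R' : ℝ) ≤ R := by exact_mod_cast h
    have := length_le_of_transverse hS (hm.mono hR) (hm'.mono hR) hl hl' (by omega)
    omega

end ChainDist

/-! ## Rough geodesics in the universal space -/

theorem exists_forall_rel_of_finset {α ι : Type*} {s : α → α → Prop} (htot : ∀ a b, s a b ∨ s b a)
    (htrans : ∀ a b c, s a b → s b c → s a c) {I : Set α} {f : ι → α}
    (F : Finset ι) (hf : ∀ i ∈ F, f i ∈ I) (hI : I.Nonempty) : ∃ h ∈ I, ∀ i ∈ F, s (f i) h := by
  classical
  induction F using Finset.induction_on with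
  | empty =>
    obtain ⟨h, hh⟩ := hI
    exact ⟨h, hh, by simp⟩
  | insert i F hi ih =>
    obtain ⟨h, hh, hF⟩ := ih fun j hj => hf j (Finset.mem_insert_of_mem hj)
    have hrefl : ∀ a, s a a := fun a => (htot a a).elim id id
    rcases htot (f i) h with h1 | h1
    · exact ⟨h, hh, fun j hj => by
        rcases Finset.mem_insert.1 hj with rfl | hj
        · exact h1
        · exact hF j hj⟩
    · exact ⟨f i, hf i (Finset.mem_insert_self _ _), fun j hj => by
        rcases Finset.mem_insert.1 hj with rfl | hj
        · exact hrefl _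
        · exact htrans _ _ _ (hF j hj) h1⟩

section Splice

variable {S : Type*} [MetricSpace S]

theorem Ultra.compl_side_mem (x : Ultra S) (h : walls S) : (x.side h)ᶜ ∈ h.1 := by
  obtain ⟨A, hA⟩ := exists_eq_compl_of_mem_walls h.2
  have := x.side_mem h
  rw [hA, Sym2.mem_iff] at this ⊢
  rcases this with h1 | h1
  · rw [h1]; exact Or.inr rfl
  · rw [h1, compl_compl]; exact Or.inl rfl

theorem Ultra.eq_compl_side {x : Ultra S} {h : walls S} {A : Set S} (hA : A ∈ h.1)
    (hne : x.side h ≠ A) : A = (x.side h)ᶜ := by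
  obtain ⟨B, hB⟩ := exists_eq_compl_of_mem_walls h.2
  have := x.side_mem h
  rw [hB, Sym2.mem_iff] at this hA
  rcases this with h1 | h1 <;> rcases hA with h2 | h2
  · exact (hne (h1.trans h2.symm)).elim
  · rw [h1, h2]
  · rw [h1, h2, compl_compl]
  · exact (hne (h1.trans h2.symm)).elim

open Classical in
/-- The ultrafilter that agrees with `y` on `I` and with `x` off `I`. -/
noncomputable def Ultra.splice (x y : Ultra S) (I : Set (walls S))
    (hI : ∀ h k, x.side h ⊆ x.side k → k ∈ I → h ∈ I) : Ultra S where
  side h := if h ∈ I then y.side h else x.side h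
  side_mem h := by
    split_ifs
    · exact y.side_mem h
    · exact x.side_mem h
  consistent h k A B hA hB hAB hs := by
    by_cases hh : h ∈ I
    · rw [if_pos hh] at hs
      have hyB := y.consistent h k A B hA hB hAB hs
      by_cases hk : k ∈ I
      · rw [if_pos hk]
        exact hyB
      · rw [if_neg hk]
        -- If x chooses Bᶜ for k, then it chooses the larger set Aᶜ for h, so k precedes h in the
        -- order given by x and must lie in the downset `I`.
        by_contra hne
        have h1 := x.eq_compl_side hB hne
        have h2 : x.side k = Bᶜ := by rw [h1, compl_compl]
        have h3 : Bᶜ ∈ k.1 := h2 ▸ x.side_mem k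
        have h4 : Aᶜ ∈ h.1 := hs ▸ y.compl_side_mem h
        have h5 := x.consistent k h Bᶜ Aᶜ h3 h4 (compl_subset_compl.2 hAB) h2
        exact hk (hI k h (by rw [h2, h5]; exact compl_subset_compl.2 hAB) hh)
    · rw [if_neg hh] at hs
      have hxB := x.consistent h k A B hA hB hAB hs
      by_cases hk : k ∈ I
      · exact (hh (hI h k (by rw [hs, hxB]; exact hAB) hk)).elim
      · rw [if_neg hk]
        exact hxB

theorem Ultra.splice_side_of_mem {x y : Ultra S} {I : Set (walls S)}
    {hI : ∀ h k, x.side h ⊆ x.side k → k ∈ I → h ∈ I} {h : walls S} (hh : h ∈ I) :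
    (Ultra.splice x y I hI).side h = y.side h := if_pos hh

theorem Ultra.splice_side_of_notMem {x y : Ultra S} {I : Set (walls S)}
    {hI : ∀ h k, x.side h ⊆ x.side k → k ∈ I → h ∈ I} {h : walls S} (hh : h ∉ I) :
    (Ultra.splice x y I hI).side h = x.side h := if_neg hh

theorem wallDist_splice_le (w : Weights) {x y : Ultra S} {I : Set (walls S)}
    {hI : ∀ h k, x.side h ⊆ x.side k → k ∈ I → h ∈ I} :
    wallDist w x (Ultra.splice x y I hI) ≤ wallDist w x y := by
  refine ENNReal.tsum_le_tsum fun R => ?_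
  gcongr
  refine iSup₂_le fun c hc => le_iSup₂_of_le (f := fun (c : Set (walls S))
      (_ : c ∈ {c | c ∈ chains S R ∧ Separates c x y}) => c.encard) c ⟨hc.1, fun h hh => ?_⟩ le_rfl
  have := hc.2 h hh
  by_cases hi : h ∈ I
  · rwa [Ultra.splice_side_of_mem hi] at this
  · rw [Ultra.splice_side_of_notMem hi] at this
    exact (this rfl).elim

theorem chainFromTo_splice_iff {R : ℝ} {x y : Ultra S} {I : Set (walls S)}
    (hI : ∀ h k, x.side h ⊆ x.side k → k ∈ I → h ∈ I) {l : List (Half S)} :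
    ChainFromTo R x (Ultra.splice x y I hI) l ↔
      ChainFromTo R x y l ∧ ∀ p ∈ l, p.wall ∈ I := by
  constructor
  · intro h
    have h1 : ∀ p ∈ l, p.wall ∈ I := fun p hp => by
      by_contra hi
      refine h.not_neg p hp ?_
      rw [Ultra.Neg, Ultra.splice_side_of_notMem hi]
      exact h.neg p hp
    refine ⟨⟨h.pairwise, h.neg, fun p hp => ?_⟩, h1⟩
    have := h.not_neg p hp
    rwa [Ultra.Neg, Ultra.splice_side_of_mem (h1 p hp)] at this
  · rintro ⟨h, h1⟩
    refine ⟨h.pairwise, h.neg, fun p hp => ?_⟩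
    rw [Ultra.Neg, Ultra.splice_side_of_mem (h1 p hp)]
    exact h.not_neg p hp

theorem chainFromTo_splice_iff' {R : ℝ} {x y : Ultra S} {I : Set (walls S)}
    (hI : ∀ h k, x.side h ⊆ x.side k → k ∈ I → h ∈ I) {l : List (Half S)} :
    ChainFromTo R (Ultra.splice x y I hI) y l ↔
      ChainFromTo R x y l ∧ ∀ p ∈ l, p.wall ∉ I := by
  constructor
  · intro h
    have h1 : ∀ p ∈ l, p.wall ∉ I := fun p hp hi => by
      refine h.not_neg p hp ?_
      have := h.neg p hp
      rwa [Ultra.Neg, Ultra.splice_side_of_mem hi] at this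
    refine ⟨⟨h.pairwise, fun p hp => ?_, h.not_neg⟩, h1⟩
    have := h.neg p hp
    rwa [Ultra.Neg, Ultra.splice_side_of_notMem (h1 p hp)] at this
  · rintro ⟨h, h1⟩
    refine ⟨h.pairwise, fun p hp => ?_, h.not_neg⟩
    rw [Ultra.Neg, Ultra.splice_side_of_notMem (h1 p hp)]
    exact h.neg p hp

variable [Nonempty S] {w : Weights}

/-- `Ultra.splice` for points of the universal space. -/
noncomputable def Space.splice (x y : Space S w) (I : Set (walls S))
    (hI : ∀ h k, x.1.side h ⊆ x.1.side k → k ∈ I → h ∈ I) : Space S w :=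
  ⟨Ultra.splice x.1 y.1 I hI, fun s => by
    refine (wallDist_triangle w _ x.1 _).trans_lt (ENNReal.add_lt_top.2 ⟨x.2 s, ?_⟩)
    exact (wallDist_splice_le w).trans_lt (Space.wallDist_ne_top x y).lt_top⟩

theorem chainDist_splice_le (R : ℕ+) (x y : Space S w) {I J : Set (walls S)} (hIJ : I ⊆ J)
    (hI : ∀ h k, x.1.side h ⊆ x.1.side k → k ∈ I → h ∈ I)
    (hJ : ∀ h k, x.1.side h ⊆ x.1.side k → k ∈ J → h ∈ J) :
    chainDist R x (x.splice y I hI) ≤ chainDist R x (x.splice y J hJ) := by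
  obtain ⟨l, hl, hln⟩ := exists_chain R x (x.splice y I hI)
  rw [← hln]
  have := (chainFromTo_splice_iff hI).1 hl
  exact ChainFromTo.length_le ((chainFromTo_splice_iff hJ).2 ⟨this.1, fun p hp => hIJ (this.2 p hp)⟩)

theorem dist_splice_le (x y : Space S w) {I J : Set (walls S)} (hIJ : I ⊆ J)
    (hI : ∀ h k, x.1.side h ⊆ x.1.side k → k ∈ I → h ∈ I)
    (hJ : ∀ h k, x.1.side h ⊆ x.1.side k → k ∈ J → h ∈ J) :
    dist x (x.splice y I hI) ≤ dist x (x.splice y J hJ) := by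
  refine hasSum_le (fun R => ?_) (hasSum_chainDist _ _) (hasSum_chainDist _ _)
  have : (0 : ℝ) ≤ w.lam R := (w.lam R).2
  have := chainDist_splice_le R x y hIJ hI hJ
  gcongr

/-- Chains from x to the splice consist of walls in `I`, and chains from the splice to y of walls
off `I`. As `I` is a downset, no member of the second kind precedes one of the first kind, so the
chains can be glued. -/
theorem chainDist_splice_add_le (hS : IsGeodesicSpace S) (R : ℕ+) (x y : Space S w)
    {I : Set (walls S)} (hI : ∀ h k, x.1.side h ⊆ x.1.side k → k ∈ I → h ∈ I) :
    chainDist R x (x.splice y I hI) + chainDist R (x.splice y I hI) y ≤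
      chainDist R x y + (3 * R + 12) := by
  obtain ⟨l, hl, hln⟩ := exists_chain R x (x.splice y I hI)
  obtain ⟨l', hl', hln'⟩ := exists_chain R (x.splice y I hI) y
  have h1 := (chainFromTo_splice_iff hI).1 hl
  have h2 := (chainFromTo_splice_iff' hI).1 hl'
  obtain ⟨m, hm, -, hmn⟩ := exists_glued_chain hS R.pos h1.1 h2.1 fun p hp q hq => by
    by_contra! hsub
    refine h2.2 q hq (hI q.wall p.wall ?_ (h1.2 p hp))
    rw [Ultra.side_of_neg (h1.1.neg p hp), Ultra.side_of_neg (h2.1.neg q hq)]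
    exact fun s hs => by_contra fun h => hsub s h hs
  have := ChainFromTo.length_le hm
  omega

theorem dist_splice_add_le (hS : IsGeodesicSpace S) (x y : Space S w)
    {I : Set (walls S)} (hI : ∀ h k, x.1.side h ⊆ x.1.side k → k ∈ I → h ∈ I) :
    dist x (x.splice y I hI) + dist (x.splice y I hI) y ≤
      dist x y + ∑' R : ℕ+, (w.lam R : ℝ) * (3 * R + 12) := by
  refine hasSum_le (fun R => ?_) ((hasSum_chainDist _ _).add (hasSum_chainDist _ _))
    ((hasSum_chainDist _ _).add (w.summable_mul_linear 3 12).hasSum)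
  have h1 : (chainDist R x (x.splice y I hI) : ℝ) + chainDist R (x.splice y I hI) y ≤
      chainDist R x y + (3 * R + 12) := by
    exact_mod_cast chainDist_splice_add_le hS R x y hI
  have h2 : (0 : ℝ) ≤ w.lam R := (w.lam R).2
  have := mul_le_mul_of_nonneg_left h1 h2
  linarith

/-- Chains that cross from a downset `I` to a slightly larger initial segment are short. -/
theorem exists_notMem_forall_length_le (hS : IsGeodesicSpace S) {s : walls S → walls S → Prop}
    (htrans : ∀ a b c, s a b → s b c → s a c) (hanti : ∀ a b, s a b → s b a → a = b)
    (R : ℕ+) (x y : Space S w)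
    (hs : ∀ h k, x.1.side h ⊆ x.1.side k → s h k) {I : Set (walls S)} (hI : ∃ h, h ∉ I) :
    ∃ h ∉ I, ∀ l, ChainFromTo (R : ℝ) x.1 y.1 l → (∀ p ∈ l, s p.wall h ∧ p.wall ∉ I) →
      l.length ≤ 3 * R + 13 := by
  classical
  let T : Set ℕ := {n | ∃ l, ChainFromTo (R : ℝ) x.1 y.1 l ∧ (∀ p ∈ l, p.wall ∉ I) ∧ l.length = n}
  have hT : T.Finite := (finite_Iic (chainDist R x y)).subset fun n hn => by
    obtain ⟨l, hl, -, rfl⟩ := hn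
    exact hl.length_le
  have hT0 : T.Nonempty := ⟨0, [], ⟨List.Pairwise.nil, by simp, by simp⟩, by simp, rfl⟩
  -- The witness is the first member of a longest chain off `I`. A chain off `I` that stays below it
  -- glues onto the remainder of the longest chain, so maximality bounds its length by 3R+12, plus 1
  -- for the removed member.
  obtain ⟨n, ⟨l, hl, hlI, rfl⟩, hmax⟩ := hT.exists_maximal hT0
  have hmax' : ∀ l', ChainFromTo (R : ℝ) x.1 y.1 l' → (∀ p ∈ l', p.wall ∉ I) →
      l'.length ≤ l.length := fun l' h1 h2 => by
    rcases le_total l'.length l.length with h | h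
    · exact h
    · exact hmax ⟨l', h1, h2, rfl⟩ h
  cases l with
  | nil =>
    obtain ⟨h, hh⟩ := hI
    refine ⟨h, hh, fun l' h1 h2 => ?_⟩
    have := hmax' l' h1 fun p hp => (h2 p hp).2
    simp at this
    simp [this]
  | cons q l =>
    refine ⟨q.wall, hlI q (by simp), fun l' h1 h2 => ?_⟩
    have hpw := List.pairwise_cons.1 hl.pairwise
    obtain ⟨m, hm, hml, hmn⟩ := exists_glued_chain hS R.pos h1
      (hl.sublist (List.sublist_cons_self q l)) fun p hp r hr => by
        by_contra! hsub
        have h3 : s r.wall p.wall := hs _ _ (by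
          rw [Ultra.side_of_neg (h1.neg p hp),
            Ultra.side_of_neg (hl.neg r (List.mem_cons_of_mem q hr))]
          exact fun s hs => by_contra fun h => hsub s h hs)
        have h4 : s q.wall r.wall := hs _ _ (by
          rw [Ultra.side_of_neg (hl.neg q (by simp)),
            Ultra.side_of_neg (hl.neg r (List.mem_cons_of_mem q hr))]
          exact (hpw.1 r hr).neg_subset)
        exact (hpw.1 r hr).wall_ne (hanti _ _ h4 (htrans _ _ _ h3 (h2 p hp).1))
    have := hmax' m hm fun p hp => by
      rcases hml p hp with h | h
      · exact (h2 p h).2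
      · exact hlI p (List.mem_cons_of_mem q h)
    simp only [List.length_cons] at this
    omega

/-- Passing from x to y wall by wall in a linear order that extends inclusion of the sides chosen by
x, one stops when the distance from x would exceed t. The order on walls need not be discrete, so
the stopping place is the downset `I`, and the distance to its splice z is compared with those to
the points `Z g` for g in and off `I`. -/
theorem exists_interpolate (hS : IsGeodesicSpace S) (w : Weights) :
    ∃ K : ℝ, ∀ (x y : Space S w) (t : ℝ), 0 ≤ t → t ≤ dist x y →
      ∃ z, dist x z ≤ t ∧ t ≤ dist x z + K ∧ dist x z + dist z y ≤ dist x y + K := by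
  classical
  refine ⟨∑' R : ℕ+, (w.lam R : ℝ) * (3 * R + 13) + 1, fun x y t ht0 ht => ?_⟩
  have hK : ∑' R : ℕ+, (w.lam R : ℝ) * (3 * R + 12) ≤ ∑' R : ℕ+, (w.lam R : ℝ) * (3 * R + 13) := by
    refine (w.summable_mul_linear 3 12).tsum_le_tsum (fun R => ?_) (w.summable_mul_linear 3 13)
    have : (0 : ℝ) ≤ w.lam R := (w.lam R).2
    gcongr
    norm_num
  have hK0 : 0 ≤ ∑' R : ℕ+, (w.lam R : ℝ) * (3 * R + 13) := tsum_nonneg fun R => by positivity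
  have : IsPartialOrder (walls S) fun h k => x.1.side h ⊆ x.1.side k :=
    { refl := fun h => Subset.rfl
      trans := fun _ _ _ => Subset.trans
      antisymm := fun h k h1 h2 => by
        have h3 := h1.antisymm h2
        have : ∀ h : walls S, h.1 = s(x.1.side h, (x.1.side h)ᶜ) := fun h => by
          obtain ⟨A, hA⟩ := exists_eq_compl_of_mem_walls h.2
          have := x.1.side_mem h
          rw [hA, Sym2.mem_iff] at this
          rw [hA]
          rcases this with h | h
          · rw [h]
          · rw [h, compl_compl, Sym2.eq_swap]
        exact Subtype.ext (by rw [this h, this k, h3]) }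
  obtain ⟨s, hlin, hs⟩ := extend_partialOrder fun h k : walls S => x.1.side h ⊆ x.1.side k
  have htot : ∀ a b, s a b ∨ s b a := total_of s
  have htrans : ∀ a b c, s a b → s b c → s a c := fun a b c => trans_of s
  have hanti : ∀ a b, s a b → s b a → a = b := fun a b => antisymm_of s
  have hrefl : ∀ a, s a a := refl_of s
  have hdown : ∀ I : Set (walls S), (∀ h k, s h k → k ∈ I → h ∈ I) →
      ∀ h k, x.1.side h ⊆ x.1.side k → k ∈ I → h ∈ I := fun I hI h k hhk => hI h k (hs h k hhk)
  have hseg : ∀ g : walls S, ∀ h k, s h k → k ∈ {k | s k g} → h ∈ {k | s k g} :=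
    fun g h k h1 h2 => htrans h k g h1 h2
  let Z : walls S → Space S w := fun g => x.splice y {k | s k g} (hdown _ (hseg g))
  let I : Set (walls S) := {g | dist x (Z g) ≤ t}
  have hIs : ∀ h k, s h k → k ∈ I → h ∈ I := fun h k hhk hk =>
    (dist_splice_le x y (fun g hg => htrans g h k hg hhk) _ _).trans hk
  let z := x.splice y I (hdown I hIs)
  -- A finite partial sum of the series involves finitely many walls of `I`, which lie below a
  -- single h in `I`; so it is bounded by the distance from x to `Z h`.
  have hz : dist x z ≤ t := by
    refine hasSum_le_of_sum_le (hasSum_chainDist x z) fun F => ?_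
    choose l hl hln using fun R : ℕ+ => exists_chain R x z
    have hl' := fun R => (chainFromTo_splice_iff (hdown I hIs)).1 (hl R)
    by_cases hI : I.Nonempty
    · have h1 : ∀ R, ∃ h ∈ I, ∀ p ∈ l R, s p.wall h := fun R => by
        obtain ⟨h, hh, hp⟩ := exists_forall_rel_of_finset htot htrans (f := Half.wall)
          (I := I) (l R).toFinset (fun p hp => (hl' R).2 p (by simpa using hp)) hI
        exact ⟨h, hh, fun p hp' => hp p (by simpa using hp')⟩
      choose f hf hfl using h1
      obtain ⟨h, hh, hfh⟩ := exists_forall_rel_of_finset htot htrans F (fun R _ => hf R) hI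
      have h2 : ∀ R ∈ F, (w.lam R : ℝ) * chainDist R x z ≤ w.lam R * chainDist R x (Z h) := by
        intro R hR
        have h3 : chainDist R x z ≤ chainDist R x (Z h) := by
          rw [← hln]
          exact ChainFromTo.length_le ((chainFromTo_splice_iff (hdown _ (hseg h))).2 ⟨(hl' R).1, fun p hp =>
            htrans _ _ _ (hfl R p hp) (hfh R hR)⟩)
        have : (0 : ℝ) ≤ w.lam R := (w.lam R).2
        gcongr
      exact ((Finset.sum_le_sum h2).trans
        (sum_le_hasSum F (fun R _ => by positivity) (hasSum_chainDist x (Z h)))).trans hh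
    · have h1 : ∀ R, chainDist R x z = 0 := fun R => by
        rw [← hln, List.length_eq_zero_iff, List.eq_nil_iff_forall_not_mem]
        exact fun p hp => hI ⟨_, (hl' R).2 p hp⟩
      simpa [h1] using ht0
  have hzy := dist_splice_add_le hS x y (hdown I hIs)
  refine ⟨z, hz, ?_, hzy.trans (by linarith)⟩
  by_cases hI : ∃ h, h ∉ I
  · have h1 := fun R => exists_notMem_forall_length_le hS htrans hanti R x y hs hI
    choose f hf hfl using h1
    -- Up to an error of 1, finitely many R account for d(x,y). Below the least of the corresponding
    -- walls `f R`, R-chains off `I` have length at most 3R+13, so d(x,z) is not far below the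
    -- distance to `Z h`, which exceeds t.
    obtain ⟨F, hF⟩ := ((hasSum_chainDist x y).eventually
      (lt_mem_nhds (show dist x y - 1 < dist x y by linarith))).exists
    obtain ⟨h, hh, hfh⟩ := exists_forall_rel_of_finset (s := fun a b => s b a)
      (fun a b => htot b a) (fun a b c h1 h2 => htrans c b a h2 h1) (I := Iᶜ) F
      (fun R _ => hf R) hI
    have hh' : t < dist x (Z h) := not_le.1 hh
    have hterm : ∀ R, (w.lam R : ℝ) * chainDist R x (Z h) ≤ w.lam R * chainDist R x z +
        w.lam R * (3 * R + 13) + (w.lam R * chainDist R x y -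
          if R ∈ F then (w.lam R : ℝ) * chainDist R x y else 0) := by
      intro R
      have h0 : (0 : ℝ) ≤ w.lam R := (w.lam R).2
      by_cases hR : R ∈ F
      · rw [if_pos hR, sub_self, add_zero, ← mul_add]
        refine mul_le_mul_of_nonneg_left ?_ h0
        obtain ⟨l, hl, hln⟩ := exists_chain R x (Z h)
        obtain ⟨hl1, hl2⟩ := (chainFromTo_splice_iff (hdown _ (hseg h))).1 hl
        have h2 : (l.filter fun p => p.wall ∈ I).length ≤ chainDist R x z :=
          ChainFromTo.length_le ((chainFromTo_splice_iff (hdown I hIs)).2 ⟨hl1.sublist List.filter_sublist,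
            fun p hp => by simpa using (List.mem_filter.1 hp).2⟩)
        have h3 : (l.filter fun p => ¬ p.wall ∈ I).length ≤ 3 * R + 13 :=
          hfl R _ (hl1.sublist List.filter_sublist) fun p hp =>
            ⟨htrans _ _ _ (hl2 p (List.mem_filter.1 hp).1) (hfh R hR),
              by simpa using (List.mem_filter.1 hp).2⟩
        have h4 := List.length_eq_length_filter_add (l := l) fun p => decide (p.wall ∈ I)
        simp only [decide_not] at h3
        rw [← hln]
        exact_mod_cast (by omega : l.length ≤ chainDist R x z + (3 * R + 13))
      · rw [if_neg hR, sub_zero]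
        have h2 : chainDist R x (Z h) ≤ chainDist R x y := by
          obtain ⟨l, hl, hln⟩ := exists_chain R x (Z h)
          rw [← hln]
          exact ChainFromTo.length_le ((chainFromTo_splice_iff (hdown _ (hseg h))).1 hl).1
        have h3 : (w.lam R : ℝ) * chainDist R x (Z h) ≤ w.lam R * chainDist R x y := by gcongr
        have h4 : 0 ≤ (w.lam R : ℝ) * chainDist R x z := by positivity
        have h5 : 0 ≤ (w.lam R : ℝ) * (3 * R + 13) := by positivity
        linarith
    have hsumF : HasSum (fun R => if R ∈ F then (w.lam R : ℝ) * chainDist R x y else 0)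
        (∑ R ∈ F, (w.lam R : ℝ) * chainDist R x y) := by
      have : HasSum (fun R => if R ∈ F then (w.lam R : ℝ) * chainDist R x y else 0)
          (∑ R ∈ F, if R ∈ F then (w.lam R : ℝ) * chainDist R x y else 0) :=
        hasSum_sum_of_ne_finset_zero fun R hR => if_neg hR
      rwa [Finset.sum_congr rfl fun R hR => if_pos hR] at this
    have := hasSum_le hterm (hasSum_chainDist x (Z h)) (((hasSum_chainDist x z).add
      (w.summable_mul_linear 3 13).hasSum).add ((hasSum_chainDist x y).sub hsumF))
    linarith
  · push Not at hI
    have h1 : z = y := by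
      refine Subtype.ext (WallUltrafilter.ext (funext fun h => ?_))
      exact Ultra.splice_side_of_mem (hI := hdown I hIs) (hI h)
    rw [h1]
    linarith

/-- Interpolation supplies points at every distance from x that lie almost between x and y.
Hyperbolicity, applied to two of them together with x and y, makes their mutual distance almost the
difference of their distances from x. -/
theorem isRoughlyGeodesic_space (hS : IsGeodesicSpace S) (w : Weights) :
    IsRoughlyGeodesic (Space S w) := by
  obtain ⟨δ, hδ⟩ := isFourPointHyperbolic_space hS w
  obtain ⟨K, hK⟩ := exists_interpolate hS w
  refine ⟨|δ| + 4 * |K| + 4, fun x y => ?_⟩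
  have hf : ∀ i : ℕ, ∃ z, (i = 0 → z = x) ∧ (⌊dist x y⌋₊ + 1 = i → z = y) ∧
      (i ≤ ⌊dist x y⌋₊ + 1 → |dist x z - i| ≤ |K| + 1 ∧ dist x z + dist z y ≤ dist x y + |K|) := by
    intro i
    have hfl := Nat.lt_floor_add_one (dist x y)
    have hfl' := Nat.floor_le (dist_nonneg (x := x) (y := y))
    have hK1 := le_abs_self K
    have hK0 := abs_nonneg K
    by_cases h0 : i = 0
    · subst h0
      refine ⟨x, fun _ => rfl, fun h => by omega, fun _ => ?_⟩
      simp only [dist_self, Nat.cast_zero, sub_zero, abs_zero]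
      exact ⟨by linarith, by linarith⟩
    by_cases h1 : ⌊dist x y⌋₊ + 1 = i
    · subst h1
      refine ⟨y, fun h => by omega, fun _ => rfl, fun _ => ?_⟩
      rw [dist_self, abs_le]
      push_cast
      exact ⟨⟨by linarith, by linarith⟩, by linarith⟩
    by_cases h2 : i ≤ ⌊dist x y⌋₊ + 1
    · obtain ⟨z, hz1, hz2, hz3⟩ := hK x y i (Nat.cast_nonneg i)
        ((Nat.cast_le.2 (by omega : i ≤ ⌊dist x y⌋₊)).trans hfl')
      refine ⟨z, fun h => (h0 h).elim, fun h => (h1 h).elim, fun _ => ⟨?_, by linarith⟩⟩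
      rw [abs_le]
      constructor <;> linarith
    · exact ⟨x, fun h => (h0 h).elim, fun h => (h1 h).elim, fun h => (h2 h).elim⟩
  choose z hz0 hzn hz using hf
  -- The additional 1 gives the endpoints different indices even if d(x,y) < 1.
  refine ⟨⌊dist x y⌋₊ + 1, z, hz0 0 rfl, hzn _ rfl, fun i hi j hj => ?_⟩
  obtain ⟨h1, h2⟩ := hz i hi
  obtain ⟨h3, h4⟩ := hz j hj
  have h5 := hδ (z i) (z j) x y
  have h6 := le_abs_self δ
  have h7 := dist_triangle x (z i) (z j)
  have h8 := dist_triangle x (z j) (z i)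
  have h9 := dist_triangle x (z i) y
  have h10 := dist_triangle x (z j) y
  rw [dist_comm (z j) (z i)] at h8
  rw [dist_comm (z i) x, dist_comm (z j) x] at h5
  rw [abs_le] at h1 h3 ⊢
  rw [Real.dist_eq]
  have hd := abs_nonneg δ
  have hk := abs_nonneg K
  rcases abs_cases ((i : ℝ) - j) with ⟨h11, h12⟩ | ⟨h11, h12⟩ <;>
    rcases max_cases (dist x (z i) + dist (z j) y) (dist (z i) y + dist x (z j)) with
      ⟨h13, h14⟩ | ⟨h13, h14⟩ <;> rw [h11] <;> constructor <;> linarith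

end Splice

/-! ## Points of `S` as points of the universal space -/

section Principal

variable {S : Type*} [MetricSpace S]

/-- All members of the chain except the first and the last are curtains crossed on the way from s to
t, each of thickness 8. The bound does not depend on R, so it can be summed against the weights. -/
theorem length_le_dist_add_two (hS : IsGeodesicSpace S) {R : ℝ} {s t : S} {l : List (Half S)}
    (hl : ChainFromTo R (principal s) (principal t) l) : (l.length : ℝ) ≤ dist s t + 2 := by
  by_cases hn : l.length ≤ 2
  · have : (l.length : ℝ) ≤ 2 := by exact_mod_cast hn
    linarith [dist_nonneg (x := s) (y := t)]
  have hpw := List.pairwise_iff_getElem.1 hl.pairwise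
  set n := l.length with hndef
  let 𝔨 : ℕ → Curtain S := fun i => if h : i < n then (l[i]'h).curtain else l[0].curtain
  have h𝔨 : ∀ i (h : i < n), 𝔨 i = (l[i]'h).curtain := fun i h => by simp [𝔨, h]
  have h0 := Ultra.principal_neg_iff.1 (hl.neg l[0] (List.getElem_mem _))
  have h1 : t ∉ l[n - 1].neg := fun h =>
    hl.not_neg l[n - 1] (List.getElem_mem _) (Ultra.principal_neg_iff.2 h)
  have := Curtain.le_dist_of_precedes hS (𝔨 := 𝔨) (i := 1) (j := n - 2) (R := R) (by omega)
    (fun m h1 h2 => by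
      rw [h𝔨 m (by omega), h𝔨 (m + 1) (by omega)]
      exact hpw _ _ _ _ (by omega))
    (x := s) (y := t) (by
      rw [h𝔨 1 (by omega)]
      exact (hpw 0 1 (by omega) (by omega) one_pos).neg_subset_minus h0)
    (by
      rw [h𝔨 _ (by omega)]
      exact (hpw (n - 2) (n - 1) (by omega) (by omega) (by omega)).mem_plus h1)
  rw [Nat.cast_sub (by omega)] at this
  have h3 : (3 : ℝ) ≤ n := by exact_mod_cast (by omega : 3 ≤ n)
  push_cast at this
  linarith

theorem wallDist_principal_lt_top (hS : IsGeodesicSpace S) (w : Weights) (s t : S) :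
    wallDist w (principal s) (principal t) < ∞ := by
  have h1 : ∀ R : ℕ+, dualDist (chains S R) (principal s) (principal t) ≤ ⌊dist s t + 2⌋₊ := by
    intro R
    by_contra! h
    have h2 : ((⌊dist s t + 2⌋₊ + 1 : ℕ) : ℕ∞) ≤
        dualDist (chains S R) (principal s) (principal t) := by
      push_cast
      exact Order.add_one_le_of_lt h
    obtain ⟨l, hl, hln⟩ := exists_chainFromTo h2
    have h3 := length_le_dist_add_two hS hl
    rw [hln] at h3
    have := Nat.lt_floor_add_one (dist s t + 2)
    push_cast at h3
    linarith
  have h2 : wallDist w (principal s) (principal t) ≤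
      ∑' R : ℕ+, (w.lam R : ℝ≥0∞) * (⌊dist s t + 2⌋₊ : ℝ≥0∞) := by
    refine ENNReal.tsum_le_tsum fun R => ?_
    gcongr
    exact_mod_cast ENat.toENNReal_mono (h1 R)
  refine h2.trans_lt ?_
  rw [ENNReal.tsum_mul_right]
  refine ENNReal.mul_lt_top ?_ (ENNReal.natCast_lt_top _)
  rw [lt_top_iff_ne_top, ENNReal.tsum_coe_ne_top_iff_summable, ← NNReal.summable_coe]
  exact (w.summable_mul_linear 0 1).congr fun R => by simp

/-- The point of the universal space given by a point of `S`. -/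
noncomputable def Space.ofPoint (hS : IsGeodesicSpace S) (w : Weights) (s : S) : Space S w :=
  ⟨principal s, fun t => wallDist_principal_lt_top hS w t s⟩

theorem Space.smul_ofPoint (hS : IsGeodesicSpace S) (w : Weights) {G : Type*} [Group G]
    [MulAction G S] [IsIsometricSMul G S] (g : G) (s : S) :
    g • Space.ofPoint hS w s = Space.ofPoint hS w (g • s) :=
  Subtype.ext (mapUltra_principal (IsometryEquiv.constSMul g) s)

variable [Nonempty S]

theorem chainDist_ofPoint_le (hS : IsGeodesicSpace S) {w : Weights} (R : ℕ+) (s t : S) :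
    (chainDist R (Space.ofPoint hS w s) (Space.ofPoint hS w t) : ℝ) ≤ dist s t + 2 := by
  obtain ⟨l, hl, hln⟩ := exists_chain R (Space.ofPoint hS w s) (Space.ofPoint hS w t)
  rw [← hln]
  exact length_le_dist_add_two hS hl

theorem dist_ofPoint_le (hS : IsGeodesicSpace S) {w : Weights} (s t : S) :
    dist (Space.ofPoint hS w s) (Space.ofPoint hS w t) ≤
      (∑' R : ℕ+, (w.lam R : ℝ)) * (dist s t + 2) := by
  have h : Summable fun R : ℕ+ => (w.lam R : ℝ) :=
    (w.summable_mul_linear 0 1).congr fun R => by simp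
  refine hasSum_le (fun R => ?_) (hasSum_chainDist _ _) (h.hasSum.mul_right _)
  exact mul_le_mul_of_nonneg_left (chainDist_ofPoint_le hS R s t) (w.lam R).2

end Principal

/-! ## Stability of quasigeodesics in hyperbolic spaces -/

section MorseLemma

variable {Y : Type*} [MetricSpace Y]

/-- In terms of twice the Gromov product based at u, hyperbolicity says that joining two pairs with
a common point costs δ. Repeated bisection of the chain costs δ once per halving, hence only
logarithmically in its length. -/
theorem le_gromovProduct_of_chain {δ : ℝ} (hδ : ∀ x₁ x₂ x₃ x₄ : Y,
    dist x₁ x₂ + dist x₃ x₄ ≤ δ + max (dist x₁ x₃ + dist x₂ x₄) (dist x₁ x₄ + dist x₂ x₃))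
    (u : Y) {c : ℝ} (p : ℕ) (f : ℕ → Y) {n : ℕ} (hn : 1 ≤ n) (hnp : n ≤ 2 ^ p)
    (hf : ∀ i < n, c ≤ dist (f i) u + dist (f (i + 1)) u - dist (f i) (f (i + 1))) :
    c - p * δ ≤ dist (f 0) u + dist (f n) u - dist (f 0) (f n) := by
  have hδ0 : 0 ≤ δ := by simpa using hδ u u u u
  induction p generalizing f n with
  | zero =>
    obtain rfl : n = 1 := by simp at hnp; omega
    simpa using hf 0 one_pos
  | succ p ih =>
    by_cases hnp' : n ≤ 2 ^ p
    · have := ih f hn hnp' hf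
      push_cast
      linarith
    · have h1 := ih f (n := 2 ^ p) Nat.one_le_two_pow le_rfl fun i hi => hf i (by omega)
      have h2 := ih (fun i => f (2 ^ p + i)) (n := n - 2 ^ p) (by omega)
        (by rw [pow_succ] at hnp; omega) fun i hi => by
          simpa [add_assoc] using hf (2 ^ p + i) (by omega)
      simp only [add_zero, show 2 ^ p + (n - 2 ^ p) = n by omega] at h2
      have h3 := hδ (f 0) (f n) (f (2 ^ p)) u
      rw [dist_comm (f n) (f (2 ^ p))] at h3
      push_cast
      rcases max_cases (dist (f 0) (f (2 ^ p)) + dist (f n) u)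
        (dist (f 0) u + dist (f (2 ^ p)) (f n)) with ⟨h4, h5⟩ | ⟨h4, h5⟩ <;> linarith

/-- This ends the argument for stability of quasigeodesics, where an excursion is at most linear in
p while 2 ^ p is at most linear in the excursion. -/
theorem exists_log_bound (A B : ℝ) : ∃ P : ℕ, ∀ p : ℕ, (2 : ℝ) ^ p ≤ A * p + B → p ≤ P := by
  have h1 : Filter.Tendsto (fun n : ℕ => (n : ℝ) ^ 1 / (2 : ℝ) ^ n) Filter.atTop (nhds 0) :=
    tendsto_pow_const_div_const_pow_of_one_lt 1 one_lt_two
  have h2 : Filter.Tendsto (fun n : ℕ => (n : ℝ) ^ 0 / (2 : ℝ) ^ n) Filter.atTop (nhds 0) :=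
    tendsto_pow_const_div_const_pow_of_one_lt 0 one_lt_two
  have h3 := (h1.const_mul A).add (h2.const_mul B)
  simp only [mul_zero, add_zero] at h3
  obtain ⟨P, hP⟩ := Filter.eventually_atTop.1 (h3.eventually (gt_mem_nhds one_pos))
  refine ⟨P, fun p hp => ?_⟩
  by_contra! hlt
  have h4 := hP p hlt.le
  rw [pow_one, pow_zero, mul_div_assoc', mul_div_assoc', ← add_div, div_lt_one (by positivity)] at h4
  linarith

theorem exists_pow_two_between (q : ℕ) : ∃ p : ℕ, q ≤ 2 ^ p ∧ 2 ^ p ≤ 2 * q + 1 := by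
  rcases Nat.eq_zero_or_pos q with rfl | hq
  · exact ⟨0, by simp, by simp⟩
  · refine ⟨Nat.log 2 q + 1, (Nat.lt_pow_succ_log_self one_lt_two q).le, ?_⟩
    have := Nat.pow_log_le_self 2 hq.ne'
    rw [pow_succ]
    omega

theorem gromovProduct_triple {δ : ℝ} (hδ : ∀ x₁ x₂ x₃ x₄ : Y,
    dist x₁ x₂ + dist x₃ x₄ ≤ δ + max (dist x₁ x₃ + dist x₂ x₄) (dist x₁ x₄ + dist x₂ x₃))
    {u x y z : Y} {c : ℝ} (h1 : c ≤ dist x u + dist y u - dist x y)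
    (h2 : c ≤ dist y u + dist z u - dist y z) : c - δ ≤ dist x u + dist z u - dist x z := by
  have h3 := hδ x z y u
  rw [dist_comm z y] at h3
  rcases max_cases (dist x y + dist z u) (dist x u + dist y z) with ⟨h4, h5⟩ | ⟨h4, h5⟩ <;> linarith

/-- `η` is a discrete quasigeodesic. -/
def IsDiscreteQuasigeodesic (K C : ℝ) (η : ℕ → Y) (N : ℕ) : Prop :=
  ∀ i ≤ N, ∀ j ≤ N, |(i : ℝ) - j| / K - C ≤ dist (η i) (η j) ∧
    dist (η i) (η j) ≤ K * |(i : ℝ) - j| + C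

/-- Consecutive points outside the ball of radius ρ about u have doubled Gromov product at least 2ρ
- (K + C). -/
theorem IsDiscreteQuasigeodesic.le_gromovProduct {δ : ℝ} (hδ : ∀ x₁ x₂ x₃ x₄ : Y,
    dist x₁ x₂ + dist x₃ x₄ ≤ δ + max (dist x₁ x₃ + dist x₂ x₄) (dist x₁ x₄ + dist x₂ x₃))
    {K C : ℝ} (hKC : 0 ≤ K + C) {η : ℕ → Y} {N : ℕ} (hη : IsDiscreteQuasigeodesic K C η N) {u : Y}
    {ρ : ℝ} (hρ : ∀ j ≤ N, ρ ≤ dist (η j) u) {i j p : ℕ} (hij : i ≤ j) (hj : j ≤ N)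
    (hp : j - i ≤ 2 ^ p) :
    2 * ρ - (K + C) - p * δ ≤ dist (η i) u + dist (η j) u - dist (η i) (η j) := by
  have hδ0 : 0 ≤ δ := by simpa using hδ u u u u
  rcases hij.eq_or_lt with rfl | hlt
  · have := hρ i hj
    have : 0 ≤ p * δ := by positivity
    rw [dist_self]
    linarith
  · have := le_gromovProduct_of_chain hδ u (c := 2 * ρ - (K + C)) p (fun m => η (i + m))
      (n := j - i) (by omega) hp (fun m hm => by
        have h1 := hρ (i + m) (by omega)
        have h2 := hρ (i + (m + 1)) (by omega)
        have h3 := (hη (i + m) (by omega) (i + (m + 1)) (by omega)).2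
        push_cast at h3
        rw [show (i : ℝ) + m - (i + (m + 1)) = -1 by ring, abs_neg, abs_one] at h3
        linarith)
    simpa [show i + (j - i) = j by omega] using this

/-- Let ρ be the largest distance from a point zₘ of the rough geodesic to η. A detour from a point
about 2ρ before zₘ to one about 2ρ behind it, via η, avoids the ball of radius ρ about zₘ and has
O(ρ) steps. So the product of its ends at zₘ is at least 2ρ - O(log ρ), whereas betweenness bounds
it by 3k. -/
theorem exists_dist_roughGeodesic_le (hY : IsFourPointHyperbolic Y)
    {K C k : ℝ} (hK : 1 ≤ K) (hC : 0 ≤ C) :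
    ∃ ρ₀ : ℝ, ∀ (η : ℕ → Y) (N : ℕ), IsDiscreteQuasigeodesic K C η N →
      ∀ (n : ℕ) (z : ℕ → Y), z 0 = η 0 → z n = η N →
      (∀ i ≤ n, ∀ j ≤ n, |dist (z i) (z j) - dist (i : ℝ) (j : ℝ)| ≤ k) →
      ∀ m ≤ n, ∃ j ≤ N, dist (z m) (η j) ≤ ρ₀ := by
  obtain ⟨δ, hδ⟩ := hY
  have hK0 : 0 < K := by linarith
  set c : ℝ := 4 * k + K + C + 2 * δ with hc
  obtain ⟨P, hP⟩ := exists_log_bound (12 * K * δ) (2 * K * (6 * c + 2 + k + C) + 1)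
  refine ⟨c + δ * P, fun η N hη n z hz0 hzn hz => ?_⟩
  have hδ0 : 0 ≤ δ := by simpa using hδ (η 0) (η 0) (η 0) (η 0)
  have hk0 : 0 ≤ k := by simpa using hz 0 (Nat.zero_le _) 0 (Nat.zero_le _)
  have hmin : ∀ i, ∃ j ≤ N, ∀ j' ≤ N, dist (z i) (η j) ≤ dist (z i) (η j') := fun i => by
    obtain ⟨j, hj, h⟩ := (Finset.range (N + 1)).exists_min_image (fun j => dist (z i) (η j))
      ⟨0, by simp⟩
    exact ⟨j, by simpa [Nat.lt_succ_iff] using hj, fun j' hj' =>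
      h j' (by simpa [Nat.lt_succ_iff] using hj')⟩
  choose J hJ hJmin using hmin
  obtain ⟨m, hm, hmax⟩ := (Finset.range (n + 1)).exists_max_image (fun i => dist (z i) (η (J i)))
    ⟨0, by simp⟩
  have hm : m ≤ n := by simpa [Nat.lt_succ_iff] using hm
  have hmax : ∀ i ≤ n, dist (z i) (η (J i)) ≤ dist (z m) (η (J m)) := fun i hi =>
    hmax i (by simpa [Nat.lt_succ_iff] using hi)
  set ρ := dist (z m) (η (J m)) with hρdef
  suffices hρ : ρ ≤ c + δ * P from fun i hi => ⟨J i, hJ i, (hmax i hi).trans hρ⟩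
  have hρ0 : 0 ≤ ρ := dist_nonneg
  have hfar : ∀ j ≤ N, ρ ≤ dist (η j) (z m) := fun j hj => by
    rw [dist_comm]
    exact hJmin m j hj
  set L := ⌈2 * ρ⌉₊ with hL
  have hL1 : 2 * ρ ≤ L := Nat.le_ceil _
  have hL2 : (L : ℝ) < 2 * ρ + 1 := Nat.ceil_lt_add_one (by linarith)
  have hzd : ∀ i ≤ n, ∀ j ≤ n, i ≤ j → (j : ℝ) - i - k ≤ dist (z i) (z j) ∧
      dist (z i) (z j) ≤ j - i + k := fun i hi j hj hij => by
    have h1 := abs_le.1 (hz i hi j hj)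
    have h2 : (i : ℝ) ≤ j := by exact_mod_cast hij
    rw [Real.dist_eq, abs_of_nonpos (by linarith)] at h1
    constructor <;> linarith [h1.1, h1.2]
  have hend0 : dist (z 0) (η (J 0)) ≤ 0 := by
    have := hJmin 0 0 (Nat.zero_le _)
    rw [hz0, dist_self] at this
    rwa [hz0]
  have hendn : dist (z n) (η (J n)) ≤ 0 := by
    have := hJmin n N le_rfl
    rw [hzn, dist_self] at this
    rwa [hzn]
  -- Going back by 2ρ makes the jump from `z a` to η, of length at most ρ, invisible from `z m`. If
  -- the rough geodesic starts too soon, its initial point lies on η and no jump is needed.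
  obtain ⟨a, ha, ham, haL, haG⟩ : ∃ a, a ≤ n ∧ a ≤ m ∧ m ≤ a + L ∧
      2 * ρ - k ≤ dist (z a) (z m) + dist (η (J a)) (z m) - dist (z a) (η (J a)) := by
    have h1 := fun a => hfar (J a) (hJ a)
    by_cases hmL : L ≤ m
    · refine ⟨m - L, by omega, by omega, by omega, ?_⟩
      have h2 := (hzd (m - L) (by omega) m hm (by omega)).1
      rw [Nat.cast_sub hmL] at h2
      linarith [h1 (m - L), hmax (m - L) (by omega)]
    · refine ⟨0, by omega, by omega, by omega, ?_⟩
      have h2 := dist_triangle (η (J 0)) (z 0) (z m)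
      rw [dist_comm (η (J 0)) (z 0)] at h2
      linarith [h1 0]
  obtain ⟨b, hb, hbm, hbL, hbG⟩ : ∃ b, b ≤ n ∧ m ≤ b ∧ b ≤ m + L ∧
      2 * ρ - k ≤ dist (z b) (z m) + dist (η (J b)) (z m) - dist (z b) (η (J b)) := by
    have h1 := fun a => hfar (J a) (hJ a)
    by_cases hmL : m + L ≤ n
    · refine ⟨m + L, by omega, by omega, by omega, ?_⟩
      have h2 := (hzd m hm (m + L) (by omega) (by omega)).1
      rw [dist_comm (z m)] at h2
      push_cast at h2
      linarith [h1 (m + L), hmax (m + L) (by omega)]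
    · refine ⟨n, by omega, by omega, by omega, ?_⟩
      have h2 := dist_triangle (η (J n)) (z n) (z m)
      rw [dist_comm (η (J n)) (z n)] at h2
      linarith [h1 n]
  have hab := hzd a ha b hb (by omega)
  have ham' := hzd a ha m hm ham
  have hbm' := hzd m hm b hb hbm
  -- the number of steps of the quasigeodesic
  obtain ⟨q, hq, hqK⟩ : ∃ q : ℕ, (J a - J b ≤ q ∧ J b - J a ≤ q) ∧
      (q : ℝ) ≤ K * (6 * ρ + 2 + k + C) := by
    have h1 := (hη (J a) (hJ a) (J b) (hJ b)).1
    have h2 := dist_triangle4 (η (J a)) (z a) (z b) (η (J b))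
    rw [dist_comm (η (J a)) (z a)] at h2
    have h3 : |(J a : ℝ) - J b| / K ≤ 6 * ρ + 2 + k + C := by
      have h4 : (b : ℝ) - a ≤ 2 * L := by
        have : b ≤ a + 2 * L := by omega
        have : (b : ℝ) ≤ a + 2 * L := by exact_mod_cast this
        linarith
      linarith [hmax a ha, hmax b hb]
    rw [div_le_iff₀ hK0] at h3
    refine ⟨(J a - J b) + (J b - J a), ⟨by omega, by omega⟩, ?_⟩
    have h5 : (((J a - J b) + (J b - J a) : ℕ) : ℝ) = |(J a : ℝ) - J b| := by
      rcases le_total (J a) (J b) with h | h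
      · have h' : (J a : ℝ) ≤ J b := by exact_mod_cast h
        rw [Nat.sub_eq_zero_of_le h, zero_add, Nat.cast_sub h, abs_of_nonpos (by linarith)]
        ring
      · have h' : (J b : ℝ) ≤ J a := by exact_mod_cast h
        rw [Nat.sub_eq_zero_of_le h, add_zero, Nat.cast_sub h, abs_of_nonneg (by linarith)]
    rw [h5]
    linarith
  obtain ⟨p, hp1, hp2⟩ := exists_pow_two_between q
  have hG : 2 * ρ - (K + C) - p * δ ≤
      dist (η (J a)) (z m) + dist (η (J b)) (z m) - dist (η (J a)) (η (J b)) := by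
    rcases le_total (J a) (J b) with h | h
    · exact hη.le_gromovProduct hδ (by linarith) hfar h (hJ b) (by omega)
    · have := hη.le_gromovProduct hδ (by linarith) hfar h (hJ a) (by omega : J a - J b ≤ 2 ^ p)
      rw [dist_comm (η (J a)) (η (J b))]
      linarith
  have hpδ : 0 ≤ p * δ := by positivity
  have hG1 := gromovProduct_triple hδ (c := 2 * ρ - (K + C) - k - p * δ)
    (x := z a) (y := η (J a)) (z := η (J b)) (u := z m) (by linarith) (by linarith)
  have hG2 := gromovProduct_triple hδ (c := 2 * ρ - (K + C) - k - p * δ - δ)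
    (x := z a) (y := η (J b)) (z := z b) (u := z m) (by linarith)
    (by rw [dist_comm (η (J b)) (z b)]; linarith)
  rw [dist_comm (z b) (z m)] at hG2
  have hρp : ρ ≤ c + δ * p := by
    rw [hc]
    nlinarith [hab.1, hab.2, ham'.1, ham'.2, hbm'.1, hbm'.2]
  have hpP : p ≤ P := hP p (by
    have h1 : (2 : ℝ) ^ p ≤ 2 * q + 1 := by exact_mod_cast hp2
    have h2 : K * (6 * ρ + 2 + k + C) ≤ K * (6 * (c + δ * p) + 2 + k + C) := by gcongr
    calc (2 : ℝ) ^ p ≤ 2 * (K * (6 * (c + δ * p) + 2 + k + C)) + 1 := by linarith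
      _ = _ := by ring)
  have : (p : ℝ) ≤ P := by exact_mod_cast hpP
  have := mul_le_mul_of_nonneg_left this hδ0
  linarith

/-- Stability of discrete quasigeodesics in roughly geodesic hyperbolic spaces. -/
theorem exists_gromovProduct_le (hY : IsFourPointHyperbolic Y) (hY' : IsRoughlyGeodesic Y)
    {K C : ℝ} (hK : 1 ≤ K) (hC : 0 ≤ C) :
    ∃ B : ℝ, ∀ (η : ℕ → Y) (N : ℕ), IsDiscreteQuasigeodesic K C η N →
      ∀ i ≤ N, dist (η 0) (η i) + dist (η i) (η N) ≤ dist (η 0) (η N) + B := by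
  obtain ⟨k, hk⟩ := hY'
  have hK0 : 0 < K := by linarith
  obtain ⟨ρ, hρ⟩ := exists_dist_roughGeodesic_le hY (k := k) hK hC
  refine ⟨3 * k + 2 * (ρ + (K * (K * (2 * ρ + 1 + k + C)) + C)), fun η N hη i hi => ?_⟩
  obtain ⟨n, z, hz0, hzn, hz⟩ := hk (η 0) (η N)
  have hk0 : 0 ≤ k := by simpa using hz 0 (Nat.zero_le _) 0 (Nat.zero_le _)
  have h1 : ∀ m, ∃ j ≤ N, m ≤ n → dist (z m) (η j) ≤ ρ := fun m => by
    by_cases hm : m ≤ n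
    · obtain ⟨j, hj, h⟩ := hρ η N hη n z hz0 hzn hz m hm
      exact ⟨j, hj, fun _ => h⟩
    · exact ⟨0, Nat.zero_le _, fun h => (hm h).elim⟩
  choose J hJ hJρ using h1
  have hρ0 : 0 ≤ ρ := dist_nonneg.trans (hJρ 0 (Nat.zero_le _))
  have hidx : ∀ a b, a ≤ N → b ≤ N → ∀ d, dist (η a) (η b) ≤ d → |(a : ℝ) - b| ≤ K * (d + C) :=
    fun a b ha hb d hd => by
      have h2 := (hη a ha b hb).1
      have h3 : |(a : ℝ) - b| / K ≤ d + C := by linarith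
      rw [div_le_iff₀ hK0] at h3
      linarith
  have hKρ : K * (ρ + C) ≤ K * (2 * ρ + 1 + k + C) := by
    gcongr
    linarith
  -- The index of a point of η near `z m` has bounded jumps and goes from nearly 0 to nearly N, so
  -- it comes close to i.
  obtain ⟨m, hm, hmi⟩ : ∃ m ≤ n, |(J m : ℝ) - i| ≤ K * (2 * ρ + 1 + k + C) := by
    have hi0 : (J 0 : ℝ) ≤ i + K * (2 * ρ + 1 + k + C) := by
      have h2 := hidx (J 0) 0 (hJ 0) (Nat.zero_le _) ρ (by
        rw [dist_comm, ← hz0]; exact hJρ 0 (Nat.zero_le _))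
      have h4 : (0 : ℝ) ≤ i := Nat.cast_nonneg _
      rw [Nat.cast_zero, sub_zero] at h2
      linarith [le_abs_self (J 0 : ℝ)]
    have hin : (i : ℝ) - K * (2 * ρ + 1 + k + C) ≤ J n := by
      have h2 := hidx (J n) N (hJ n) le_rfl ρ (by
        rw [dist_comm, ← hzn]; exact hJρ n le_rfl)
      have h4 : (i : ℝ) ≤ N := by exact_mod_cast hi
      linarith [neg_le_abs ((J n : ℝ) - N)]
    refine exists_abs_sub_le_of_nat (f := fun m => (J m : ℝ)) hi0 hin
      (fun m hm => ?_) (by positivity)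
    refine hidx _ _ (hJ _) (hJ _) (2 * ρ + 1 + k) ?_
    have h2 := (abs_le.1 (hz (m + 1) hm m hm.le)).2
    rw [Real.dist_eq] at h2
    push_cast at h2
    rw [add_sub_cancel_left, abs_one] at h2
    have h3 := dist_triangle4 (η (J (m + 1))) (z (m + 1)) (z m) (η (J m))
    rw [dist_comm (η (J (m + 1))) (z (m + 1))] at h3
    linarith [hJρ (m + 1) hm, hJρ m hm.le]
  have h2 := (hη (J m) (hJ m) i hi).2
  have h3 : K * |(J m : ℝ) - i| ≤ K * (K * (2 * ρ + 1 + k + C)) := by gcongr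
  have h4 := dist_triangle (z m) (η (J m)) (η i)
  have h5 := hJρ m hm
  have h6 := abs_le.1 (hz 0 (Nat.zero_le _) m hm)
  have h7 := abs_le.1 (hz m hm n le_rfl)
  have h8 := abs_le.1 (hz 0 (Nat.zero_le _) n le_rfl)
  have hmn : (m : ℝ) ≤ n := by exact_mod_cast hm
  have hm0 : (0 : ℝ) ≤ m := Nat.cast_nonneg _
  rw [Real.dist_eq, Nat.cast_zero, abs_of_nonpos (by linarith)] at h6 h8
  rw [Real.dist_eq, abs_of_nonpos (by linarith)] at h7
  have h9 := dist_triangle (η 0) (z m) (η i)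
  have h10 := dist_triangle (η i) (z m) (η N)
  rw [dist_comm (η i) (z m)] at h10
  rw [hz0] at h6 h8
  rw [hzn] at h7 h8
  linarith [h6.2, h7.2, h8.1]

end MorseLemma

/-! ## Word metrics -/

section WordMetric

variable {G : Type*} [Group G] {T : Set G}

theorem wordLength_le_length {l : List G} (hl : ∀ x ∈ l, x ∈ T ∨ x⁻¹ ∈ T) :
    wordLength T l.prod ≤ l.length :=
  Nat.sInf_le ⟨l, rfl, hl, rfl⟩

theorem exists_list_length_eq_wordLength (hT : Subgroup.closure T = ⊤) (g : G) :
    ∃ l : List G, l.length = wordLength T g ∧ (∀ x ∈ l, x ∈ T ∨ x⁻¹ ∈ T) ∧ l.prod = g := by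
  have hne : {n | ∃ l : List G, l.length = n ∧ (∀ x ∈ l, x ∈ T ∨ x⁻¹ ∈ T) ∧ l.prod = g}.Nonempty := by
    have h1 : g ∈ (Subgroup.closure T).toSubmonoid := by rw [hT]; trivial
    rw [Subgroup.closure_toSubmonoid] at h1
    obtain ⟨l, hl, hg⟩ := Submonoid.exists_list_of_mem_closure h1
    exact ⟨l.length, l, rfl, fun x hx => (hl x hx).imp id Set.mem_inv.1, hg⟩
  exact Nat.sInf_mem hne

theorem wordLength_one : wordLength T (1 : G) = 0 :=
  Nat.le_zero.1 (wordLength_le_length (T := T) (l := []) (by simp))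

theorem wordLength_mul_le (hT : Subgroup.closure T = ⊤) (g h : G) :
    wordLength T (g * h) ≤ wordLength T g + wordLength T h := by
  obtain ⟨l, hl, hlT, rfl⟩ := exists_list_length_eq_wordLength hT g
  obtain ⟨m, hm, hmT, rfl⟩ := exists_list_length_eq_wordLength hT h
  rw [← hl, ← hm, ← List.prod_append, ← List.length_append]
  refine wordLength_le_length fun x hx => ?_
  rcases List.mem_append.1 hx with hx | hx
  · exact hlT x hx
  · exact hmT x hx

theorem wordLength_inv_le (hT : Subgroup.closure T = ⊤) (g : G) :
    wordLength T g⁻¹ ≤ wordLength T g := by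
  obtain ⟨l, hl, hlT, rfl⟩ := exists_list_length_eq_wordLength hT g
  rw [← hl, List.prod_inv_reverse]
  refine (wordLength_le_length fun x hx => ?_).trans (by simp)
  simp only [List.mem_reverse, List.mem_map] at hx
  obtain ⟨y, hy, rfl⟩ := hx
  rw [inv_inv]
  exact (hlT y hy).symm

theorem wordLength_prod_le (hT : Subgroup.closure T = ⊤) {B : ℕ} {l : List G}
    (hl : ∀ x ∈ l, wordLength T x ≤ B) : wordLength T l.prod ≤ B * l.length := by
  induction l with
  | nil => simp [wordLength_one]
  | cons x l ih =>
    rw [List.prod_cons, List.length_cons]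
    have h1 := wordLength_mul_le hT x l.prod
    have h2 := hl x (by simp)
    have h3 := ih fun y hy => hl y (List.mem_cons_of_mem x hy)
    rw [mul_add]
    omega

theorem wordDist_nonneg (g h : G) : 0 ≤ wordDist T g h := Nat.cast_nonneg _

theorem wordDist_comm (hT : Subgroup.closure T = ⊤) (g h : G) :
    wordDist T g h = wordDist T h g := by
  have key : ∀ g h : G, wordDist T g h ≤ wordDist T h g := fun g h => by
    have := wordLength_inv_le hT (h⁻¹ * g)
    rw [mul_inv_rev, inv_inv] at this
    exact Nat.cast_le.2 this
  exact le_antisymm (key g h) (key h g)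

theorem wordDist_triangle (hT : Subgroup.closure T = ⊤) (g h k : G) :
    wordDist T g k ≤ wordDist T g h + wordDist T h k := by
  have := wordLength_mul_le hT (g⁻¹ * h) (h⁻¹ * k)
  rw [show g⁻¹ * h * (h⁻¹ * k) = g⁻¹ * k by group] at this
  simp only [wordDist]
  exact_mod_cast this

/-- Word geodesics exist. -/
theorem exists_word_geodesic (hT : Subgroup.closure T = ⊤) (g h : G) :
    ∃ (n : ℕ) (p : ℕ → G), p 0 = g ∧ p n = h ∧
      ∀ i ≤ n, ∀ j ≤ n, wordDist T (p i) (p j) = |(i : ℝ) - j| := by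
  obtain ⟨l, hl, hlT, hg⟩ := exists_list_length_eq_wordLength hT (g⁻¹ * h)
  set n := l.length with hn
  have hend : g * (l.take n).prod = h := by
    rw [hn, List.take_length, hg, mul_inv_cancel_left]
  refine ⟨n, fun i => g * (l.take i).prod, by simp, hend, ?_⟩
  have hle : ∀ i j, i ≤ j → j ≤ n →
      wordDist T (g * (l.take i).prod) (g * (l.take j).prod) ≤ (j : ℝ) - i := by
    intro i j hij hj
    have h1 : (g * (l.take i).prod)⁻¹ * (g * (l.take j).prod) = ((l.take j).drop i).prod := by
      rw [← List.prod_take_mul_prod_drop (l.take j) i, List.take_take, min_eq_left hij]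
      group
    have h2 : wordLength T ((l.take j).drop i).prod ≤ j - i := by
      refine (wordLength_le_length fun x hx =>
        hlT x (List.mem_of_mem_take (List.mem_of_mem_drop hx))).trans ?_
      rw [List.length_drop, List.length_take]
      omega
    rw [wordDist, h1, ← Nat.cast_sub hij]
    exact_mod_cast h2
  have key : ∀ i j, i ≤ j → j ≤ n →
      wordDist T (g * (l.take i).prod) (g * (l.take j).prod) = (j : ℝ) - i := by
    -- The three pieces of the path have at most their expected lengths, and these add up to the
    -- distance of the ends; hence equality.
    intro i j hij hj
    refine le_antisymm (hle i j hij hj) ?_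
    have h1 := hle 0 i (Nat.zero_le _) (by omega)
    have h2 := hle j n hj le_rfl
    have h3 : wordDist T (g * (l.take 0).prod) (g * (l.take n).prod) = n := by
      rw [hend, List.take_zero, List.prod_nil, mul_one, wordDist, ← hl]
    have h4 := wordDist_triangle hT (g * (l.take 0).prod) (g * (l.take i).prod)
      (g * (l.take n).prod)
    have h5 := wordDist_triangle hT (g * (l.take i).prod) (g * (l.take j).prod)
      (g * (l.take n).prod)
    push_cast at h1
    linarith
  intro i hi j hj
  rcases le_total i j with h | h
  · have h' : (i : ℝ) ≤ j := by exact_mod_cast h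
    rw [key i j h hj, abs_of_nonpos (by linarith)]
    ring
  · have h' : (j : ℝ) ≤ i := by exact_mod_cast h
    rw [wordDist_comm hT, key j i h hi, abs_of_nonneg (by linarith)]

/-! ## Orbit maps -/

variable {S : Type*} [MetricSpace S] [MulAction G S] [IsIsometricSMul G S]

theorem dist_smul_le_wordDist (hT : Subgroup.closure T = ⊤) (hfin : T.Finite) (s : S) :
    ∃ K : ℝ, 1 ≤ K ∧ ∀ g h : G, dist (g • s) (h • s) ≤ K * wordDist T g h := by
  obtain ⟨B, hB⟩ := (hfin.image fun t => dist s (t • s)).bddAbove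
  refine ⟨max B 1, le_max_right _ _, fun g h => ?_⟩
  have h1 : ∀ t : G, t ∈ T ∨ t⁻¹ ∈ T → dist s (t • s) ≤ max B 1 := by
    rintro t (ht | ht)
    · exact (hB ⟨t, ht, rfl⟩).trans (le_max_left _ _)
    · refine le_trans ?_ ((hB ⟨t⁻¹, ht, rfl⟩).trans (le_max_left _ _))
      change _ ≤ dist s (t⁻¹ • s)
      rw [← dist_smul t s (t⁻¹ • s), smul_inv_smul, dist_comm]
  have h2 : ∀ l : List G, (∀ x ∈ l, x ∈ T ∨ x⁻¹ ∈ T) →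
      dist s (l.prod • s) ≤ max B 1 * l.length := by
    intro l
    induction l with
    | nil => simp
    | cons x l ih =>
      intro hl
      have h3 := dist_triangle s (x • s) ((x * l.prod) • s)
      rw [mul_smul, dist_smul] at h3
      have h4 := ih fun y hy => hl y (List.mem_cons_of_mem x hy)
      have h5 := h1 x (hl x (by simp))
      rw [List.prod_cons, List.length_cons, mul_smul]
      push_cast
      linarith
  obtain ⟨l, hl, hlT, hg⟩ := exists_list_length_eq_wordLength hT (g⁻¹ * h)
  have h3 := h2 l hlT
  rw [hl, hg, ← dist_smul g, ← mul_smul, mul_inv_cancel_left] at h3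
  exact h3

/-- The Milnor–Švarc argument: advance along a geodesic in unit steps and replace each point by an
orbit point within r. Consecutive orbit points differ by an element moving s by at most 2r+1. -/
theorem exists_list_of_cobounded (hS : IsGeodesicSpace S) {s : S} {r : ℝ}
    (hr : ∀ y : S, ∃ g : G, dist y (g • s) ≤ r) (g h : G) :
    ∃ l : List G, (∀ x ∈ l, dist s (x • s) ≤ 2 * r + 1) ∧ l.prod = g⁻¹ * h ∧
      (l.length : ℝ) ≤ dist (g • s) (h • s) + 2 := by
  have hr0 : 0 ≤ r := by
    obtain ⟨g, hg⟩ := hr s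
    exact dist_nonneg.trans hg
  have key : ∀ n : ℕ, ∀ g h : G, dist (g • s) (h • s) ≤ n → ∀ y, dist y (g • s) ≤ r →
      dist y (h • s) ≤ n → ∃ l : List G, (∀ x ∈ l, dist s (x • s) ≤ 2 * r + 1) ∧
        l.prod = g⁻¹ * h ∧ l.length ≤ n + 1 := by
    intro n
    have hlast : ∀ g h : G, ∀ y, dist y (g • s) ≤ r → dist y (h • s) ≤ 1 →
        ∃ l : List G, (∀ x ∈ l, dist s (x • s) ≤ 2 * r + 1) ∧ l.prod = g⁻¹ * h ∧ l.length ≤ 1 := by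
      intro g h y h1 h2
      refine ⟨[g⁻¹ * h], fun x hx => ?_, by simp, by simp⟩
      rw [List.mem_singleton.1 hx, ← dist_smul g, ← mul_smul, mul_inv_cancel_left]
      have := dist_triangle_left (g • s) (h • s) y
      linarith
    suffices ∀ g h : G, ∀ y, dist y (g • s) ≤ r → dist y (h • s) ≤ n →
        ∃ l : List G, (∀ x ∈ l, dist s (x • s) ≤ 2 * r + 1) ∧ l.prod = g⁻¹ * h ∧
          l.length ≤ n + 1 from fun g h _ y => this g h y
    induction n with
    | zero =>
      intro g h y h1 h2
      exact hlast g h y h1 (h2.trans (by simp))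
    | succ n ih =>
      intro g h y h1 h2
      by_cases h3 : dist y (h • s) ≤ 1
      · obtain ⟨l, hl, hl', hl''⟩ := hlast g h y h1 h3
        exact ⟨l, hl, hl', by omega⟩
      · obtain ⟨y', h4, h5⟩ := hS.exists_between y (h • s) zero_le_one (by linarith)
        obtain ⟨k, hk⟩ := hr y'
        push_cast at h2
        obtain ⟨l, hl, hl', hl''⟩ := ih k h y' hk (by linarith)
        refine ⟨(g⁻¹ * k) :: l, fun x hx => ?_, ?_, by simpa using hl''⟩
        · rcases List.mem_cons.1 hx with rfl | hx
          · rw [← dist_smul g, ← mul_smul, mul_inv_cancel_left]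
            have h6 := dist_triangle4 (g • s) y y' (k • s)
            rw [dist_comm (g • s) y] at h6
            linarith
          · exact hl x hx
        · rw [List.prod_cons, hl']
          group
  have h1 := Nat.lt_floor_add_one (dist (g • s) (h • s))
  have h2 := Nat.floor_le (dist_nonneg (x := g • s) (y := h • s))
  obtain ⟨l, hl, hl', hl''⟩ := key (⌊dist (g • s) (h • s)⌋₊ + 1) g h (by push_cast; linarith) (g • s)
    (by simpa using hr0) (by push_cast; linarith)
  refine ⟨l, hl, hl', ?_⟩
  have : (l.length : ℝ) ≤ (⌊dist (g • s) (h • s)⌋₊ + 1 + 1 : ℕ) := by exact_mod_cast hl''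
  push_cast at this
  linarith

theorem group_fg_of_proper_cobounded (hS : IsGeodesicSpace S) (hp : IsProperAction G S)
    (hc : IsCoboundedAction G S) : Group.FG G := by
  obtain ⟨s, r, hr⟩ := hc
  refine Group.fg_iff.2 ⟨{g : G | dist s (g • s) ≤ 2 * r + 1}, ?_, hp s _⟩
  rw [Subgroup.eq_top_iff']
  intro g
  obtain ⟨l, hl, hl', -⟩ := exists_list_of_cobounded hS hr 1 g
  rw [inv_one, one_mul] at hl'
  rw [← hl']
  exact Subgroup.list_prod_mem _ fun x hx => Subgroup.subset_closure (hl x hx)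

/-- The orbit map of a proper cobounded action is a quasiisometric embedding. -/
theorem exists_wordDist_le (hS : IsGeodesicSpace S) (hp : IsProperAction G S) {s : S} {r : ℝ}
    (hr : ∀ y : S, ∃ g : G, dist y (g • s) ≤ r) (hT : Subgroup.closure T = ⊤) (hfin : T.Finite) :
    ∃ K : ℝ, 1 ≤ K ∧ ∀ g h : G, dist (g • s) (h • s) ≤ K * wordDist T g h ∧
      wordDist T g h ≤ K * dist (g • s) (h • s) + K := by
  obtain ⟨K, hK, hKd⟩ := dist_smul_le_wordDist hT hfin s
  obtain ⟨B, hB⟩ := ((hp s (2 * r + 1)).image (wordLength T)).bddAbove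
  refine ⟨max K (2 * B), hK.trans (le_max_left _ _), fun g h => ⟨(hKd g h).trans ?_, ?_⟩⟩
  · have := wordDist_nonneg (T := T) g h
    gcongr
    exact le_max_left _ _
  · obtain ⟨l, hl, hl', hln⟩ := exists_list_of_cobounded hS hr g h
    have h1 := wordLength_prod_le hT (B := B) (l := l) fun x hx => hB ⟨x, hl x hx, rfl⟩
    rw [hl'] at h1
    have h2 : wordDist T g h ≤ B * l.length := by
      rw [wordDist]
      exact_mod_cast h1
    have h3 : (B : ℝ) * l.length ≤ B * (dist (g • s) (h • s) + 2) := by gcongr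
    have h4 : (2 * B : ℝ) ≤ max K (2 * B) := le_max_right _ _
    have h5 := dist_nonneg (x := g • s) (y := h • s)
    have h6 : (B : ℝ) ≤ max K (2 * B) := by
      have : (0 : ℝ) ≤ B := Nat.cast_nonneg _
      linarith
    have h7 := mul_le_mul_of_nonneg_right h6 h5
    linarith

end WordMetric

/-! ## Chains of curtains along contracting geodesics -/

section SegmentCurtain

variable {S : Type*} [MetricSpace S]

/-- The curtain dual to the middle half of a contracting geodesic segment. -/
def Curtain.ofSegment {D : ℝ} (hD : 1 ≤ D) (γ : ℝ → S) (u : ℝ)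
    (hγ : IsGeodesicOn γ (Icc u (u + 20 * D)))
    (hc : StronglyContracting (γ '' Icc u (u + 20 * D)) D) : Curtain S where
  D := D
  one_le := hD
  α t := γ (u + t)
  geodesic s hs t ht := by
    rw [hγ _ ⟨by linarith [hs.1], by linarith [hs.2]⟩ _ ⟨by linarith [ht.1], by linarith [ht.2]⟩,
      add_sub_add_left_eq_sub]
  contracting := by
    have : (fun t => γ (u + t)) '' Icc 0 (20 * D) = γ '' Icc u (u + 20 * D) := by
      change (γ ∘ fun t => u + t) '' _ = _
      rw [image_comp, image_const_add_Icc, add_zero]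
    rw [this]
    exact hc
  a := 5 * D
  a_pos := by linarith
  a_lt := by linarith

namespace Curtain

variable (hS : IsGeodesicSpace S) {D : ℝ} {hD : 1 ≤ D} {γ : ℝ → S} {u l : ℝ} (hu : 0 ≤ u)
  (hul : u + 20 * D ≤ l) (hγl : IsGeodesicOn γ (Icc 0 l))
  (hcl : StronglyContracting (γ '' Icc 0 l) D)
  {hγ : IsGeodesicOn γ (Icc u (u + 20 * D))}
  {hc : StronglyContracting (γ '' Icc u (u + 20 * D)) D} {x : S} {t : ℝ}
  (ht : t ∈ Icc 0 l) (hx : γ t ∈ closestPoints (γ '' Icc 0 l) x)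

include hS hD hu hul hγl hcl ht hx

/-- Going from x to p almost passes through γ t, with error 3D. As p is no farther from x than the
start γ u of the segment, it is at most 3D beyond that start. -/
theorem ofSegment_le_of_lt (htu : t < u) {τ : ℝ} (hτ : τ ∈ Icc 0 (20 * D))
    (hp : γ (u + τ) ∈ closestPoints (ofSegment hD γ u hγ hc).axis x) : τ ≤ 3 * D := by
  have hl : 0 ≤ l := ht.1.trans ht.2
  have h1 := dist_add_dist_closest_le_of_mem hS hcl (by linarith)
    (hγl.closestPoints_nonempty hl) (mem_image_of_mem γ (show u + τ ∈ Icc 0 l from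
      ⟨by linarith [hτ.1], by linarith [hτ.2]⟩)) hx
  have h2 := hp.2 (γ (u + 0)) (mem_image_of_mem _ ⟨le_rfl, show 0 ≤ 20 * D by linarith⟩)
  have h3 := dist_triangle x (γ t) (γ (u + 0))
  rw [hγl t ht _ ⟨by linarith [hτ.1], by linarith [hτ.2]⟩, abs_of_nonpos (by linarith [hτ.1])] at h1
  rw [hγl t ht _ ⟨by linarith, by linarith⟩, abs_of_nonpos (by linarith)] at h3
  linarith

theorem le_ofSegment_of_lt (htu : u + 20 * D < t) {τ : ℝ} (hτ : τ ∈ Icc 0 (20 * D))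
    (hp : γ (u + τ) ∈ closestPoints (ofSegment hD γ u hγ hc).axis x) : 17 * D ≤ τ := by
  have hl : 0 ≤ l := ht.1.trans ht.2
  have h1 := dist_add_dist_closest_le_of_mem hS hcl (by linarith)
    (hγl.closestPoints_nonempty hl) (mem_image_of_mem γ (show u + τ ∈ Icc 0 l from
      ⟨by linarith [hτ.1], by linarith [hτ.2]⟩)) hx
  have h2 := hp.2 (γ (u + 20 * D)) (mem_image_of_mem _ ⟨by linarith, le_rfl⟩)
  have h3 := dist_triangle x (γ t) (γ (u + 20 * D))
  rw [hγl t ht _ ⟨by linarith [hτ.1], by linarith [hτ.2]⟩, abs_of_nonneg (by linarith [hτ.2])] at h1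
  rw [hγl t ht _ ⟨by linarith, by linarith⟩, abs_of_nonneg (by linarith)] at h3
  linarith

omit hS hγl hcl ht in
theorem mem_closestPoints_ofSegment (h1 : u ≤ t) (h2 : t ≤ u + 20 * D) :
    γ (u + (t - u)) ∈ closestPoints (ofSegment hD γ u hγ hc).axis x := by
  refine ⟨⟨t - u, ⟨by linarith, ?_⟩, rfl⟩, ?_⟩
  · change t - u ≤ 20 * D
    linarith
  · rintro _ ⟨τ, hτ, rfl⟩
    rw [add_sub_cancel]
    have h3 : τ ≤ 20 * D := hτ.2
    exact hx.2 _ ⟨u + τ, ⟨by linarith [hτ.1], by linarith⟩, rfl⟩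

/-- Membership in the sides of the curtain can be read off from the projection to the long geodesic:
the error 3D outside the segment is less than the margin 5D at its ends. -/
theorem mem_ofSegment_minus (h : t < u + 5 * D) : x ∈ (ofSegment hD γ u hγ hc).minus := by
  by_cases htu : t < u
  · obtain ⟨_, ⟨τ, hτ, rfl⟩, h2⟩ := (ofSegment hD γ u hγ hc).closestPoints_nonempty x
    have := ofSegment_le_of_lt hS hu hul hγl hcl ht hx htu hτ ⟨⟨τ, hτ, rfl⟩, h2⟩
    refine ⟨_, ⟨⟨τ, hτ, rfl⟩, h2⟩, τ, ⟨hτ.1, ?_⟩, rfl⟩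
    change τ < 5 * D
    linarith
  · refine ⟨_, mem_closestPoints_ofSegment hu hul hx (not_lt.1 htu) (by linarith),
      t - u, ⟨by linarith, ?_⟩, rfl⟩
    change t - u < 5 * D
    linarith

theorem mem_ofSegment_plus (h : u + 15 * D < t) : x ∈ (ofSegment hD γ u hγ hc).plus := by
  by_cases htu : u + 20 * D < t
  · obtain ⟨_, ⟨τ, hτ, rfl⟩, h2⟩ := (ofSegment hD γ u hγ hc).closestPoints_nonempty x
    have := le_ofSegment_of_lt hS hu hul hγl hcl ht hx htu hτ ⟨⟨τ, hτ, rfl⟩, h2⟩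
    refine ⟨_, ⟨⟨τ, hτ, rfl⟩, h2⟩, τ, ⟨?_, hτ.2⟩, rfl⟩
    change 5 * D + 10 * D < τ
    linarith
  · refine ⟨_, mem_closestPoints_ofSegment hu hul hx (by linarith) (not_lt.1 htu),
      t - u, ⟨?_, ?_⟩, rfl⟩
    · change 5 * D + 10 * D < t - u
      linarith
    · change t - u ≤ 20 * D
      linarith

theorem of_mem_ofSegment_carrier (h : x ∈ (ofSegment hD γ u hγ hc).carrier) :
    u + 5 * D ≤ t ∧ t ≤ u + 15 * D := by
  constructor
  · by_contra! h1
    exact Set.disjoint_left.1 (disjoint_minus_carrier _)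
      (mem_ofSegment_minus hS hu hul hγl hcl ht hx h1) h
  · by_contra! h1
    exact Set.disjoint_left.1 (disjoint_carrier_plus _) h
      (mem_ofSegment_plus hS hu hul hγl hcl ht hx h1)

/-- A converse with loss D, because another closest point may be the one that puts x into the
halfspace. -/
theorem lt_of_mem_ofSegment_minus (h : x ∈ (ofSegment hD γ u hγ hc).minus) : t < u + 6 * D := by
  by_contra! h1
  obtain ⟨_, hp, τ, hτ, rfl⟩ := h
  have hτ2 : τ < 5 * D := hτ.2
  by_cases htu : u + 20 * D < t
  · have := le_ofSegment_of_lt hS hu hul hγl hcl ht hx htu ⟨hτ.1, by linarith⟩ hp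
    linarith
  · have h2 := mem_closestPoints_ofSegment (hD := hD) (hγ := hγ) (hc := hc) hu hul hx
      (by linarith) (not_lt.1 htu)
    have h3 := (ofSegment hD γ u hγ hc).contracting.dist_lt (by
      change 0 < D
      linarith) hp h2
    change dist (γ (u + τ)) (γ (u + (t - u))) < D at h3
    rw [hγl _ ⟨by linarith [hτ.1], by linarith⟩ _ ⟨by linarith, by linarith⟩] at h3
    linarith [neg_le_abs (u + τ - (u + (t - u)))]

theorem lt_of_mem_ofSegment_plus (h : x ∈ (ofSegment hD γ u hγ hc).plus) : u + 14 * D < t := by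
  by_contra! h1
  obtain ⟨_, hp, τ, hτ, rfl⟩ := h
  have hτ1 : 5 * D + 10 * D < τ := hτ.1
  have hτ2 : τ ≤ 20 * D := hτ.2
  by_cases htu : t < u
  · have := ofSegment_le_of_lt hS hu hul hγl hcl ht hx htu ⟨by linarith, by linarith⟩ hp
    linarith
  · have h2 := mem_closestPoints_ofSegment (hD := hD) (hγ := hγ) (hc := hc) hu hul hx
      (not_lt.1 htu) (by linarith)
    have h3 := (ofSegment hD γ u hγ hc).contracting.dist_lt (by
      change 0 < D
      linarith) hp h2
    change dist (γ (u + τ)) (γ (u + (t - u))) < D at h3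
    rw [hγl _ ⟨by linarith, by linarith⟩ _ ⟨by linarith, by linarith⟩] at h3
    linarith [le_abs_self (u + τ - (u + (t - u)))]

omit ht hx in
-- The separating ball is centred at γ(u + 35D), far from both curtains. A geodesic between the far
-- sides has projections that pass over this centre, and there it comes close to γ by
-- `dist_closest_le_of_between`.
theorem precedes_ofSegment {R v : ℝ} (hR : 10 * D ≤ R) (huv : u + 50 * D ≤ v)
    (hvl : v + 20 * D ≤ l) {hγ' : IsGeodesicOn γ (Icc v (v + 20 * D))}
    {hc' : StronglyContracting (γ '' Icc v (v + 20 * D)) D} :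
    Precedes R (ofSegment hD γ u hγ hc) (ofSegment hD γ v hγ' hc') := by
  have hD0 : 0 < D := by linarith
  have hl : 0 ≤ l := by linarith
  have hne := hγl.closestPoints_nonempty hl
  have hproj : ∀ x, ∃ t ∈ Icc 0 l, γ t ∈ closestPoints (γ '' Icc 0 l) x := fun x => by
    obtain ⟨_, ⟨t, ht, rfl⟩, h⟩ := hne x
    exact ⟨t, ht, ⟨t, ht, rfl⟩, h⟩
  choose f hf hfc using hproj
  have hv : 0 ≤ v := by linarith
  have hLip : ∀ x y, |f x - f y| ≤ dist x y + 2 * D := fun x y => by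
    rw [← hγl _ (hf x) _ (hf y)]
    exact dist_closest_le hS hcl hD0 hne (hfc x) (hfc y)
  have hcmem : u + 35 * D ∈ Icc 0 l := ⟨by linarith, by linarith⟩
  refine ⟨fun x hx => ?_, fun x hx => ?_, Set.disjoint_left.2 fun x hx hx' => ?_,
    γ (u + 35 * D), 10 * D, by linarith, hR, fun x hx => ?_, ?_⟩
  · have := of_mem_ofSegment_carrier hS hu hul hγl hcl (hf x) (hfc x) hx
    exact mem_ofSegment_minus hS hv hvl hγl hcl (hf x) (hfc x) (by linarith)
  · have := of_mem_ofSegment_carrier hS hv hvl hγl hcl (hf x) (hfc x) hx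
    exact mem_ofSegment_plus hS hu hul hγl hcl (hf x) (hfc x) (by linarith)
  · have := of_mem_ofSegment_carrier hS hu hul hγl hcl (hf x) (hfc x) hx
    have := of_mem_ofSegment_carrier hS hv hvl hγl hcl (hf x) (hfc x) hx'
    linarith
  · have h1 := dist_closest_le hS hcl hD0 hne (hfc x)
      (mem_closestPoints_self (mem_image_of_mem γ hcmem))
    rw [hγl _ (hf x) _ hcmem] at h1
    have h2 := abs_le.1 h1
    have h3 := Metric.mem_closedBall.1 hx
    exact ⟨mem_ofSegment_plus hS hu hul hγl hcl (hf x) (hfc x) (by linarith),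
      mem_ofSegment_minus hS hv hvl hγl hcl (hf x) (hfc x) (by linarith)⟩
  · intro β l' hl' hβ h0 h1
    have h2 := lt_of_mem_ofSegment_minus hS hu hul hγl hcl (hf _) (hfc _) h0
    have h3 := lt_of_mem_ofSegment_plus hS hv hvl hγl hcl (hf _) (hfc _) h1
    -- Unit steps move the projection by at most 1 + 2D ≤ 3D. The point found is within 6D of γ and
    -- its projection within 3D of the centre, so it is within 9D of the centre.
    obtain ⟨τ, hτ, h4⟩ := exists_abs_sub_le_of_Icc (f := fun τ => f (β τ)) (J := 3 * D)
      (c := u + 35 * D) hl' (by linarith) (by linarith) fun s hs t ht hst => by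
        have := hLip (β s) (β t)
        rw [hβ s hs t ht] at this
        linarith
    have h5 := abs_le.1 h4
    refine ⟨β τ, mem_image_of_mem β hτ, Metric.mem_closedBall.2 ?_⟩
    have h6 := dist_closest_le_of_between hS hcl hD0 hne (hfc (β 0)) (hfc (β l')) (hfc (β τ))
      (hβ.dist_add_dist le_rfl hτ.1 hτ.2 le_rfl)
      (by rw [hγl _ (hf _) _ (hf _)]; linarith [neg_le_abs (f (β 0) - f (β τ))])
      (by rw [hγl _ (hf _) _ (hf _)]; linarith [neg_le_abs (f (β τ) - f (β l'))])
    have h7 := dist_triangle (β τ) (γ (f (β τ))) (γ (u + 35 * D))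
    rw [hγl _ (hf _) _ hcmem] at h7
    linarith

end Curtain

/-- Curtains dual to segments of length 20D, placed at intervals of 50D along γ, form an R-chain.
Contraction is needed for the subsegments as well as for γ itself. -/
theorem le_chainDist_of_contracting [Nonempty S] {w : Weights} (hS : IsGeodesicSpace S) {D : ℝ}
    (hD : 1 ≤ D) {γ : ℝ → S} {l : ℝ} (hl : 0 ≤ l) (hγ : IsGeodesicOn γ (Icc 0 l))
    (hc : ∀ u v, 0 ≤ u → u ≤ v → v ≤ l → StronglyContracting (γ '' Icc u v) D)
    {R : ℕ+} (hR : 10 * D ≤ R) :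
    l / (50 * D) - 1 ≤
      chainDist R (Space.ofPoint hS w (γ 0)) (Space.ofPoint hS w (γ l)) := by
  have hcl := hc 0 l le_rfl hl le_rfl
  set n := ⌊l / (50 * D)⌋₊ with hn
  have hnl : (n : ℝ) * (50 * D) ≤ l := by
    rw [← le_div_iff₀ (by linarith)]
    exact Nat.floor_le (by positivity)
  have hu : ∀ i : Fin n, 0 ≤ 50 * D * (i : ℝ) + D ∧ 50 * D * (i : ℝ) + D + 30 * D ≤ l := by
    intro i
    have h1 : ((i : ℕ) : ℝ) + 1 ≤ n := by exact_mod_cast i.2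
    have h2 := mul_le_mul_of_nonneg_right h1 (show 0 ≤ 50 * D by linarith)
    exact ⟨by positivity, by linarith⟩
  have hγ' : ∀ i : Fin n, IsGeodesicOn γ
      (Icc (50 * D * (i : ℝ) + D) (50 * D * (i : ℝ) + D + 20 * D)) := fun i =>
    hγ.mono (Icc_subset_Icc (hu i).1 (by linarith [(hu i).2]))
  have hc' : ∀ i : Fin n, StronglyContracting
      (γ '' Icc (50 * D * (i : ℝ) + D) (50 * D * (i : ℝ) + D + 20 * D)) D := fun i =>
    hc _ _ (hu i).1 (by linarith) (by linarith [(hu i).2])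
  let f : Fin n → Half S := fun i =>
    ⟨Curtain.ofSegment hD γ (50 * D * i + D) (hγ' i) (hc' i), _, Or.inl rfl⟩
  have h0 : (0 : ℝ) ∈ Icc 0 l := ⟨le_rfl, hl⟩
  have hl' : l ∈ Icc 0 l := ⟨hl, le_rfl⟩
  have key : ChainFromTo (R : ℝ) (principal (γ 0)) (principal (γ l)) (List.ofFn f) := by
    refine ⟨?_, ?_, ?_⟩
    · rw [List.pairwise_ofFn]
      intro i j hij
      have h1 : ((i : ℕ) : ℝ) + 1 ≤ (j : ℕ) := by exact_mod_cast hij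
      have h2 := mul_le_mul_of_nonneg_left h1 (show 0 ≤ 50 * D by linarith)
      exact Curtain.precedes_ofSegment hS (hγ := hγ' i) (hc := hc' i) (hγ' := hγ' j)
        (hc' := hc' j) (hu i).1 (by linarith [(hu i).2]) hγ hcl hR (by linarith)
        (by linarith [(hu j).2])
    · intro p hp
      obtain ⟨i, rfl⟩ := (List.mem_ofFn' _ _).1 hp
      rw [Ultra.principal_neg_iff]
      exact Curtain.mem_ofSegment_minus hS (hγ := hγ' i) (hc := hc' i) (hu i).1 (by linarith [(hu i).2]) hγ hcl h0
        (mem_closestPoints_self (mem_image_of_mem γ h0)) (by linarith [(hu i).1])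
    · intro p hp
      obtain ⟨i, rfl⟩ := (List.mem_ofFn' _ _).1 hp
      rw [Ultra.principal_neg_iff]
      intro hm
      exact Curtain.notMem_plus_of_mem_minus hm
        (Curtain.mem_ofSegment_plus hS (hγ := hγ' i) (hc := hc' i) (hu i).1 (by linarith [(hu i).2]) hγ hcl hl'
          (mem_closestPoints_self (mem_image_of_mem γ hl')) (by linarith [(hu i).2]))
  have h1 : (List.ofFn f).length ≤
      chainDist R (Space.ofPoint hS w (γ 0)) (Space.ofPoint hS w (γ l)) := ChainFromTo.length_le key
  rw [List.length_ofFn] at h1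
  have h2 := Nat.lt_floor_add_one (l / (50 * D))
  have h3 : (n : ℝ) ≤ chainDist R (Space.ofPoint hS w (γ 0)) (Space.ofPoint hS w (γ l)) := by
    exact_mod_cast h1
  linarith

end SegmentCurtain

/-! ## Quasigeodesics near paths -/

section Near

variable {S : Type*} [MetricSpace S]

/-- Two visits to the same ball are close in time, and in between q cannot go far. -/
theorem IsQuasigeodesicOn.dist_le_of_between {l m : ℝ} (hl : 1 ≤ l) {q : ℝ → S} {a b : ℝ}
    (hq : IsQuasigeodesicOn dist l m q a b) {t₁ t t₂ : ℝ} (ha : a ≤ t₁) (h₁ : t₁ ≤ t) (h₂ : t ≤ t₂)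
    (hb : t₂ ≤ b) {y : S} {ρ : ℝ} (hy₁ : dist (q t₁) y ≤ ρ) (hy₂ : dist (q t₂) y ≤ ρ) :
    dist (q t) y ≤ l * (l * (2 * ρ + m)) + m + ρ := by
  have h3 := (hq t₁ ⟨ha, by linarith⟩ t₂ ⟨by linarith, hb⟩).1
  have h4 := (hq t ⟨by linarith, by linarith⟩ t₁ ⟨ha, by linarith⟩).2
  have h5 := dist_triangle_right (q t₁) (q t₂) y
  have h6 := dist_triangle (q t) (q t₁) y
  rw [abs_of_nonpos (by linarith)] at h3
  rw [abs_of_nonneg (by linarith)] at h4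
  have h7 : -(t₁ - t₂) ≤ l * (2 * ρ + m) := by
    rw [← div_le_iff₀' (by linarith)]
    linarith
  have h8 : l * (t - t₁) ≤ l * (l * (2 * ρ + m)) :=
    mul_le_mul_of_nonneg_left (by linarith) (by linarith)
  linarith

theorem IsGeodesicOn.isQuasigeodesicOn {γ : ℝ → S} {a b : ℝ} (hγ : IsGeodesicOn γ (Icc a b)) :
    IsQuasigeodesicOn dist 1 0 γ a b := fun s hs t ht => by
  rw [hγ s hs t ht]
  simp

/-- If a coarsely connected path stays near a discrete quasigeodesic with the same endpoints, then
the discrete quasigeodesic stays near the path. -/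
theorem IsDiscreteQuasigeodesic.exists_dist_le {K C : ℝ} (hK : 1 ≤ K) {η : ℕ → S} {N : ℕ}
    (hη : IsDiscreteQuasigeodesic K C η N) {q : ℝ → S} {a b J ρ : ℝ} (hab : a ≤ b) (hJ : 0 ≤ J)
    (hq : ∀ t ∈ Icc a b, ∀ t' ∈ Icc a b, |t - t'| ≤ 1 → dist (q t) (q t') ≤ J)
    (hqη : ∀ t ∈ Icc a b, ∃ i ≤ N, dist (q t) (η i) ≤ ρ) (ha : dist (q a) (η 0) ≤ ρ)
    (hb : dist (q b) (η N) ≤ ρ) {i : ℕ} (hi : i ≤ N) :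
    ∃ t ∈ Icc a b, dist (q t) (η i) ≤ ρ + (K * (K * (J + 2 * ρ + C)) + C) := by
  choose! f hfN hf using hqη
  have key : ∀ j ≤ N, ∀ k ≤ N, dist (η j) (η k) ≤ J + 2 * ρ →
      |(j : ℝ) - k| ≤ K * (J + 2 * ρ + C) := by
    intro j hj k hk h
    rw [← div_le_iff₀' (by linarith)]
    linarith [(hη j hj k hk).1]
  have ha' : a ∈ Icc a b := ⟨le_rfl, hab⟩
  have hb' : b ∈ Icc a b := ⟨hab, le_rfl⟩
  have h0 := key _ (hfN a ha') 0 (Nat.zero_le _)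
    (by linarith [dist_triangle_left (η (f a)) (η 0) (q a), hf a ha'])
  have hN := key _ (hfN b hb') N le_rfl
    (by linarith [dist_triangle_left (η (f b)) (η N) (q b), hf b hb'])
  have hi0 : (0 : ℝ) ≤ i := Nat.cast_nonneg _
  have hiN : (i : ℝ) ≤ N := by exact_mod_cast hi
  rw [Nat.cast_zero] at h0
  obtain ⟨t, ht, h⟩ := exists_abs_sub_le_of_Icc (f := fun t => (f t : ℝ)) (c := i) hab
    (J := K * (J + 2 * ρ + C)) (by linarith [(abs_le.1 h0).2]) (by linarith [(abs_le.1 hN).1])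
    fun t ht t' ht' htt => key _ (hfN t ht) _ (hfN t' ht') (by
      have h1 := hq t ht t' ht' htt
      have h3 := dist_triangle4 (η (f t)) (q t) (q t') (η (f t'))
      rw [dist_comm (η (f t)) (q t)] at h3
      linarith [hf t ht, hf t' ht'])
  refine ⟨t, ht, ?_⟩
  have h1 := (hη _ (hfN t ht) i hi).2
  have h2 := mul_le_mul_of_nonneg_left h (show 0 ≤ K by linarith)
  linarith [dist_triangle (q t) (η (f t)) (η i), hf t ht]

/-- A quasigeodesic near a geodesic and with endpoints in a subsegment is near the subsegment. -/
theorem exists_mem_subsegment_dist_le {l m ρ : ℝ} (hl : 1 ≤ l) (hm : 0 ≤ m) (hρ : 0 ≤ ρ)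
    {γ : ℝ → S} {c u v : ℝ} (hγ : IsGeodesicOn γ (Icc 0 c)) (hu : 0 ≤ u) (huv : u ≤ v) (hv : v ≤ c)
    {q : ℝ → S} {a b : ℝ} (hq : IsQuasigeodesicOn dist l m q a b)
    (hqγ : ∀ t ∈ Icc a b, ∃ τ ∈ Icc 0 c, dist (q t) (γ τ) ≤ ρ) (ha : q a ∈ γ '' Icc u v)
    (hb : q b ∈ γ '' Icc u v) {t : ℝ} (ht : t ∈ Icc a b) :
    ∃ p ∈ γ '' Icc u v, dist (q t) p ≤
      l * (l * (2 * (l + m + 3 * ρ) + m)) + m + (l + m + 3 * ρ) := by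
  choose! f hfc hf using hqγ
  have hab : a ≤ b := ht.1.trans ht.2
  have ha' : a ∈ Icc a b := ⟨le_rfl, hab⟩
  have hb' : b ∈ Icc a b := ⟨hab, le_rfl⟩
  have hend : ∀ t ∈ Icc a b, q t ∈ γ '' Icc u v → u - ρ ≤ f t ∧ f t ≤ v + ρ := by
    rintro t ht ⟨τ, hτ, h⟩
    have h1 := hf t ht
    rw [← h, hγ τ ⟨by linarith [hτ.1], by linarith [hτ.2]⟩ _ (hfc t ht)] at h1
    have := abs_le.1 h1
    constructor <;> linarith [hτ.1, hτ.2]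
  have hLip : ∀ t ∈ Icc a b, ∀ t' ∈ Icc a b, |t - t'| ≤ 1 → |f t - f t'| ≤ l + m + 2 * ρ := by
    intro t ht t' ht' htt
    rw [← hγ _ (hfc t ht) _ (hfc t' ht')]
    have h1 := (hq t ht t' ht').2
    have h2 := mul_le_mul_of_nonneg_left htt (show 0 ≤ l by linarith)
    have h3 := dist_triangle4 (γ (f t)) (q t) (q t') (γ (f t'))
    rw [dist_comm (γ (f t)) (q t)] at h3
    linarith [hf t ht, hf t' ht']
  have key : ∀ w ∈ Icc u v, ∀ t₁ t₂, a ≤ t₁ → t₁ ≤ t → t ≤ t₂ → t₂ ≤ b →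
      |f t₁ - w| ≤ l + m + 2 * ρ → |f t₂ - w| ≤ l + m + 2 * ρ → ∃ p ∈ γ '' Icc u v,
        dist (q t) p ≤ l * (l * (2 * (l + m + 3 * ρ) + m)) + m + (l + m + 3 * ρ) := by
    intro w hw t₁ t₂ h1 h2 h3 h4 h5 h6
    have hw' : w ∈ Icc 0 c := ⟨by linarith [hw.1], by linarith [hw.2]⟩
    have h7 : ∀ t ∈ Icc a b, |f t - w| ≤ l + m + 2 * ρ → dist (q t) (γ w) ≤ l + m + 3 * ρ := by
      intro t ht h
      rw [← hγ _ (hfc t ht) w hw'] at h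
      linarith [dist_triangle (q t) (γ (f t)) (γ w), hf t ht]
    exact ⟨γ w, mem_image_of_mem γ hw, hq.dist_le_of_between hl h1 h2 h3 h4
      (h7 _ ⟨h1, by linarith⟩ h5) (h7 _ ⟨by linarith, h4⟩ h6)⟩
  have hJ : ρ ≤ l + m + 2 * ρ := by linarith
  have hL : ∀ t₁ ∈ Icc a b, ∀ t₂ ∈ Icc a b, t₁ ≤ t₂ → ∀ w, f t₁ ≤ w + ρ → w - ρ ≤ f t₂ →
      ∃ t ∈ Icc t₁ t₂, |f t - w| ≤ l + m + 2 * ρ := fun t₁ h1 t₂ h2 h12 w h3 h4 =>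
    exists_abs_sub_le_of_Icc h12 (by linarith) (by linarith) fun s hs t ht hst =>
      hLip s ⟨by linarith [h1.1, hs.1], by linarith [h2.2, hs.2]⟩ t
        ⟨by linarith [h1.1, ht.1], by linarith [h2.2, ht.2]⟩ hst
  have hR : ∀ t₁ ∈ Icc a b, ∀ t₂ ∈ Icc a b, t₁ ≤ t₂ → ∀ w, w - ρ ≤ f t₁ → f t₂ ≤ w + ρ →
      ∃ t ∈ Icc t₁ t₂, |f t - w| ≤ l + m + 2 * ρ := fun t₁ h1 t₂ h2 h12 w h3 h4 => by
    obtain ⟨t, ht, h⟩ := exists_abs_sub_le_of_Icc (f := fun t => -f t) (c := -w)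
      (J := l + m + 2 * ρ) h12 (by linarith) (by linarith) fun s hs t ht hst => by
        rw [neg_sub_neg, abs_sub_comm]
        exact hLip s ⟨by linarith [h1.1, hs.1], by linarith [h2.2, hs.2]⟩ t
          ⟨by linarith [h1.1, ht.1], by linarith [h2.2, ht.2]⟩ hst
    rw [neg_sub_neg, abs_sub_comm] at h
    exact ⟨t, ht, h⟩
  have h1 := hend a ha' ha
  have h2 := hend b hb' hb
  -- Where the shadow f t of q t lies beyond an end of the subsegment, the shadow passes that end
  -- both before and after t. Thus q visits a ball about this end twice and stays near it in
  -- between.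
  rcases lt_or_ge (f t) u with h | h
  · obtain ⟨t₁, ht₁, h3⟩ := hR a ha' t ht ht.1 u h1.1 (by linarith)
    obtain ⟨t₂, ht₂, h4⟩ := hL t ht b hb' ht.2 u (by linarith) h2.1
    exact key u ⟨le_rfl, huv⟩ t₁ t₂ ht₁.1 ht₁.2 ht₂.1 ht₂.2 h3 h4
  rcases lt_or_ge v (f t) with h' | h'
  · obtain ⟨t₁, ht₁, h3⟩ := hL a ha' t ht ht.1 v h1.2 (by linarith)
    obtain ⟨t₂, ht₂, h4⟩ := hR t ht b hb' ht.2 v (by linarith) h2.2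
    exact key v ⟨huv, le_rfl⟩ t₁ t₂ ht₁.1 ht₁.2 ht₂.1 ht₂.2 h3 h4
  · exact key (f t) ⟨h, h'⟩ t t ht.1 le_rfl le_rfl ht.2 (by simp; positivity) (by simp; positivity)

end Near

/-! ## Stable subgroups embed quasiisometrically -/

section Stable

variable {S : Type*} [MetricSpace S] {G : Type*} [Group G] [MulAction G S]
  {T : Set G} {s : S} {r K : ℝ}

theorem isDiscreteQuasigeodesic_smul (hK : 1 ≤ K)
    (hd : ∀ g h : G, dist (g • s) (h • s) ≤ K * wordDist T g h ∧
      wordDist T g h ≤ K * dist (g • s) (h • s) + K)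
    {p : ℕ → G} {n : ℕ} (hp : ∀ i ≤ n, ∀ j ≤ n, wordDist T (p i) (p j) = |(i : ℝ) - j|) :
    IsDiscreteQuasigeodesic K 1 (fun i => p i • s) n := fun i hi j hj => by
  have h1 := hd (p i) (p j)
  rw [hp i hi j hj] at h1
  refine ⟨?_, by linarith⟩
  rw [sub_le_iff_le_add, div_le_iff₀' (by linarith)]
  linarith

/-- The quasigeodesic is transported to G by choosing nearby orbit points, the Morse property is
used there, and the result is transported back. -/
theorem exists_dist_smul_le_of_isMorse (hr : ∀ y : S, ∃ g : G, dist y (g • s) ≤ r) (hK : 1 ≤ K)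
    (hd : ∀ g h : G, dist (g • s) (h • s) ≤ K * wordDist T g h ∧
      wordDist T g h ≤ K * dist (g • s) (h • s) + K)
    {M : ℝ → ℝ → ℝ} {A : Set G} (hA : IsMorse (wordDist T) M A) {l m ρ : ℝ} (hl : 1 ≤ l)
    (hm : 0 ≤ m) (hρ : 0 ≤ ρ) (hrρ : r ≤ ρ) {q : ℝ → S} {a b : ℝ} (hab : a ≤ b)
    (hq : IsQuasigeodesicOn dist l m q a b) {g g' : G} (hg : g ∈ A) (hg' : g' ∈ A)
    (ha : dist (q a) (g • s) ≤ ρ) (hb : dist (q b) (g' • s) ≤ ρ) {t : ℝ} (ht : t ∈ Icc a b) :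
    ∃ k ∈ A, dist (q t) (k • s) ≤ ρ + K * M (K * l) (K * (m + 2 * ρ) + K) := by
  choose ν hν using hr
  -- The values at the ends are prescribed, so that the transported path ends in A.
  let f : ℝ → G := fun t => if t = a then g else if t = b then g' else ν (q t)
  have hfa : f a = g := if_pos rfl
  have hfb : f b ∈ A := by
    by_cases h : b = a
    · rw [h, hfa]
      exact hg
    · simpa [f, h] using hg'
  have hf : ∀ t, dist (q t) (f t • s) ≤ ρ := by
    intro t
    by_cases h1 : t = a
    · rw [h1, hfa]
      exact ha
    by_cases h2 : t = b
    · have : f t = g' := by simp only [f, if_neg h1, if_pos h2]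
      rw [this, h2]
      exact hb
    · have : f t = ν (q t) := by simp only [f, if_neg h1, if_neg h2]
      rw [this]
      exact (hν _).trans hrρ
  have hK0 : 0 < K := by linarith
  have hl0 : 0 < l := by linarith
  have hfq : IsQuasigeodesicOn (wordDist T) (K * l) (K * (m + 2 * ρ) + K) f a b := by
    intro x hx y hy
    have h1 := hq x hx y hy
    have h2 := hd (f x) (f y)
    have h3 := dist_triangle4 (q x) (f x • s) (f y • s) (q y)
    have h4 := dist_triangle4 (f x • s) (q x) (q y) (f y • s)
    rw [dist_comm (f y • s)] at h3
    rw [dist_comm (f x • s) (q x)] at h4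
    have h5 := hf x
    have h6 := hf y
    constructor
    · rw [sub_le_iff_le_add, mul_comm K l, ← div_div, div_le_iff₀' hK0]
      have h7 : K * 1 * (m + 2 * ρ) ≤ K * K * (m + 2 * ρ) := by gcongr
      have h8 : 1 * 1 * (m + 2 * ρ) ≤ K * 1 * (m + 2 * ρ) := by gcongr
      have h9 : 0 ≤ K * K := by positivity
      linarith
    · have h7 : K * dist (f x • s) (f y • s) ≤ K * (l * |x - y| + m + 2 * ρ) := by
        gcongr
        linarith
      linarith
  obtain ⟨k, hk, h⟩ := hA (K * l) (K * (m + 2 * ρ) + K) (by nlinarith) (by positivity) f a b hab hfq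
    (by rwa [hfa]) hfb t ht
  refine ⟨k, hk, ?_⟩
  have h1 := (hd (f t) k).1
  have h2 := mul_le_mul_of_nonneg_left h hK0.le
  linarith [dist_triangle (q t) (f t • s) (k • s), hf t]

/-- Geodesics in `S` that join points in the orbit of a subgroup, all word geodesics of which are
uniformly Morse, have uniformly Morse subsegments. -/
theorem exists_isMorse_subsegment (hT : Subgroup.closure T = ⊤)
    (hr : ∀ y : S, ∃ g : G, dist y (g • s) ≤ r) (hK : 1 ≤ K)
    (hd : ∀ g h : G, dist (g • s) (h • s) ≤ K * wordDist T g h ∧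
      wordDist T g h ≤ K * dist (g • s) (h • s) + K)
    {M : ℝ → ℝ → ℝ} {H : Subgroup G}
    (hM : ∀ A : Set G, IsWordGeodesicBetween T H A → IsMorse (wordDist T) M A) :
    ∃ M' : ℝ → ℝ → ℝ, ∀ h ∈ H, ∀ h' ∈ H, ∀ (γ : ℝ → S) (c : ℝ), 0 ≤ c →
      IsGeodesicOn γ (Icc 0 c) → γ 0 = h • s → γ c = h' • s →
      ∀ u v, 0 ≤ u → u ≤ v → v ≤ c → IsMorse dist M' (γ '' Icc u v) := by
  have hr0 : 0 ≤ r := by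
    obtain ⟨g, hg⟩ := hr s
    exact dist_nonneg.trans hg
  set C₁ := max (r + K * M (K * 1) (K * (0 + 2 * r) + K)) r with hC₁
  have hC₁r : r ≤ C₁ := le_max_right _ _
  have hC₁0 : 0 ≤ C₁ := hr0.trans hC₁r
  set C₂ := C₁ + (K * (K * (1 + 2 * C₁ + 1)) + 1) with hC₂
  set ρ : ℝ → ℝ → ℝ := fun l m => max (C₁ + K * M (K * l) (K * (m + 2 * C₁) + K) + C₂) 0 with hρ
  refine ⟨fun l m => l * (l * (2 * (l + m + 3 * ρ l m) + m)) + m + (l + m + 3 * ρ l m),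
    fun h hh h' hh' γ c hc hγ h0 h1 u v hu huv hv => ?_⟩
  obtain ⟨n, p, hp0, hpn, hp⟩ := exists_word_geodesic hT h h'
  have hA := hM (p '' Iic n) ⟨n, p, by rwa [hp0], by rwa [hpn], hp, rfl⟩
  have hpq := isDiscreteQuasigeodesic_smul (s := s) hK hd hp
  have hmem0 : h ∈ p '' Iic n := ⟨0, Nat.zero_le _, hp0⟩
  have hmemn : h' ∈ p '' Iic n := ⟨n, mem_Iic.2 le_rfl, hpn⟩
  have near1 : ∀ t ∈ Icc 0 c, ∃ i ≤ n, dist (γ t) (p i • s) ≤ C₁ := by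
    intro t ht
    obtain ⟨_, ⟨i, hi, rfl⟩, h⟩ := exists_dist_smul_le_of_isMorse hr hK hd hA le_rfl le_rfl hr0
      le_rfl hc hγ.isQuasigeodesicOn hmem0 hmemn (by rw [h0, dist_self]; exact hr0)
      (by rw [h1, dist_self]; exact hr0) ht
    exact ⟨i, hi, h.trans (le_max_left _ _)⟩
  -- Both directions are needed: a quasigeodesic is first compared with the word geodesic and then,
  -- through it, with γ.
  have near2 : ∀ i ≤ n, ∃ t ∈ Icc 0 c, dist (γ t) (p i • s) ≤ C₂ := fun i hi =>
    hpq.exists_dist_le hK hc zero_le_one (fun t ht t' ht' h => by rwa [hγ t ht t' ht']) near1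
      (by rw [h0, hp0, dist_self]; exact hC₁0) (by rw [h1, hpn, dist_self]; exact hC₁0) hi
  intro l m hl hm q a b hab hq ha hb t ht
  refine exists_mem_subsegment_dist_le hl hm (le_max_right _ _) hγ hu huv hv hq (fun t ht => ?_)
    ha hb ht
  have hend : ∀ x ∈ γ '' Icc u v, ∃ g ∈ p '' Iic n, dist x (g • s) ≤ C₁ := by
    rintro _ ⟨τ, hτ, rfl⟩
    obtain ⟨i, hi, h⟩ := near1 τ ⟨by linarith [hτ.1], by linarith [hτ.2]⟩
    exact ⟨p i, mem_image_of_mem p hi, h⟩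
  obtain ⟨g, hg, hga⟩ := hend _ ha
  obtain ⟨g', hg', hgb⟩ := hend _ hb
  obtain ⟨_, ⟨i, hi, rfl⟩, h2⟩ := exists_dist_smul_le_of_isMorse hr hK hd hA hl hm hC₁0 hC₁r hab hq
    hg hg' hga hgb ht
  obtain ⟨τ, hτ, h3⟩ := near2 i hi
  refine ⟨τ, hτ, le_trans ?_ (le_max_left _ _)⟩
  linarith [dist_triangle_right (q t) (γ τ) (p i • s)]

variable [Nonempty S] [IsIsometricSMul G S]

theorem abs_dist_smul_sub_le (hS : IsGeodesicSpace S) {w : Weights} (x : Space S w) (s : S)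
    (g h : G) : |dist (g • x) (h • x) -
      dist (Space.ofPoint hS w (g • s)) (Space.ofPoint hS w (h • s))| ≤
        2 * dist x (Space.ofPoint hS w s) := by
  rw [← Space.smul_ofPoint, ← Space.smul_ofPoint]
  have h1 : ∀ g : G, dist (g • x) (g • Space.ofPoint hS w s) = dist x (Space.ofPoint hS w s) :=
    fun g => dist_smul _ _ _
  have h2 := dist_dist_dist_le (g • x) (h • x) (g • Space.ofPoint hS w s)
    (h • Space.ofPoint hS w s)
  rw [h1, h1, Real.dist_eq] at h2
  linarith

/-- The lower bound uses one summand of the metric of X, with R at least 10D for the common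
contraction constant D. The upper bound holds because both the inclusion into G and the orbit map to
X are coarsely Lipschitz. Changing the base point costs 2e. -/
theorem isQIEmbedding_of_isStable (hS : IsGeodesicSpace S)
    (hMorse : ∀ M : ℝ → ℝ → ℝ, ∃ D : ℝ, ∀ A : Set S, IsGeodesicSet A → IsMorse dist M A →
      StronglyContracting A D)
    (w : Weights) (hp : IsProperAction G S) (hc : IsCoboundedAction G S) (hfin : T.Finite)
    (hT : Subgroup.closure T = ⊤) {H : Subgroup G} {U : Set H} (hH : IsStable T H U)
    (x : Space S w) : IsQIEmbedding (wordDist U) dist (fun h : H => (h : G) • x) := by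
  obtain ⟨s, r, hr⟩ := hc
  obtain ⟨⟨K₁, C₁, hK₁, hC₁, hqi⟩, M, hM⟩ := hH
  obtain ⟨K, hK, hd⟩ := exists_wordDist_le hS hp hr hT hfin
  obtain ⟨M', hM'⟩ := exists_isMorse_subsegment hT hr hK hd hM
  obtain ⟨D₀, hD₀⟩ := hMorse M'
  set D := max D₀ 1 with hD
  have hD1 : 1 ≤ D := le_max_right _ _
  obtain ⟨n, hn⟩ := exists_nat_ge (10 * D)
  have hn0 : 0 < n := by
    have : (0 : ℝ) < n := by linarith
    exact_mod_cast this
  set R : ℕ+ := ⟨n, hn0⟩ with hR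
  set c : ℝ := (w.lam R : ℝ) with hcdef
  have hlam : 0 < c := w.pos R
  set σ : ℝ := ∑' R : ℕ+, (w.lam R : ℝ) with hσ
  have hσ0 : 0 ≤ σ := tsum_nonneg fun R => (w.lam R).2
  set e : ℝ := dist x (Space.ofPoint hS w s) with he
  have he0 : 0 ≤ e := dist_nonneg
  have hlow : ∀ h h' : H, c * (dist ((h : G) • s) ((h' : G) • s) / (50 * D) - 1) ≤
      dist (Space.ofPoint hS w ((h : G) • s)) (Space.ofPoint hS w ((h' : G) • s)) := by
    intro h h'
    obtain ⟨γ, hγ, h0, h1⟩ := hS ((h : G) • s) ((h' : G) • s)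
    have h2 := le_chainDist_of_contracting (w := w) hS hD1 dist_nonneg hγ (fun u v hu huv hv =>
      (hD₀ _ ⟨γ, Icc u v, ordConnected_Icc, isClosed_Icc, nonempty_Icc.2 huv,
        hγ.mono (Icc_subset_Icc hu hv), rfl⟩
        (hM' h h.2 h' h'.2 γ _ dist_nonneg hγ h0 h1 u v hu huv hv)).mono (le_max_left _ _))
      (R := R) hn
    rw [h0, h1] at h2
    exact (mul_le_mul_of_nonneg_left h2 hlam.le).trans (mul_chainDist_le_dist R _ _)
  set Q : ℝ := K₁ * K * (50 * D) / c + σ * K * K₁ + 1 with hQ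
  have hQ1 : K₁ * K * (50 * D) / c ≤ Q := by
    have : 0 ≤ σ * K * K₁ := by positivity
    linarith
  have hpos : 0 < K₁ * K * (50 * D) / c := by positivity
  have hQ2 : σ * K * K₁ ≤ Q := by linarith
  have hQ3 : 1 ≤ Q := by
    have : 0 ≤ σ * K * K₁ := by positivity
    linarith
  refine ⟨Q, c * ((C₁ + K) / (K * (50 * D)) + 1) + σ * (K * C₁ + 2) + 2 * e, hQ3, by positivity,
    fun h h' => ?_⟩
  have h1 := hqi h h'
  have h2 := hd (h : G) (h' : G)
  have h3 := abs_le.1 (abs_dist_smul_sub_le hS x s (h : G) (h' : G))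
  have h4 := hlow h h'
  have h5 := dist_ofPoint_le hS (w := w) ((h : G) • s) ((h' : G) • s)
  have hW : 0 ≤ wordDist U h h' := wordDist_nonneg _ _
  constructor
  · have h6 : wordDist U h h' / Q ≤ wordDist U h h' / (K₁ * K * (50 * D) / c) := by gcongr
    have h7 : wordDist U h h' / (K₁ * K * (50 * D) / c) =
        c * ((wordDist U h h' / K₁ - C₁ - K) / K / (50 * D) - 1) +
          c * ((C₁ + K) / (K * (50 * D)) + 1) := by
      field_simp
      ring
    have h8 : (wordDist U h h' / K₁ - C₁ - K) / K ≤ dist ((h : G) • s) ((h' : G) • s) := by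
      rw [div_le_iff₀' (by linarith)]
      linarith
    have h9 : c * ((wordDist U h h' / K₁ - C₁ - K) / K / (50 * D) - 1) ≤
        c * (dist ((h : G) • s) ((h' : G) • s) / (50 * D) - 1) := by gcongr
    have h10 : 0 ≤ σ * (K * C₁ + 2) := by positivity
    linarith
  · have h6 : σ * (dist ((h : G) • s) ((h' : G) • s) + 2) ≤
        σ * (K * (K₁ * wordDist U h h' + C₁) + 2) := by
      gcongr
      exact h2.1.trans (by gcongr; exact h1.2)
    have h7 : σ * K * K₁ * wordDist U h h' ≤ Q * wordDist U h h' := by gcongr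
    have h8 : 0 ≤ c * ((C₁ + K) / (K * (50 * D)) + 1) := by positivity
    linarith

end Stable

/-! ## Quasigeodesics along a ladder of ball-separated curtains -/

theorem exists_threshold {n : ℕ} {P : ℕ → Prop} (h : ∀ i j, i < j → j < n → P j → P i) :
    ∃ v ≤ n, ∀ b < n, P b ↔ b < v := by
  classical
  have hex : ∃ v, v = n ∨ ¬ P v := ⟨n, Or.inl rfl⟩
  refine ⟨Nat.find hex, Nat.find_min' hex (Or.inl rfl), fun b hb => ⟨fun hP => ?_, fun hlt => ?_⟩⟩
  · by_contra! hle
    rcases Nat.find_spec hex with h1 | h1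
    · omega
    · rcases hle.eq_or_lt with h2 | h2
      · rw [h2] at h1
        exact h1 hP
      · exact h1 (h _ _ h2 hb hP)
  · have := Nat.find_min hex hlt
    push Not at this
    exact this.2

/-- A sequence of pairs of ball-separated curtains along a sequence of points. -/
structure Ladder {S : Type*} [MetricSpace S] (R κ : ℝ) (n : ℕ) (𝔥 𝔨 : ℕ → Curtain S)
    (z : ℕ → S) : Prop where
  inner : ∀ b < n, (𝔥 b).Precedes R (𝔨 b)
  outer : ∀ b b', b < b' → b' < n → (𝔨 b).Precedes R (𝔥 b')
  mem_minus : ∀ b < n, z b ∈ (𝔥 b).minus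
  mem_plus : ∀ b < n, z (b + 1) ∈ (𝔨 b).plus
  dist_le : ∀ b < n, dist (z b) (z (b + 1)) ≤ κ

namespace Ladder

variable {S : Type*} [MetricSpace S] {R κ : ℝ} {n : ℕ} {𝔥 𝔨 : ℕ → Curtain S} {z : ℕ → S}

/-- The number of curtains `𝔨 b` that have been passed at `y` is `v`. -/
def IsLevel (n : ℕ) (𝔨 : ℕ → Curtain S) (y : S) (v : ℕ) : Prop :=
  v ≤ n ∧ ∀ b < n, (y ∈ (𝔨 b).plus ↔ b < v)

theorem exists_isLevel (hL : Ladder R κ n 𝔥 𝔨 z) (y : S) : ∃ v, IsLevel n 𝔨 y v :=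
  exists_threshold fun i j hij hj h =>
    ((hL.outer i j hij hj).trans (hL.inner j hj)).plus_subset h

theorem isLevel_of_mem (hL : Ladder R κ n 𝔥 𝔨 z) {b : ℕ} (hb : b < n) {y : S}
    (h : y ∈ (𝔥 b).plus) (h' : y ∈ (𝔨 b).minus) : IsLevel n 𝔨 y b := by
  refine ⟨hb.le, fun c hc => ⟨fun hy => ?_, fun hcb => (hL.outer c b hcb hb).plus_subset h⟩⟩
  by_contra! hbc
  rcases hbc.eq_or_lt with rfl | hbc
  · exact Curtain.notMem_plus_of_mem_minus h' hy
  · exact Curtain.notMem_plus_of_mem_minus h'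
      (((hL.outer b c hbc hc).trans (hL.inner c hc)).plus_subset hy)

theorem mem_minus_of_isLevel (hL : Ladder R κ n 𝔥 𝔨 z) {y : S} {v b : ℕ} (hv : IsLevel n 𝔨 y v)
    (hvb : v < b) (hb : b < n) : y ∈ (𝔥 b).minus :=
  (hL.outer v b hvb hb).mem_minus_of_notMem_plus fun h =>
    lt_irrefl v ((hv.2 v (hvb.trans hb)).1 h)

/-- All but one of the curtains counted by the difference of the levels are crossed on the way from
y to y', each of thickness 8. -/
theorem level_sub_le (hS : IsGeodesicSpace S) (hL : Ladder R κ n 𝔥 𝔨 z) {y y' : S} {v v' : ℕ}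
    (hv : IsLevel n 𝔨 y v) (hv' : IsLevel n 𝔨 y' v') : (v' : ℝ) - v ≤ dist y y' + 1 := by
  have hd : 0 ≤ dist y y' := dist_nonneg
  by_cases h : v' ≤ v + 1
  · have : (v' : ℝ) ≤ v + 1 := by exact_mod_cast h
    linarith
  · have hn := hv'.1
    have h1 := Curtain.le_dist_of_precedes hS (𝔨 := 𝔨) (i := v + 1) (j := v' - 1) (R := R)
      (by omega) (fun m _ hm => (hL.outer m (m + 1) (by omega) (by omega)).trans
        (hL.inner (m + 1) (by omega)))
      ((hL.inner (v + 1) (by omega)).minus_subset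
        (hL.mem_minus_of_isLevel hv (Nat.lt_succ_self v) (by omega)))
      ((hv'.2 (v' - 1) (by omega)).2 (by omega))
    have h2 : (v : ℝ) + 2 ≤ v' := by
      have : v + 2 ≤ v' := by omega
      exact_mod_cast this
    rw [Nat.cast_sub (by omega)] at h1
    push_cast at h1
    linarith

theorem abs_level_sub_le (hS : IsGeodesicSpace S) (hL : Ladder R κ n 𝔥 𝔨 z) {y y' : S} {v v' : ℕ}
    (hv : IsLevel n 𝔨 y v) (hv' : IsLevel n 𝔨 y' v') : |(v : ℝ) - v'| ≤ dist y y' + 1 := by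
  have h1 := hL.level_sub_le hS hv hv'
  have h2 := hL.level_sub_le hS hv' hv
  rw [dist_comm y'] at h2
  exact abs_le.2 ⟨by linarith, by linarith⟩

/-- The properties of the centres of the balls that separate the pairs of curtains. -/
structure IsCentre (R : ℝ) (n : ℕ) (𝔥 𝔨 : ℕ → Curtain S) (o : ℕ → S) : Prop where
  mem_plus : ∀ b < n, o b ∈ (𝔥 b).plus
  mem_minus : ∀ b < n, o b ∈ (𝔨 b).minus
  exists_dist_le : ∀ b < n, ∀ (γ : ℝ → S) (l : ℝ), 0 ≤ l → IsGeodesicOn γ (Icc 0 l) →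
    γ 0 ∈ (𝔥 b).minus → γ l ∈ (𝔨 b).plus → ∃ u ∈ Icc 0 l, dist (γ u) (o b) ≤ R

theorem exists_isCentre (hL : Ladder R κ n 𝔥 𝔨 z) : ∃ o, IsCentre R n 𝔥 𝔨 o := by
  have : Nonempty S := ⟨z 0⟩
  choose! o h1 h2 h3 using fun b (hb : b < n) => (hL.inner b hb).exists_ball
  refine ⟨o, h1, h2, fun b hb γ l hl hγ h0 h => ?_⟩
  obtain ⟨u, hu, h4, -⟩ := h3 b hb γ 0 l hl hγ (Or.inl ⟨h0, h⟩)
  exact ⟨u, hu, h4⟩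

variable {o : ℕ → S}

theorem IsCentre.dist_le (hS : IsGeodesicSpace S) (ho : IsCentre R n 𝔥 𝔨 o) {b : ℕ} (hb : b < n)
    {x y : S} (hx : x ∈ (𝔥 b).minus) (hy : y ∈ (𝔨 b).plus) :
    dist x (o b) ≤ dist x y + R ∧ dist y (o b) ≤ dist x y + R := by
  obtain ⟨γ, hγ, rfl, h1⟩ := hS x y
  obtain ⟨u, hu, h⟩ := ho.exists_dist_le b hb γ _ dist_nonneg hγ hx (by rwa [h1])
  have h2 := hγ 0 ⟨le_rfl, dist_nonneg⟩ u hu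
  have h3 := hγ _ ⟨dist_nonneg, le_rfl⟩ u hu
  rw [abs_of_nonpos (by linarith [hu.1])] at h2
  rw [abs_of_nonneg (by linarith [hu.2]), h1] at h3
  constructor
  · linarith [dist_triangle (γ 0) (γ u) (o b), hu.2]
  · linarith [dist_triangle y (γ u) (o b), hu.1]

theorem dist_centre_le (hS : IsGeodesicSpace S) (hL : Ladder R κ n 𝔥 𝔨 z)
    (ho : IsCentre R n 𝔥 𝔨 o) {b : ℕ} (hb : b < n) :
    dist (z b) (o b) ≤ κ + R ∧ dist (z (b + 1)) (o b) ≤ κ + R := by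
  have h1 := ho.dist_le hS hb (hL.mem_minus b hb) (hL.mem_plus b hb)
  have h2 := hL.dist_le b hb
  exact ⟨by linarith, by linarith⟩

theorem dist_points_le (hL : Ladder R κ n 𝔥 𝔨 z) {b c : ℕ} (hbc : b ≤ c) (hc : c ≤ n) :
    dist (z b) (z c) ≤ κ * (c - b) := by
  induction c, hbc using Nat.le_induction with
  | base => simp
  | succ c hbc ih =>
    have := ih (by omega)
    have := hL.dist_le c (by omega)
    have := dist_triangle (z b) (z c) (z (c + 1))
    push_cast
    linarith

theorem dist_centre_centre_le (hS : IsGeodesicSpace S) (hL : Ladder R κ n 𝔥 𝔨 z)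
    (ho : IsCentre R n 𝔥 𝔨 o) {b c : ℕ} (hb : b < n) (hc : c < n) :
    dist (o b) (o c) ≤ 2 * (κ + R) + κ * |(b : ℝ) - c| := by
  have key : dist (z b) (z c) ≤ κ * |(b : ℝ) - c| := by
    rcases le_total b c with h | h
    · have h' : (b : ℝ) ≤ c := by exact_mod_cast h
      rw [abs_of_nonpos (by linarith), neg_sub]
      exact hL.dist_points_le h hc.le
    · have h' : (c : ℝ) ≤ b := by exact_mod_cast h
      rw [abs_of_nonneg (by linarith), dist_comm]
      exact hL.dist_points_le h hb.le
  have h1 := (hL.dist_centre_le hS ho hb).1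
  have h2 := (hL.dist_centre_le hS ho hc).1
  have h3 := dist_triangle4_left (o b) (z b) (z c) (o c)
  have h4 := dist_triangle4 (o b) (z b) (z c) (o c)
  rw [dist_comm (o b) (z b)] at h4
  linarith

/-- If neither of two points is near a centre, then their levels differ by at most one. -/
theorem level_le_add_one (hS : IsGeodesicSpace S) (hL : Ladder R κ n 𝔥 𝔨 z)
    (ho : IsCentre R n 𝔥 𝔨 o) {y y' : S} {v v' : ℕ} (hv : IsLevel n 𝔨 y v)
    (hv' : IsLevel n 𝔨 y' v') {ρ : ℝ} (hρ : dist y y' + R ≤ ρ)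
    (hfar : (∀ b < n, ρ < dist y (o b)) ∨ (∀ b < n, ρ < dist y' (o b))) : v' ≤ v + 1 := by
  by_contra! h
  have hn := hv'.1
  have h1 := ho.dist_le hS (b := v + 1) (by omega)
    (hL.mem_minus_of_isLevel hv (Nat.lt_succ_self v) (by omega))
    ((hv'.2 (v + 1) (by omega)).2 (by omega))
  rcases hfar with hf | hf
  · linarith [hf (v + 1) (by omega)]
  · linarith [hf (v + 1) (by omega)]

theorem abs_level_sub_le_of_far (hS : IsGeodesicSpace S) (hL : Ladder R κ n 𝔥 𝔨 z)
    (ho : IsCentre R n 𝔥 𝔨 o) {lev : S → ℕ} (hlev : ∀ y, IsLevel n 𝔨 y (lev y)) {Y : ℕ → S}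
    {J ρ : ℝ} (hρ : J + R ≤ ρ) {i j : ℕ} (hij : i ≤ j)
    (hJ : ∀ k, i ≤ k → k < j → dist (Y k) (Y (k + 1)) ≤ J)
    (hfar : ∀ k, i ≤ k → k < j → (∀ b < n, ρ < dist (Y k) (o b)) ∨
      (∀ b < n, ρ < dist (Y (k + 1)) (o b))) :
    |(lev (Y i) : ℝ) - lev (Y j)| ≤ j - i := by
  induction j, hij using Nat.le_induction with
  | base => simp
  | succ j hij ih =>
    have h1 := ih (fun k hk hkj => hJ k hk (by omega)) (fun k hk hkj => hfar k hk (by omega))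
    have h2 := hJ j hij (Nat.lt_succ_self j)
    have h3 := hfar j hij (Nat.lt_succ_self j)
    have h4 := hL.level_le_add_one hS ho (hlev (Y j)) (hlev (Y (j + 1))) (ρ := ρ)
      (by linarith) h3
    have h5 := hL.level_le_add_one hS ho (hlev (Y (j + 1))) (hlev (Y j)) (ρ := ρ)
      (by rw [dist_comm]; linarith) h3.symm
    have h6 : |(lev (Y j) : ℝ) - lev (Y (j + 1))| ≤ 1 := by
      have h4' : (lev (Y (j + 1)) : ℝ) ≤ lev (Y j) + 1 := by exact_mod_cast h4
      have h5' : (lev (Y j) : ℝ) ≤ lev (Y (j + 1)) + 1 := by exact_mod_cast h5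
      exact abs_le.2 ⟨by linarith, by linarith⟩
    have h7 := abs_sub_le (lev (Y i) : ℝ) (lev (Y j)) (lev (Y (j + 1)))
    push_cast
    linarith

/-- A sequence of points that makes good progress and starts and ends near a centre cannot make
long excursions from the centres. -/
theorem exists_dist_centre_le (hS : IsGeodesicSpace S) (hR : 0 ≤ R) (hκ : 0 ≤ κ)
    (hL : Ladder R κ n 𝔥 𝔨 z) (ho : IsCentre R n 𝔥 𝔨 o) {Y : ℕ → S} {N : ℕ} {J ρ m : ℝ}
    (hJ0 : 0 ≤ J) (hm : 0 ≤ m) (hρ : J + R ≤ ρ) (hJ : ∀ i < N, dist (Y i) (Y (i + 1)) ≤ J)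
    (hlow : ∀ i j, i ≤ j → j ≤ N → 2 * (κ + 1) * ((j : ℝ) - i - 1) - m ≤ dist (Y i) (Y j))
    (h0 : ∃ b < n, dist (Y 0) (o b) ≤ ρ) (hN : ∃ b < n, dist (Y N) (o b) ≤ ρ) {i : ℕ}
    (hi : i ≤ N) :
    ∃ b < n, dist (Y i) (o b) ≤
      J * (2 * κ + 2 + m + 2 * ρ + 2 * (κ + R) + κ * (2 * ρ + 2)) + ρ := by
  classical
  have hρ0 : 0 ≤ ρ := by linarith
  have hE : 0 ≤ J * (2 * κ + 2 + m + 2 * ρ + 2 * (κ + R) + κ * (2 * ρ + 2)) := by positivity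
  by_cases hnear : ∃ b < n, dist (Y i) (o b) ≤ ρ
  · obtain ⟨b, hb, h⟩ := hnear
    exact ⟨b, hb, by linarith⟩
  choose lev hlev using hL.exists_isLevel
  let P : ℕ → Prop := fun j => ∃ b < n, dist (Y j) (o b) ≤ ρ
  -- The excursion containing i lasts from the last index before it to the first index after it that
  -- is near a centre.
  set i₁ := Nat.findGreatest P i with hi₁
  have h1 : P i₁ := Nat.findGreatest_spec (P := P) (Nat.zero_le i) h0
  have h1i : i₁ ≤ i := Nat.findGreatest_le i
  have h1f : ∀ j, i₁ < j → j ≤ i → ¬ P j := fun j h h' => Nat.findGreatest_is_greatest h h'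
  have hex : ∃ j, i ≤ j ∧ P j := ⟨N, hi, hN⟩
  set i₂ := Nat.find hex with hi₂
  obtain ⟨h2i, h2⟩ : i ≤ i₂ ∧ P i₂ := Nat.find_spec hex
  have h2N : i₂ ≤ N := Nat.find_min' hex ⟨hi, hN⟩
  have h2f : ∀ j, i ≤ j → j < i₂ → ¬ P j := fun j h h' hP => Nat.find_min hex h' ⟨h, hP⟩
  have h1i' : i₁ < i := lt_of_le_of_ne h1i fun h => hnear (by rw [← h]; exact h1)
  have hfar' : ∀ j, i₁ < j → j < i₂ → ∀ b < n, ρ < dist (Y j) (o b) := by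
    intro j hj hj' b hb
    by_contra! hle
    rcases le_total j i with h | h
    · exact h1f j hj h ⟨b, hb, hle⟩
    · exact h2f j h hj' ⟨b, hb, hle⟩
  have h2i' : i < i₂ := lt_of_le_of_ne h2i fun h => hnear (by rw [h]; exact h2)
  have hlevdiff := hL.abs_level_sub_le_of_far hS ho hlev hρ (Y := Y) (h1i.trans h2i)
    (fun k _ hk => hJ k (by omega)) (fun k hk hk' => by
      rcases hk.eq_or_lt with h | h
      · exact Or.inr (hfar' (k + 1) (by omega) (by omega))
      · exact Or.inl (hfar' k h hk'))
  obtain ⟨b₁, hb₁, hd₁⟩ := h1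
  obtain ⟨b₂, hb₂, hd₂⟩ := h2
  have hl₁ := hL.abs_level_sub_le hS (hlev (Y i₁))
    (hL.isLevel_of_mem hb₁ (ho.mem_plus b₁ hb₁) (ho.mem_minus b₁ hb₁))
  have hl₂ := hL.abs_level_sub_le hS (hlev (Y i₂))
    (hL.isLevel_of_mem hb₂ (ho.mem_plus b₂ hb₂) (ho.mem_minus b₂ hb₂))
  have hbb : |(b₁ : ℝ) - b₂| ≤ (i₂ - i₁) + (2 * ρ + 2) := by
    have h3 := abs_sub_le (b₁ : ℝ) (lev (Y i₁)) b₂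
    have h4 := abs_sub_le (lev (Y i₁) : ℝ) (lev (Y i₂)) b₂
    rw [abs_sub_comm (b₁ : ℝ) (lev (Y i₁))] at h3
    linarith
  have hoo := hL.dist_centre_centre_le hS ho hb₁ hb₂
  have hκb := mul_le_mul_of_nonneg_left hbb hκ
  have hup := dist_triangle4 (Y i₁) (o b₁) (o b₂) (Y i₂)
  rw [dist_comm (o b₂)] at hup
  have hlo := hlow i₁ i₂ (by omega) h2N
  have hi12 : (0 : ℝ) ≤ i₂ - i₁ := by
    have : (i₁ : ℝ) ≤ i₂ := by exact_mod_cast (h1i.trans h2i)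
    linarith
  -- Far from the centres the level changes by at most 1 per step. So the centres near the two ends
  -- of the excursion are at distance at most κ(i₂ - i₁) plus a constant, whereas `hlow` demands
  -- about twice as much; this bounds the duration.
  have hk : (i₂ : ℝ) - i₁ ≤ 2 * κ + 2 + m + 2 * ρ + 2 * (κ + R) + κ * (2 * ρ + 2) := by
    have h3 : 0 ≤ κ * (i₂ - i₁) := by positivity
    linarith
  have hdist : dist (Y i₁) (Y i) ≤ J * (i - i₁) := by
    have : ∀ j, i₁ ≤ j → j ≤ N → dist (Y i₁) (Y j) ≤ J * (j - i₁) := by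
      intro j hj
      induction j, hj using Nat.le_induction with
      | base => simp
      | succ j hj ih =>
        intro hjN
        have h3 := ih (by omega)
        have h4 := hJ j (by omega)
        have h5 := dist_triangle (Y i₁) (Y j) (Y (j + 1))
        push_cast
        linarith
    exact this i h1i hi
  have hi' : (i : ℝ) ≤ i₂ := by exact_mod_cast h2i
  have hJk : J * ((i : ℝ) - i₁) ≤
      J * (2 * κ + 2 + m + 2 * ρ + 2 * (κ + R) + κ * (2 * ρ + 2)) :=
    mul_le_mul_of_nonneg_left (by linarith) hJ0
  refine ⟨b₁, hb₁, ?_⟩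
  have := dist_triangle_left (Y i) (o b₁) (Y i₁)
  linarith

end Ladder

/-- A quasigeodesic between the ends of a ladder stays near the points of the ladder. -/
theorem exists_dist_le_of_ladder {S : Type*} [MetricSpace S] (hS : IsGeodesicSpace S) {R κ : ℝ}
    (hR : 0 ≤ R) (hκ : 0 ≤ κ) {l m ρ : ℝ} (hl : 1 ≤ l) (hm : 0 ≤ m) (hρ : 0 ≤ ρ) :
    ∃ C : ℝ, ∀ (n : ℕ) (𝔥 𝔨 : ℕ → Curtain S) (z : ℕ → S), 1 ≤ n → Ladder R κ n 𝔥 𝔨 z →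
      ∀ (q : ℝ → S) (a b : ℝ), IsQuasigeodesicOn dist l m q a b →
      dist (q a) (z 0) ≤ ρ → dist (q b) (z n) ≤ ρ →
      ∀ t ∈ Icc a b, ∃ i < n, dist (q t) (z i) ≤ C := by
  -- Sampling with this step makes the quasigeodesic advance by at least 2(κ + 1) per full step, up
  -- to m, which beats the spacing κ of the ladder. Only the last step may be shorter, whence the -1
  -- in `hlow`.
  set θ := 2 * l * (κ + 1) with hθ
  have hθ0 : 0 < θ := by positivity
  set J := l * θ + m with hJ
  have hJ0 : 0 ≤ J := by positivity
  set ρ' := ρ + J + κ + R with hρ'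
  refine ⟨J + (J * (2 * κ + 2 + m + 2 * ρ' + 2 * (κ + R) + κ * (2 * ρ' + 2)) + ρ') + (κ + R),
    fun n 𝔥 𝔨 z hn hL q a b hq ha hb t ht => ?_⟩
  obtain ⟨o, ho⟩ := hL.exists_isCentre
  set N := ⌈(b - a) / θ⌉₊ with hN
  set τ : ℕ → ℝ := fun i => min (a + i * θ) b with hτ
  have hab : a ≤ b := ht.1.trans ht.2
  have hτmem : ∀ i, τ i ∈ Icc a b := fun i =>
    ⟨le_min (by have : (0 : ℝ) ≤ i * θ := by positivity
                linarith) hab, min_le_right _ _⟩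
  have hτ0 : τ 0 = a := by simp [hτ, hab]
  have hτN : τ N = b := by
    refine min_eq_right ?_
    have := Nat.le_ceil ((b - a) / θ)
    rw [div_le_iff₀ hθ0] at this
    linarith
  have hτstep : ∀ i, |τ i - τ (i + 1)| ≤ θ := by
    intro i
    have := abs_min_sub_min_le_max (a + i * θ) b (a + ((i + 1 : ℕ) : ℝ) * θ) b
    refine this.trans (max_le ?_ (by simpa using hθ0.le))
    push_cast
    rw [show a + i * θ - (a + (i + 1) * θ) = -θ by ring, abs_neg, abs_of_pos hθ0]
  have hτlow : ∀ j ≤ N, a + (j - 1) * θ ≤ τ j := by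
    intro j hj
    refine le_min (by linarith) ?_
    rcases Nat.eq_zero_or_pos j with rfl | hj0
    · push_cast
      linarith
    · have h1 : j - 1 < N := by omega
      rw [Nat.lt_ceil, lt_div_iff₀ hθ0, Nat.cast_sub hj0] at h1
      push_cast at h1
      linarith
  have hstep : ∀ t ∈ Icc a b, ∀ t' ∈ Icc a b, |t - t'| ≤ θ → dist (q t) (q t') ≤ J := by
    intro t ht t' ht' h
    have := (hq t ht t' ht').2
    have := mul_le_mul_of_nonneg_left h (show 0 ≤ l by linarith)
    linarith
  have hlow : ∀ i j, i ≤ j → j ≤ N →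
      2 * (κ + 1) * ((j : ℝ) - i - 1) - m ≤ dist (q (τ i)) (q (τ j)) := by
    intro i j hij hj
    refine le_trans ?_ (hq _ (hτmem i) _ (hτmem j)).1
    have h1 := hτlow j hj
    have h2 : τ i ≤ a + i * θ := min_le_left _ _
    have h3 := neg_le_abs (τ i - τ j)
    gcongr
    rw [le_div_iff₀ (by linarith)]
    have h4 : 2 * (κ + 1) * ((j : ℝ) - i - 1) * l = (j - i - 1) * θ := by rw [hθ]; ring
    linarith
  have h0 : ∃ b' < n, dist (q (τ 0)) (o b') ≤ ρ' := by
    refine ⟨0, hn, ?_⟩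
    rw [hτ0]
    linarith [dist_triangle (q a) (z 0) (o 0), (hL.dist_centre_le hS ho hn).1]
  have h1 : ∃ b' < n, dist (q (τ N)) (o b') ≤ ρ' := by
    refine ⟨n - 1, by omega, ?_⟩
    have h2 := (hL.dist_centre_le hS ho (b := n - 1) (by omega)).2
    rw [Nat.sub_add_cancel hn] at h2
    rw [hτN]
    linarith [dist_triangle (q b) (z n) (o (n - 1))]
  set i := ⌊(t - a) / θ⌋₊ with hi
  have hta : 0 ≤ (t - a) / θ := div_nonneg (by linarith [ht.1]) hθ0.le
  have hiN : i ≤ N := by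
    refine (Nat.floor_le_floor ?_).trans (Nat.floor_le_ceil _)
    gcongr
    exact ht.2
  have hi1 := Nat.floor_le hta
  have hi2 := Nat.lt_floor_add_one ((t - a) / θ)
  rw [le_div_iff₀ hθ0] at hi1
  rw [div_lt_iff₀ hθ0] at hi2
  have hτi : τ i = a + i * θ := min_eq_left (by linarith [ht.2])
  have ht' : dist (q t) (q (τ i)) ≤ J := hstep t ht _ (hτmem i) (by
    rw [hτi]
    exact abs_le.2 ⟨by linarith, by linarith⟩)
  obtain ⟨b', hb', h2⟩ := hL.exists_dist_centre_le hS hR hκ ho (Y := fun i => q (τ i)) (N := N)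
    (J := J) (ρ := ρ') hJ0 hm (by linarith) (fun i _ => hstep _ (hτmem i) _ (hτmem _) (hτstep i))
    hlow h0 h1 hiN
  refine ⟨b', hb', ?_⟩
  have h3 := (hL.dist_centre_le hS ho hb').1
  have h4 := dist_triangle4 (q t) (q (τ i)) (o b') (z b')
  rw [dist_comm (o b')] at h4
  linarith

/-! ## Quasigeodesics near paths that are quasiisometrically embedded in the universal space -/

section ChainLadder

variable {S : Type*} [MetricSpace S] [Nonempty S] {w : Weights}

/-- If the distance in the universal space is linear, then so is one of its summands. -/
theorem exists_le_chainDist (hS : IsGeodesicSpace S) (w : Weights) {L K C : ℝ} (hL : 0 ≤ L)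
    (hK : 1 ≤ K) (hC : 0 ≤ C) :
    ∃ (R : ℕ+) (K' C' : ℝ), 1 ≤ K' ∧ 0 ≤ C' ∧ ∀ (W : ℝ) (s t : S), dist s t ≤ L * W →
      W / K - C ≤ dist (Space.ofPoint hS w s) (Space.ofPoint hS w t) →
      W / K' - C' ≤ chainDist R (Space.ofPoint hS w s) (Space.ofPoint hS w t) := by
  have hsum : Summable fun R : ℕ+ => (w.lam R : ℝ) :=
    (w.summable_mul_linear 0 1).congr fun R => by simp
  set σ : ℝ := ∑' R : ℕ+, (w.lam R : ℝ) with hσ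
  have hσ0 : 0 ≤ σ := tsum_nonneg fun R => (w.lam R).2
  have hε : 0 < 1 / (2 * K * (L + 1)) := by positivity
  -- Outside F the weights are so small that their share, bounded by the distance in S, is at most
  -- half of the linear growth up to a constant. The terms in F are dominated by the one with the
  -- largest R.
  obtain ⟨F, hF⟩ := ((tendsto_tsum_compl_atTop_zero fun R : ℕ+ => (w.lam R : ℝ)).eventually
    (gt_mem_nhds hε)).exists
  set ε : ℝ := ∑' R : {R // R ∉ F}, (w.lam R : ℝ) with hεdef
  have hε0 : 0 ≤ ε := tsum_nonneg fun R => (w.lam R).2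
  have htail : HasSum ({R | R ∉ F}.indicator fun R : ℕ+ => (w.lam R : ℝ)) ε :=
    hasSum_subtype_iff_indicator.1 (hsum.subtype _).hasSum
  refine ⟨F.sup id, 2 * K * (σ + 1), C + 2 * ε, by nlinarith, by positivity,
    fun W s t hst hW => ?_⟩
  set d : ℝ :=
    (chainDist (F.sup id) (Space.ofPoint hS w s) (Space.ofPoint hS w t) : ℝ) with hd
  have hd0 : 0 ≤ d := Nat.cast_nonneg _
  have h1 : dist (Space.ofPoint hS w s) (Space.ofPoint hS w t) ≤
      σ * d + ε * (dist s t + 2) := by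
    refine hasSum_le (fun R => ?_) (hasSum_chainDist _ _)
      ((hsum.hasSum.mul_right d).add (htail.mul_right (dist s t + 2)))
    have hl0 : (0 : ℝ) ≤ w.lam R := (w.lam R).2
    have hst0 : 0 ≤ dist s t := dist_nonneg
    by_cases hR : R ∈ F
    · have h2 : ((chainDist R (Space.ofPoint hS w s) (Space.ofPoint hS w t) : ℕ) : ℝ) ≤ d :=
        Nat.cast_le.2 (chainDist_mono (Finset.le_sup (f := id) hR) _ _)
      rw [indicator_of_notMem (by simpa using hR), zero_mul, add_zero]
      gcongr
    · have h2 := chainDist_ofPoint_le (w := w) hS R s t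
      rw [indicator_of_mem (by simpa using hR)]
      have h3 := mul_le_mul_of_nonneg_left h2 hl0
      have h4 : 0 ≤ (w.lam R : ℝ) * d := by positivity
      linarith
  have hε' : ε ≤ 1 / (2 * K * (L + 1)) := hF.le
  rcases lt_or_ge W 0 with hW0 | hW0
  · have : W / (2 * K * (σ + 1)) ≤ 0 := div_nonpos_of_nonpos_of_nonneg hW0.le (by positivity)
    linarith
  have h2 : ε * (dist s t + 2) ≤ W / (2 * K) + 2 * ε := by
    have h3 : ε * dist s t ≤ 1 / (2 * K * (L + 1)) * ((L + 1) * W) := by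
      gcongr
      linarith
    have h4 : 1 / (2 * K * (L + 1)) * ((L + 1) * W) = W / (2 * K) := by field_simp
    linarith
  have h3 : W / K = W / (2 * K) + W / (2 * K) := by field_simp; ring
  have h4 : W / (2 * K) - (C + 2 * ε) ≤ (σ + 1) * d := by linarith
  have h5 : W / (2 * K * (σ + 1)) - (C + 2 * ε) / (σ + 1) ≤ d := by
    rw [← div_div, ← sub_div, div_le_iff₀' (by positivity)]
    exact h4
  have h6 : (C + 2 * ε) / (σ + 1) ≤ C + 2 * ε := div_le_self (by positivity) (by linarith)
  linarith

/-- The defect of the triangle inequality is the weighted sum of the defects of all d_R. These are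
nonnegative, so a bound on the sum bounds each of them. -/
theorem mul_chainDist_add_le (R : ℕ+) {x y z u : Space S w} {B : ℝ}
    (h : dist x y + dist y z + dist z u ≤ dist x u + B) :
    (w.lam R : ℝ) * (chainDist R x y + chainDist R y z + chainDist R z u) ≤
      w.lam R * chainDist R x u + B := by
  have h1 := (((hasSum_chainDist x y).add (hasSum_chainDist y z)).add (hasSum_chainDist z u)).sub
    (hasSum_chainDist x u)
  have h2 := le_hasSum h1 R fun R _ => by
    have h3 := chainDist_triangle R x y u
    have h4 := chainDist_triangle R y z u
    have h5 : (chainDist R x u : ℝ) ≤ chainDist R x y + chainDist R y z + chainDist R z u := by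
      exact_mod_cast (by omega :
        chainDist R x u ≤ chainDist R x y + chainDist R y z + chainDist R z u)
    have h6 := mul_le_mul_of_nonneg_left h5 (w.lam R).2
    change (w.lam R : ℝ) * _ ≤ (w.lam R : ℝ) * _ at h6
    linarith
  linarith

/-- Let v(u) be the number of members of a longest R-chain from x to y that u has passed. Cutting
the chain there bounds d_R(x,u) and d_R(u,y) from below, so the hypothesis makes v grow by at least
4 from `z b` to `z (b + 1)`. The members v+1 and v+2 become the pair of curtains; v and v+3 place
the two points strictly outside. -/
theorem exists_ladder (hS : IsGeodesicSpace S) {R : ℕ+} {x y : S} {n : ℕ} (hn : 1 ≤ n)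
    {z : ℕ → S} {κ : ℝ} (hz : ∀ b < n, dist (z b) (z (b + 1)) ≤ κ)
    (h : ∀ b < n, chainDist R (Space.ofPoint hS w x) (Space.ofPoint hS w (z b)) + 4 +
      chainDist R (Space.ofPoint hS w (z (b + 1))) (Space.ofPoint hS w y) ≤
        chainDist R (Space.ofPoint hS w x) (Space.ofPoint hS w y)) :
    ∃ 𝔥 𝔨 : ℕ → Curtain S, Ladder (R : ℝ) κ n 𝔥 𝔨 z := by
  obtain ⟨l, hl, hlN⟩ := exists_chain R (Space.ofPoint hS w x) (Space.ofPoint hS w y)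
  set N := l.length with hN
  have hN0 : 0 < N := by
    have := h 0 (by omega)
    omega
  let p : ℕ → Half S := fun j => l.getD j (l[0]'hN0)
  have hp : ∀ j (hj : j < N), p j = l[j]'hj := fun j hj =>
    List.getD_eq_getElem _ _ hj
  have hpw : ∀ i j, i < j → j < N → (p i).Precedes (R : ℝ) (p j) := fun i j hij hj => by
    rw [hp i (hij.trans hj), hp j hj]
    exact List.pairwise_iff_getElem.1 hl.pairwise i j _ _ hij
  have hpx : ∀ j < N, (principal x).Neg (p j) := fun j hj => by
    rw [hp j hj]
    exact hl.neg _ (List.getElem_mem _)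
  have hpy : ∀ j < N, ¬ (principal y).Neg (p j) := fun j hj => by
    rw [hp j hj]
    exact hl.not_neg _ (List.getElem_mem _)
  have hthr : ∀ u : S, ∃ v ≤ N, ∀ j < N, u ∉ (p j).neg ↔ j < v := fun u =>
    exists_threshold fun i j hij hj hu hu' => hu ((hpw i j hij hj).neg_subset hu')
  choose v hvN hv using hthr
  have hv₁ : ∀ u, v u ≤ chainDist R (Space.ofPoint hS w x) (Space.ofPoint hS w u) := by
    intro u
    have h1 : ChainFromTo (R : ℝ) (Space.ofPoint hS w x).1 (Space.ofPoint hS w u).1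
        (l.take (v u)) := by
      refine ⟨hl.pairwise.sublist (List.take_sublist _ _), fun q hq =>
        hl.neg q (List.mem_of_mem_take hq), fun q hq => ?_⟩
      obtain ⟨j, hj, rfl⟩ := List.mem_take_iff_getElem.1 hq
      have hjN : j < N := by omega
      rw [← hp j hjN]
      change ¬ (principal u).Neg _
      rw [Ultra.principal_neg_iff]
      exact (hv u j hjN).2 (by omega)
    have h2 := h1.length_le
    rw [List.length_take, min_eq_left (hvN u)] at h2
    exact h2
  have hv₂ : ∀ u, N - v u ≤ chainDist R (Space.ofPoint hS w u) (Space.ofPoint hS w y) := by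
    intro u
    have h1 : ChainFromTo (R : ℝ) (Space.ofPoint hS w u).1 (Space.ofPoint hS w y).1
        (l.drop (v u)) := by
      refine ⟨hl.pairwise.sublist (List.drop_sublist _ _), fun q hq => ?_, fun q hq =>
        hl.not_neg q (List.mem_of_mem_drop hq)⟩
      obtain ⟨j, hj, rfl⟩ := List.mem_drop_iff_getElem.1 hq
      have hjN : v u + j < N := by omega
      rw [← hp _ hjN]
      change (principal u).Neg _
      rw [Ultra.principal_neg_iff]
      by_contra hm
      have := (hv u _ hjN).1 hm
      omega
    have h2 := h1.length_le
    rw [List.length_drop] at h2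
    exact h2
  have hstep : ∀ b < n, v (z b) + 4 ≤ v (z (b + 1)) := by
    intro b hb
    have h1 := hv₁ (z b)
    have h2 := hv₂ (z (b + 1))
    have h3 := h b hb
    have h4 := hvN (z b)
    have h5 := hvN (z (b + 1))
    omega
  have hmono : ∀ b b', b < b' → b' ≤ n → v (z b) + 4 ≤ v (z b') := by
    intro b b' hbb
    induction b', hbb using Nat.le_induction with
    | base => exact fun hb => hstep b hb
    | succ b' hb ih =>
      intro hb'
      have := ih (by omega)
      have := hstep b' hb'
      omega
  refine ⟨fun b => (p (v (z b) + 1)).curtain, fun b => (p (v (z b) + 2)).curtain, ?_, ?_, ?_, ?_,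
    hz⟩
  · intro b hb
    have h1 := hstep b hb
    have h2 := hvN (z (b + 1))
    exact hpw _ _ (by omega) (by omega)
  · intro b b' hbb hb'
    have h1 := hmono b b' hbb hb'.le
    have h2 := hstep b' hb'
    have h3 := hvN (z (b' + 1))
    exact hpw _ _ (by omega) (by omega)
  · intro b hb
    have h1 := hstep b hb
    have h2 := hvN (z (b + 1))
    refine (hpw (v (z b)) _ (by omega) (by omega)).neg_subset_minus ?_
    by_contra hm
    exact lt_irrefl _ ((hv (z b) (v (z b)) (by omega)).1 hm)
  · intro b hb
    have h1 := hstep b hb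
    have h2 := hvN (z (b + 1))
    exact (hpw (v (z b) + 2) (v (z b) + 3) (by omega) (by omega)).mem_plus
      ((hv (z (b + 1)) (v (z b) + 3) (by omega)).2 (by omega))

/-- Morse property of paths in `S` that are quasigeodesics in the universal space. -/
theorem exists_dist_le_of_isQuasigeodesicOn (hS : IsGeodesicSpace S) (w : Weights) {L K C : ℝ}
    (hL : 0 ≤ L) (hK : 1 ≤ K) (hC : 0 ≤ C) {l m ρ : ℝ} (hl : 1 ≤ l) (hm : 0 ≤ m) (hρ : 0 ≤ ρ) :
    ∃ E : ℝ, ∀ (y : ℕ → S) (N : ℕ),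
      (∀ i ≤ N, ∀ j ≤ N, dist (y i) (y j) ≤ L * |(i : ℝ) - j|) →
      (∀ i ≤ N, ∀ j ≤ N,
        |(i : ℝ) - j| / K - C ≤ dist (Space.ofPoint hS w (y i)) (Space.ofPoint hS w (y j))) →
      ∀ (q : ℝ → S) (a b : ℝ), IsQuasigeodesicOn dist l m q a b →
      dist (q a) (y 0) ≤ ρ → dist (q b) (y N) ≤ ρ →
      ∀ t ∈ Icc a b, ∃ i ≤ N, dist (q t) (y i) ≤ E := by
  obtain ⟨R, K', C', hK', hC', hR⟩ := exists_le_chainDist hS w hL hK hC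
  set σ : ℝ := ∑' R : ℕ+, (w.lam R : ℝ) with hσ
  have hσ0 : 0 ≤ σ := tsum_nonneg fun R => (w.lam R).2
  have hσL : 0 ≤ σ * L := by positivity
  obtain ⟨B, hB⟩ := exists_gromovProduct_le (isFourPointHyperbolic_space hS w)
    (isRoughlyGeodesic_space hS w) (K := K + σ * L) (C := C + 2 * σ) (by linarith) (by positivity)
  have hlam : (0 : ℝ) < w.lam R := w.pos R
  -- Over M steps d_R grows by at least 4, even after the loss of 2B/λ_R, where 2B bounds the defect
  -- of two successive triangle inequalities in X. Hence the points taken at intervals of M carry a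
  -- ladder.
  obtain ⟨M, hM⟩ := exists_nat_ge (max 1 (K' * (4 + 2 * B / w.lam R + C')))
  have hM1 : 1 ≤ M := by exact_mod_cast (le_max_left _ _).trans hM
  have hM2 : 4 + 2 * B / w.lam R ≤ M / K' - C' := by
    have h1 := (le_max_right _ _).trans hM
    rw [le_sub_iff_add_le, le_div_iff₀' (by linarith)]
    exact h1
  set κ : ℝ := L * M with hκ
  have hκ0 : 0 ≤ κ := by positivity
  obtain ⟨E, hE⟩ := exists_dist_le_of_ladder hS (R := (R : ℝ)) (κ := κ) (by positivity) hκ0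
    hl hm (ρ := ρ + κ) (by positivity)
  refine ⟨max E (l * (l * (2 * (ρ + κ) + m)) + m + (ρ + κ)), fun y N hup hlow q a b hq ha hb t ht =>
    ?_⟩
  have hnear : ∀ i j, i ≤ j → j ≤ N → j ≤ i + M → dist (y i) (y j) ≤ κ := by
    intro i j hij hj hjM
    refine (hup i (by omega) j hj).trans ?_
    have h1 : (i : ℝ) ≤ j := by exact_mod_cast hij
    have h2 : (j : ℝ) ≤ i + M := by exact_mod_cast hjM
    rw [abs_of_nonpos (by linarith)]
    exact mul_le_mul_of_nonneg_left (by linarith) hL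
  by_cases hNM : N < M
  · refine ⟨0, Nat.zero_le _, le_trans ?_ (le_max_right _ _)⟩
    refine hq.dist_le_of_between hl le_rfl ht.1 ht.2 le_rfl (by linarith) ?_
    have := hnear 0 N (Nat.zero_le _) le_rfl (by omega)
    have := dist_triangle_right (q b) (y 0) (y N)
    linarith
  · set n := N / M with hn
    have hn1 : 1 ≤ n := (Nat.one_le_div_iff hM1).2 (by omega)
    have hnN : n * M ≤ N := Nat.div_mul_le_self N M
    have hNn : N ≤ n * M + M := by
      have := Nat.lt_div_mul_add (a := N) hM1
      rw [← hn] at this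
      omega
    have hbM : ∀ b ≤ n, b * M ≤ N := fun b hb => (Nat.mul_le_mul_right M hb).trans hnN
    have hX : ∀ i, i ≤ N → IsDiscreteQuasigeodesic (K + σ * L) (C + 2 * σ)
        (fun j => Space.ofPoint hS w (y (i + j))) (N - i) := by
      intro i hi j hj k hk
      have h1 := hup (i + j) (by omega) (i + k) (by omega)
      have h2 := hlow (i + j) (by omega) (i + k) (by omega)
      push_cast at h1 h2
      rw [add_sub_add_left_eq_sub] at h1 h2
      have h3 := dist_ofPoint_le hS (w := w) (y (i + j)) (y (i + k))
      constructor
      · have h4 : |(j : ℝ) - k| / (K + σ * L) ≤ |(j : ℝ) - k| / K := by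
          gcongr
          linarith
        linarith
      · have h4 : σ * (dist (y (i + j)) (y (i + k)) + 2) ≤ σ * (L * |(j : ℝ) - k| + 2) := by gcongr
        have h5 : 0 ≤ K * |(j : ℝ) - k| := by positivity
        linarith
    have htriple : ∀ i k, i ≤ k → k ≤ N →
        dist (Space.ofPoint hS w (y 0)) (Space.ofPoint hS w (y i)) +
          dist (Space.ofPoint hS w (y i)) (Space.ofPoint hS w (y k)) +
          dist (Space.ofPoint hS w (y k)) (Space.ofPoint hS w (y N)) ≤
        dist (Space.ofPoint hS w (y 0)) (Space.ofPoint hS w (y N)) + 2 * B := by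
      intro i k hik hk
      have h1 := hB _ _ (hX 0 (Nat.zero_le _)) i (by omega)
      have h2 := hB _ _ (hX i (by omega)) (k - i) (by omega)
      simp only [zero_add, Nat.sub_zero, add_zero] at h1 h2
      rw [Nat.add_sub_cancel' hik, Nat.add_sub_cancel' (hik.trans hk)] at h2
      linarith
    obtain ⟨𝔥, 𝔨, hLad⟩ := exists_ladder (w := w) hS (R := R) (x := y 0) (y := y N) hn1
      (z := fun b => y (b * M)) (κ := κ) (fun b hb => by
        have h1 := hbM (b + 1) hb
        rw [Nat.succ_mul] at h1
        rw [Nat.succ_mul]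
        exact hnear _ _ (by omega) h1 le_rfl) (fun b hb => by
        have h1 := hbM (b + 1) hb
        have h2 : b * M ≤ (b + 1) * M := Nat.mul_le_mul_right M (Nat.le_succ b)
        have h3 := mul_chainDist_add_le R (htriple _ _ h2 h1)
        have h4 := hR M (y (b * M)) (y ((b + 1) * M)) (by
          rw [Nat.succ_mul] at h1 ⊢
          exact hnear _ _ (by omega) h1 le_rfl) (by
          have h5 := hlow (b * M) (h2.trans h1) _ h1
          push_cast at h5
          rw [show (b : ℝ) * M - (b + 1) * M = -M by ring, abs_neg, Nat.abs_cast] at h5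
          exact h5)
        rw [← sub_le_iff_le_add', ← mul_sub, ← le_div_iff₀' hlam] at h3
        have h6 : ((chainDist R (Space.ofPoint hS w (y 0)) (Space.ofPoint hS w (y (b * M))) + 4 +
            chainDist R (Space.ofPoint hS w (y ((b + 1) * M))) (Space.ofPoint hS w (y N)) : ℕ) : ℝ)
            ≤ chainDist R (Space.ofPoint hS w (y 0)) (Space.ofPoint hS w (y N)) := by
          push_cast
          linarith
        exact_mod_cast h6)
    obtain ⟨i, hi, h⟩ := hE n 𝔥 𝔨 _ hn1 hLad q a b hq (by
      rw [zero_mul]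
      linarith) (by
      have := hnear (n * M) N hnN le_rfl hNn
      have := dist_triangle_right (q b) (y (n * M)) (y N)
      linarith) t ht
    exact ⟨i * M, hbM i hi.le, h.trans (le_max_left _ _)⟩

end ChainLadder

/-! ## Subgroups that embed quasiisometrically in the universal space are stable -/

section OfQIEmbedding

variable {S : Type*} [MetricSpace S] {G : Type*} [Group G] [MulAction G S] {T : Set G} {s : S}
  {K : ℝ}

theorem isQuasigeodesicOn_smul_floor (hK : 1 ≤ K)
    (hd : ∀ g h : G, dist (g • s) (h • s) ≤ K * wordDist T g h ∧
      wordDist T g h ≤ K * dist (g • s) (h • s) + K)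
    {p : ℕ → G} {n : ℕ} (hp : ∀ i ≤ n, ∀ j ≤ n, wordDist T (p i) (p j) = |(i : ℝ) - j|) :
    IsQuasigeodesicOn dist K (K + 2) (fun t => p ⌊t⌋₊ • s) 0 n := fun t ht t' ht' => by
  have h1 := isDiscreteQuasigeodesic_smul (s := s) hK hd hp ⌊t⌋₊ (Nat.floor_le_of_le ht.2) ⌊t'⌋₊
    (Nat.floor_le_of_le ht'.2)
  have h2 : |((⌊t⌋₊ : ℝ) - ⌊t'⌋₊) - (t - t')| ≤ 1 := by
    have := Nat.floor_le ht.1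
    have := Nat.lt_floor_add_one t
    have := Nat.floor_le ht'.1
    have := Nat.lt_floor_add_one t'
    exact abs_le.2 ⟨by linarith, by linarith⟩
  have h3 := abs_sub_abs_le_abs_sub ((⌊t⌋₊ : ℝ) - ⌊t'⌋₊) (t - t')
  have h4 := abs_sub_abs_le_abs_sub (t - t') ((⌊t⌋₊ : ℝ) - ⌊t'⌋₊)
  rw [abs_sub_comm (t - t')] at h4
  constructor
  · have h5 : |t - t'| / K ≤ (|(⌊t⌋₊ : ℝ) - ⌊t'⌋₊| + 1) / K := by
      gcongr
      linarith
    have h6 : 1 / K ≤ 1 := (div_le_one (by linarith)).2 hK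
    rw [add_div] at h5
    linarith [h1.1]
  · have h5 : K * |(⌊t⌋₊ : ℝ) - ⌊t'⌋₊| ≤ K * (|t - t'| + 1) := by
      gcongr
      linarith
    linarith [h1.2]

theorem IsQuasigeodesicOn.smul (hK : 1 ≤ K)
    (hd : ∀ g h : G, dist (g • s) (h • s) ≤ K * wordDist T g h ∧
      wordDist T g h ≤ K * dist (g • s) (h • s) + K)
    {l m : ℝ} (hl : 1 ≤ l) (hm : 0 ≤ m) {q : ℝ → G} {a b : ℝ}
    (hq : IsQuasigeodesicOn (wordDist T) l m q a b) :
    IsQuasigeodesicOn dist (K * l) (K * m + 1) (fun t => q t • s) a b := fun t ht t' ht' => by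
  have h1 := hq t ht t' ht'
  have h2 := hd (q t) (q t')
  have hl0 : 0 < l := by linarith
  have hK0 : 0 < K := by linarith
  constructor
  · rw [mul_comm K l, ← div_div, sub_le_iff_le_add, div_le_iff₀' hK0]
    have h3 : 1 * 1 * m ≤ K * K * m := by gcongr
    linarith
  · have h3 := mul_le_mul_of_nonneg_left h1.2 hK0.le
    linarith

/-- The piece of a path between two of its indices, traversed backwards if necessary. -/
theorem exists_subpath {N i j : ℕ} (hi : i ≤ N) (hj : j ≤ N) :
    ∃ (f : ℕ → ℕ) (n : ℕ), (∀ k ≤ n, f k ≤ N) ∧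
      (∀ k ≤ n, ∀ k' ≤ n, |(f k : ℝ) - f k'| = |(k : ℝ) - k'|) ∧ f 0 = i ∧ f n = j := by
  rcases le_total i j with h | h
  · refine ⟨fun k => i + k, j - i, fun k hk => by dsimp only; omega,
      fun k _ k' _ => ?_, rfl, by dsimp only; omega⟩
    push_cast
    rw [add_sub_add_left_eq_sub]
  · refine ⟨fun k => i - k, i - j, fun k hk => by dsimp only; omega,
      fun k hk k' hk' => ?_, rfl, by dsimp only; omega⟩
    rw [Nat.cast_sub (by omega), Nat.cast_sub (by omega), sub_sub_sub_cancel_left, abs_sub_comm]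

variable [Nonempty S] [IsIsometricSMul G S]

/-- The distance of X is coarsely bounded by that of S, and hence by the word metric of G, so H is
undistorted. A word geodesic η of H is quasigeodesic in X, so quasigeodesics of S with ends near it
stay near it. This applies both to a geodesic of G with the same ends and to any quasigeodesic that
is to be compared with that geodesic. -/
theorem isStable_of_isQIEmbedding (hS : IsGeodesicSpace S) (w : Weights)
    (hp : IsProperAction G S) (hc : IsCoboundedAction G S) (hfin : T.Finite)
    (hT : Subgroup.closure T = ⊤) {H : Subgroup G} {U : Set H} (hUfin : U.Finite)
    (hU : Subgroup.closure U = ⊤) {x : Space S w}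
    (hx : IsQIEmbedding (wordDist U) dist (fun h : H => (h : G) • x)) : IsStable T H U := by
  obtain ⟨s, r, hr⟩ := hc
  obtain ⟨K₀, C₀, hK₀, hC₀, hqi⟩ := hx
  obtain ⟨K, hK, hd⟩ := exists_wordDist_le hS hp hr hT hfin
  have : IsIsometricSMul H S := ⟨fun h => isometry_smul S (h : G)⟩
  obtain ⟨L, hL, hLd⟩ := dist_smul_le_wordDist hU hUfin s
  replace hLd : ∀ g h : H, dist ((g : G) • s) ((h : G) • s) ≤ L * wordDist U g h := hLd
  set e : ℝ := dist x (Space.ofPoint hS w s) with he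
  have he0 : 0 ≤ e := dist_nonneg
  set σ : ℝ := ∑' R : ℕ+, (w.lam R : ℝ) with hσ
  have hσ0 : 0 ≤ σ := tsum_nonneg fun R => (w.lam R).2
  set C : ℝ := C₀ + 2 * e with hC
  have hC0 : 0 ≤ C := by positivity
  have hlow : ∀ g h : H, wordDist U g h / K₀ - C ≤
      dist (Space.ofPoint hS w ((g : G) • s)) (Space.ofPoint hS w ((h : G) • s)) := by
    intro g h
    have h1 := (hqi g h).1
    have h2 := (abs_le.1 (abs_dist_smul_sub_le hS x s (g : G) (h : G))).2
    linarith
  have hlowS : ∀ g h : H, wordDist U g h / K₀ - C ≤ σ * (dist ((g : G) • s) ((h : G) • s) + 2) :=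
    fun g h => (hlow g h).trans (dist_ofPoint_le hS _ _)
  refine ⟨⟨K₀ * (σ * K + 1) + K * L, C + 2 * σ + K, ?_, by positivity, fun g h => ?_⟩, ?_⟩
  · have h1 : 1 * (0 + 1) ≤ K₀ * (σ * K + 1) := by
      gcongr
      positivity
    have h2 : 0 ≤ K * L := by positivity
    linarith
  · have h1 := hlowS g h
    have h2 := hd (g : G) (h : G)
    have h3 := hLd g h
    have hW : 0 ≤ wordDist U g h := wordDist_nonneg _ _
    have hW' : 0 ≤ wordDist T (g : G) h := wordDist_nonneg _ _
    constructor
    · have h4 : σ * (dist ((g : G) • s) ((h : G) • s) + 2) ≤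
          σ * (K * wordDist T (g : G) h + 2) := by
        gcongr
        exact h2.1
      have h5 : wordDist U g h / (K₀ * (σ * K + 1) + K * L) ≤
          wordDist U g h / (K₀ * (σ * K + 1)) := by
        gcongr
        have : 0 ≤ K * L := by positivity
        linarith
      have h6 : wordDist U g h / (K₀ * (σ * K + 1)) - (C + 2 * σ) / (σ * K + 1) ≤
          wordDist T (g : G) h := by
        rw [← div_div, ← sub_div, div_le_iff₀' (by positivity)]
        linarith
      have h7 : (C + 2 * σ) / (σ * K + 1) ≤ C + 2 * σ := by
        refine div_le_self (by positivity) ?_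
        have : 0 ≤ σ * K := by positivity
        linarith
      linarith
    · have h4 : K * dist ((g : G) • s) ((h : G) • s) ≤ K * (L * wordDist U g h) := by gcongr
      have h5 : 0 ≤ K₀ * (σ * K + 1) * wordDist U g h := by positivity
      linarith [h2.2]
  choose! E hE using fun (l m ρ : ℝ) (hl : 1 ≤ l) (hm : 0 ≤ m) (hρ : 0 ≤ ρ) =>
    exists_dist_le_of_isQuasigeodesicOn hS w (L := L) (K := K₀) (C := C) (by linarith) hK₀ hC0
      hl hm hρ
  set C₁ : ℝ := max (E K (K + 2) 0) 0 with hC₁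
  have hC₁0 : 0 ≤ C₁ := le_max_right _ _
  set K₂ : ℝ := K₀ * (σ + 1) + L with hK₂
  have hK₂1 : 1 ≤ K₂ := by
    have : 0 ≤ K₀ * (σ + 1) := by positivity
    linarith
  set C₂ : ℝ := C₁ + (K₂ * (K₂ * (K * 1 + (K + 2) + 2 * C₁ + (C + 2 * σ))) + (C + 2 * σ)) with hC₂
  refine ⟨fun l m => K * (E (K * l) (K * m + 1) C₁ + C₂) + K, ?_⟩
  rintro _ ⟨n, p, hp0, hpn, hpd, rfl⟩
  obtain ⟨N, η, hη0, hηN, hη⟩ := exists_word_geodesic hU ⟨p 0, hp0⟩ ⟨p n, hpn⟩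
  have hη0' : (η 0 : G) = p 0 := by rw [hη0]
  have hηN' : (η N : G) = p n := by rw [hηN]
  have hup : ∀ i ≤ N, ∀ j ≤ N, dist ((η i : G) • s) ((η j : G) • s) ≤ L * |(i : ℝ) - j| :=
    fun i hi j hj => by
      rw [← hη i hi j hj]
      exact hLd _ _
  have hηX : ∀ i ≤ N, ∀ j ≤ N, |(i : ℝ) - j| / K₀ - C ≤
      dist (Space.ofPoint hS w ((η i : G) • s)) (Space.ofPoint hS w ((η j : G) • s)) :=
    fun i hi j hj => by
      rw [← hη i hi j hj]
      exact hlow _ _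
  have hηS : IsDiscreteQuasigeodesic K₂ (C + 2 * σ) (fun i => (η i : G) • s) N := by
    intro i hi j hj
    have h1 := hup i hi j hj
    have h2 := (hηX i hi j hj).trans (dist_ofPoint_le hS _ _)
    have hd0 : 0 ≤ dist ((η i : G) • s) ((η j : G) • s) := dist_nonneg
    constructor
    · have h5 : |(i : ℝ) - j| / K₂ ≤ |(i : ℝ) - j| / (K₀ * (σ + 1)) := by
        gcongr
        linarith
      have h6 : |(i : ℝ) - j| / (K₀ * (σ + 1)) - (C + 2 * σ) / (σ + 1) ≤
          dist ((η i : G) • s) ((η j : G) • s) := by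
        rw [← div_div, ← sub_div, div_le_iff₀' (by positivity)]
        linarith
      have h7 : (C + 2 * σ) / (σ + 1) ≤ C + 2 * σ := div_le_self (by positivity) (by linarith)
      linarith
    · have h5 : 0 ≤ K₀ * (σ + 1) * |(i : ℝ) - j| := by positivity
      linarith
  have hq₀ := isQuasigeodesicOn_smul_floor (s := s) hK hd hpd
  have near₁ : ∀ t ∈ Icc (0 : ℝ) n, ∃ i ≤ N, dist (p ⌊t⌋₊ • s) ((η i : G) • s) ≤ C₁ := by
    intro t ht
    obtain ⟨i, hi, h⟩ := hE K (K + 2) 0 hK (by linarith) le_rfl (fun i => (η i : G) • s) N hup hηX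
      _ 0 n hq₀ (by simp [hη0']) (by simp [hηN']) t ht
    exact ⟨i, hi, h.trans (le_max_left _ _)⟩
  have near₂ : ∀ i ≤ N, ∃ j ≤ n, dist (p j • s) ((η i : G) • s) ≤ C₂ := by
    intro i hi
    obtain ⟨t, ht, h⟩ := hηS.exists_dist_le hK₂1 (Nat.cast_nonneg n) (J := K * 1 + (K + 2))
      (by positivity) (fun t ht t' ht' htt => (hq₀ t ht t' ht').2.trans (by gcongr)) near₁
      (by simpa [hη0'] using hC₁0) (by simpa [hηN'] using hC₁0) hi
    exact ⟨_, Nat.floor_le_of_le ht.2, h⟩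
  intro l m hl hm q a b hab hq ha hb t ht
  have near₃ : ∀ g ∈ p '' Iic n, ∃ i ≤ N, dist (g • s) ((η i : G) • s) ≤ C₁ := by
    rintro _ ⟨j, hj, rfl⟩
    obtain ⟨i, hi, h⟩ := near₁ j ⟨Nat.cast_nonneg j, by exact_mod_cast hj⟩
    rw [Nat.floor_natCast] at h
    exact ⟨i, hi, h⟩
  obtain ⟨i, hi, hia⟩ := near₃ _ ha
  obtain ⟨j, hj, hjb⟩ := near₃ _ hb
  -- The ends of q are near points of η in the interior, possibly in reversed order, so the estimate
  -- is applied to the piece of η between them.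
  obtain ⟨f, N', hfN, hfd, hf0, hfN'⟩ := exists_subpath hi hj
  obtain ⟨k, hk, hkt⟩ := hE (K * l) (K * m + 1) C₁ (by nlinarith) (by positivity) hC₁0
    (fun k => (η (f k) : G) • s) N'
    (fun k hk k' hk' => by
      rw [← hfd k hk k' hk']
      exact hup _ (hfN k hk) _ (hfN k' hk'))
    (fun k hk k' hk' => by
      rw [← hfd k hk k' hk']
      exact hηX _ (hfN k hk) _ (hfN k' hk'))
    _ a b (hq.smul hK hd hl hm) (by simpa only [hf0] using hia) (by simpa only [hfN'] using hjb) t ht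
  obtain ⟨j', hj', h⟩ := near₂ (f k) (hfN k hk)
  refine ⟨p j', mem_image_of_mem p hj', ?_⟩
  have h1 := (hd (q t) (p j')).2
  have h2 : dist (q t • s) (p j' • s) ≤ E (K * l) (K * m + 1) C₁ + C₂ := by
    have := dist_triangle_right (q t • s) (p j' • s) ((η (f k) : G) • s)
    linarith
  have h3 := mul_le_mul_of_nonneg_left h2 (show 0 ≤ K by linarith)
  linarith

end OfQIEmbedding

end UniversalSpace

theorem mainTheorem4 {S : Type*} [MetricSpace S] [Nonempty S] (hS : IsGeodesicSpace S)
    (hMorse : ∀ M : ℝ → ℝ → ℝ, ∃ D : ℝ, ∀ A : Set S, IsGeodesicSet A → IsMorse dist M A →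
      StronglyContracting A D)
    (w : Weights) :
    (∀ s : S, ∃ x : Space S w, x.1 = principal s) ∧
    IsFourPointHyperbolic (Space S w) ∧ IsRoughlyGeodesic (Space S w) ∧
    ∀ {G : Type*} [Group G] [MulAction G S] [IsIsometricSMul G S],
      IsProperAction G S → IsCoboundedAction G S →
        Group.FG G ∧
        ∀ T : Set G, T.Finite → Subgroup.closure T = ⊤ →
        ∀ (H : Subgroup G) (U : Set H), U.Finite → Subgroup.closure U = ⊤ →
        ∀ x : Space S w,
          IsStable T H U ↔ IsQIEmbedding (wordDist U) dist (fun h : H => (h : G) • x) := by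
  refine ⟨fun s => ⟨Space.ofPoint hS w s, rfl⟩, isFourPointHyperbolic_space hS w,
    isRoughlyGeodesic_space hS w, ?_⟩
  intro G _ _ _ hp hc
  exact ⟨group_fg_of_proper_cobounded hS hp hc, fun T hTfin hT H U hUfin hU x =>
    ⟨fun hH => isQIEmbedding_of_isStable hS hMorse w hp hc hTfin hT hH x,
      fun hx => isStable_of_isQIEmbedding hS w hp hc hTfin hT hUfin hU hx⟩⟩
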